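/- Let $k$ be an algebraically closed field, let $n\ge 1$, and let $H\cong\mathbf P^{n-1}$ be a hyperplane of $\mathbf P^n=\mathbf P^n_k$. A closed subscheme $Y\subset\mathbf P^n$ with ideal sheaf $\mathcal I_Y$ is called *numerically adjusted in degree $d$* if $\chi(\mathbf P^n,\mathcal I_Y(d))=0$, and *adjusted in degree $d$* if $h^i(\mathbf P^n,\mathcal I_Y(d))=0$ for all $i\ge 0$. For $s\ge 0$, an *$s$-complex* is the intersection $U\cap K$, where $U$ is the union of the $\frac{(s+2)(s+1)}2$ lines joining $s+2$ closed points of $\mathbf P^n$ two by two (with $s\le n-1$), and $K$ is a hyperplane of $\mathbf P^n$ containing none of these points; for $s<0$ the $s$-complex is the empty set. **Proposition 6.3.** Let $u,a,b,v\ge 0$ and $l\ge -1$ be integers, with $v\le 1$, and $v=0$ if $n=2$, such that 1. $a\ge n-1$; 2. either $\displaystyle \frac1n\binom{n+3}{4}+\frac{n-1}{2}\ \ge\ a+b\ \ge\ \frac{n(n-1)}{2}$, or one of the following holds: $n=4,\ a=5,\ b=v=0,\ l=-1$; $\quad n=5,\ a=8,\ b=0,\ v=1,\ l=-1$; $\quad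 n=6,\ a=14,\ b=v=0,\ l=-1$; 3. $0\le b<n$; 4. $-1\le l\le \frac{n+2}{2}$. Let $Y$ be the generic union in $\mathbf P^n$ of * the first infinitesimal neighbourhoods of $u$ closed points of $\mathbf P^n$, * an $(l-2)$-complex of $\mathbf P^n$ (cut out by a generic hyperplane $K$, not by $H$), * $a$ closed points of $H$, * $b$ finite closed subschemes of degree two of $\mathbf P^n$, each transverse to $H$ and supported at a closed point of $H$, * the first infinitesimal neighbourhoods in $\mathbf P^n$ of $v$ closed points of $H$. If $Y$ is numerically adjusted in degree $3$, then $Y$ is adjusted in degree $3$. (Here "generic" means: for all choices of the data in a nonempty Zariski open subset of the irreducible variety that parametrizes them.) -/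

import Mathlib

/-!
Closed subschemes of the projective space `P^n` over a field `k` are given by homogeneous ideals of
`k[x_0, …, x_n]`; the union of two subschemes is given by the intersection of their ideals.  Points
and linear subspaces of `P^n` are given by linear subspaces of `k^(n+1)`.
-/

noncomputable section

namespace ProjSpace

variable {k : Type*} [Field k] {n : ℕ}

/-- The ring `k[x_0^±1, …, x_n^±1]` of Laurent polynomials.  It contains the localization of
`k[x_0, …, x_n]` at every product of variables. -/
abbrev Laurent (k : Type*) [Field k] (n : ℕ) : Type _ := AddMonoidAlgebra k (Fin (n + 1) → ℤ)

/-- The inclusion `k[x_0, …, x_n] → k[x_0^±1, …, x_n^±1]`. -/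
def toLaurent (k : Type*) [Field k] (n : ℕ) :
    MvPolynomial (Fin (n + 1)) k →ₐ[k] Laurent k n :=
  MvPolynomial.aeval fun i => AddMonoidAlgebra.single (Pi.single i 1) 1

/-- For a homogeneous ideal `I` with associated ideal sheaf `𝓘`, the sections of `𝓘(d)` over the
affine open set `{x_i ≠ 0 for all i ∈ T}`, that is, the part of degree `d` of the localization of
`I` at `x_T = ∏_{i ∈ T} x_i`: the Laurent polynomials `f / x_T ^ N` with `f ∈ I` homogeneous of
degree `d + N * #T`. -/
def sections (I : Ideal (MvPolynomial (Fin (n + 1)) k)) (d : ℕ) (T : Finset (Fin (n + 1))) :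
    Submodule k (Laurent k n) where
  carrier := {g | ∃ (N : ℕ) (f : MvPolynomial (Fin (n + 1)) k),
    f ∈ I ∧ f.IsHomogeneous (d + N * T.card) ∧
      toLaurent k n f = toLaurent k n (∏ i ∈ T, MvPolynomial.X i) ^ N * g}
  zero_mem' := ⟨0, 0, I.zero_mem, MvPolynomial.isHomogeneous_zero _ _ _, by simp⟩
  add_mem' := by
    rintro g₁ g₂ ⟨N, f₁, hI₁, hd₁, e₁⟩ ⟨M, f₂, hI₂, hd₂, e₂⟩
    have hx : (∏ i ∈ T, (MvPolynomial.X i : MvPolynomial (Fin (n + 1)) k)).IsHomogeneous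
        T.card := by
      simpa using MvPolynomial.IsHomogeneous.prod T
        (fun i => (MvPolynomial.X i : MvPolynomial (Fin (n + 1)) k)) (fun _ => 1)
        (fun i _ => MvPolynomial.isHomogeneous_X k i)
    refine ⟨N + M, (∏ i ∈ T, MvPolynomial.X i) ^ M * f₁ + (∏ i ∈ T, MvPolynomial.X i) ^ N * f₂,
      I.add_mem (I.mul_mem_left _ hI₁) (I.mul_mem_left _ hI₂), ?_, ?_⟩
    · refine MvPolynomial.IsHomogeneous.add ?_ ?_
      · have h := (hx.pow M).mul hd₁
        rwa [show T.card * M + (d + N * T.card) = d + (N + M) * T.card by ring] at h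
      · have h := (hx.pow N).mul hd₂
        rwa [show T.card * N + (d + M * T.card) = d + (N + M) * T.card by ring] at h
    · rw [map_add, map_mul, map_mul, map_pow, map_pow, e₁, e₂]
      ring
  smul_mem' := by
    rintro c g ⟨N, f, hI, hd, e⟩
    refine ⟨N, c • f, Submodule.smul_of_tower_mem I c hI, ?_, ?_⟩
    · rw [MvPolynomial.smul_eq_C_mul]
      simpa using (MvPolynomial.isHomogeneous_C _ c).mul hd
    · rw [map_smul, e, mul_smul_comm]

/-- The Čech cochains of degree `p` of `𝓘(d)` for the covering of `P^n` by the standard affine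
open sets `{x_i ≠ 0}`: families of sections indexed by the sets `T` of `p + 1` coordinates (and
extended by `0` to all other sets of coordinates). -/
def cochains (I : Ideal (MvPolynomial (Fin (n + 1)) k)) (d p : ℕ) :
    Submodule k (Finset (Fin (n + 1)) → Laurent k n) :=
  Submodule.pi Set.univ fun T => if T.card = p + 1 then sections I d T else ⊥

/-- The Čech differential
`(δ c) {i_0 < … < i_p} = ∑_j (-1)^j c {i_0 < … < i_p without i_j}`. -/
def differential (k : Type*) [Field k] (n : ℕ) :
    (Finset (Fin (n + 1)) → Laurent k n) →ₗ[k] (Finset (Fin (n + 1)) → Laurent k n) :=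
  LinearMap.pi fun T => ∑ i ∈ T,
    ((-1 : k) ^ (T.filter (· < i)).card) • LinearMap.proj (T.erase i)

/-- The Čech cocycles of degree `p`. -/
def cocycles (I : Ideal (MvPolynomial (Fin (n + 1)) k)) (d p : ℕ) :
    Submodule k (Finset (Fin (n + 1)) → Laurent k n) :=
  cochains I d p ⊓ LinearMap.ker (differential k n)

/-- The Čech coboundaries of degree `p`. -/
def coboundaries (I : Ideal (MvPolynomial (Fin (n + 1)) k)) (d : ℕ) :
    ℕ → Submodule k (Finset (Fin (n + 1)) → Laurent k n)
  | 0 => ⊥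
  | p + 1 => (cochains I d p).map (differential k n)

/-- The cohomology `H^p(P^n, 𝓘(d))`, where `𝓘` is the ideal sheaf associated with the homogeneous
ideal `I`. -/
abbrev Cohomology (I : Ideal (MvPolynomial (Fin (n + 1)) k)) (d p : ℕ) : Type _ :=
  cocycles I d p ⧸ (coboundaries I d p).submoduleOf (cocycles I d p)

/-- The Euler characteristic `χ(P^n, 𝓘(d)) = ∑_p (-1)^p dim H^p(P^n, 𝓘(d))`. -/
def eulerChar (I : Ideal (MvPolynomial (Fin (n + 1)) k)) (d : ℕ) : ℤ :=
  ∑ p ∈ Finset.range (n + 1), (-1) ^ p * (Module.finrank k (Cohomology I d p) : ℤ)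

/-- The closed subscheme with ideal `I` is numerically adjusted in degree `d`:
`χ(P^n, 𝓘(d)) = 0`. -/
def NumericallyAdjusted (I : Ideal (MvPolynomial (Fin (n + 1)) k)) (d : ℕ) : Prop :=
  eulerChar I d = 0

/-- The closed subscheme with ideal `I` is adjusted in degree `d`:
`H^p(P^n, 𝓘(d)) = 0` for all `p ≥ 0`. -/
def Adjusted (I : Ideal (MvPolynomial (Fin (n + 1)) k)) (d : ℕ) : Prop :=
  ∀ p : ℕ, Subsingleton (Cohomology I d p)

/-- The ideal of the linear subspace `P(W)` of `P^n`: it is generated by the linear forms that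
vanish on `W`. -/
def linearIdeal (W : Submodule k (Fin (n + 1) → k)) : Ideal (MvPolynomial (Fin (n + 1)) k) :=
  Ideal.span {F | ∃ c : Fin (n + 1) → k, (∀ w ∈ W, ∑ i, c i * w i = 0) ∧
    F = ∑ i, MvPolynomial.C (c i) * MvPolynomial.X i}

/-- The ideal of the closed point `[x]`. -/
def pointIdeal (x : Fin (n + 1) → k) : Ideal (MvPolynomial (Fin (n + 1)) k) :=
  linearIdeal (Submodule.span k {x})

/-- The ideal of the first infinitesimal neighbourhood in `P^n` of the closed point `[x]`. -/
def doublePointIdeal (x : Fin (n + 1) → k) : Ideal (MvPolynomial (Fin (n + 1)) k) :=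
  pointIdeal x ^ 2

/-- The ideal of the first infinitesimal neighbourhood of `[x]` in the line joining the distinct
points `[x]` and `[y]`.  These are all the closed subschemes of degree two supported at `[x]`; for
`[x]` in a hyperplane `H`, the scheme is transverse to `H` if and only if `[y]` is not in `H`. -/
def tangentIdeal (x y : Fin (n + 1) → k) : Ideal (MvPolynomial (Fin (n + 1)) k) :=
  linearIdeal (Submodule.span k {x, y}) ⊔ doublePointIdeal x

/-- The ideal of the `(m - 2)`-complex cut out by the hyperplane `κ = 0` on the union of the
`m * (m - 1) / 2` lines which join the points `[x_1], …, [x_m]` two by two: the union of the points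
in which this hyperplane meets the lines. It is empty for `m ≤ 1`. -/
def complexIdeal {m : ℕ} (x : Fin m → Fin (n + 1) → k) (κ : Module.Dual k (Fin (n + 1) → k)) :
    Ideal (MvPolynomial (Fin (n + 1)) k) :=
  ⨅ (i : Fin m) (j : Fin m) (_ : i < j),
    linearIdeal (Submodule.span k {x i, x j} ⊓ LinearMap.ker κ)

/-- A property holds for the generic point of the affine space `E` (a finite dimensional vector
space over an infinite field): it holds on a nonempty Zariski open subset of `E`. -/
def Generically (k : Type*) [Field k] {E : Type*} [AddCommGroup E] [Module k E]
    (P : E → Prop) : Prop :=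
  ∃ F : MvPolynomial (Module.Dual k E) k,
    (∃ e : E, MvPolynomial.eval (fun φ : Module.Dual k E => φ e) F ≠ 0) ∧
      ∀ e : E, MvPolynomial.eval (fun φ : Module.Dual k E => φ e) F ≠ 0 → P e

/-- The homogeneous coordinates of: `u` points of `P^n`; `m` points of `P^n` and a hyperplane, which
determine an `(m - 2)`-complex; `a` points of `H`; `b` pairs formed by a point of `H` and a point
of `P^n`, each determining a degree two scheme supported in `H`; `v` further points of `H`. -/
abbrev Config (H : Submodule k (Fin (n + 1) → k)) (u m a b v : ℕ) : Type _ :=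
  (Fin u → Fin (n + 1) → k) ×
  ((Fin m → Fin (n + 1) → k) × Module.Dual k (Fin (n + 1) → k)) ×
  (Fin a → H) × (Fin b → H × (Fin (n + 1) → k)) × (Fin v → H)

/-- The ideal of the union of: the first infinitesimal neighbourhoods in `P^n` of the `u` points;
the `(m - 2)`-complex; the `a` points of `H`; the `b` schemes of degree two; the first
infinitesimal neighbourhoods in `P^n` of the `v` points of `H`. -/
def Config.ideal {H : Submodule k (Fin (n + 1) → k)} {u m a b v : ℕ} (c : Config H u m a b v) :
    Ideal (MvPolynomial (Fin (n + 1)) k) :=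
  (⨅ i, doublePointIdeal (c.1 i)) ⊓
  complexIdeal c.2.1.1 c.2.1.2 ⊓
  (⨅ i, pointIdeal (c.2.2.1 i : Fin (n + 1) → k)) ⊓
  (⨅ i, tangentIdeal ((c.2.2.2.1 i).1 : Fin (n + 1) → k) (c.2.2.2.1 i).2) ⊓
  (⨅ i, doublePointIdeal (c.2.2.2.2 i : Fin (n + 1) → k))

end ProjSpace

end

/-! Cohomology is traded for linear algebra. When the components of `Y` are supported at distinct
points, `Y` is a finite scheme described by jets (a value and some derivatives) at finitely many
points. The Čech complex then shows that `H^0` of the twisted ideal sheaf is the kernel of the map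
from cubics to jets, `H^1` is its cokernel, and the higher groups vanish
(`JetScheme.cohomologyZeroEquiv`, `cohomologyOneEquiv`, `cocycles_le_coboundaries`). So numerically
adjusted means that `Y` has length `(n+3).choose 3`, and a scheme of this length is adjusted as soon
as no nonzero cubic contains it. The absence of cubics is an open condition (`generically_noForm`),
and nonempty open sets of an affine space over an infinite field meet. It remains to exhibit
configurations in special position.

Special position in space. Double points are placed at the `n + 1` coordinate points, so that the
cubics left are squarefree. The variables are grouped in blocks of three and a last block `U` of at
most three. Further double points are taken in the span of two blocks (three for each pair) and in
the span of a block and `U` (at most two for each block), and a complex has vertices close to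
coordinate points. A linear relation between all these conditions, tested on squarefree monomials,
splits according to the blocks in which the variables lie into a few small systems, nonsingular for
explicit coordinates (`Params.Regular.relation_trivial`). Degree two schemes are added one at a
time: two squarefree cubics with equal logarithmic derivatives are proportional, so some tangent
vector imposes two conditions (`exists_tangent`). When there are only `n` double points, one more is
added and paid for with a degree two scheme and simple points (`exists_special_position`).

Passage to `H`. A linear automorphism brings the supports of the degree two schemes and of the `v`
double points into `H`. For a generic configuration the cubics satisfying all conditions except the
`a` simple points form a space of dimension at most `a`. To cut it down by `a` points of `H`, it
suffices that none of these cubics but zero vanishes on `H`. Such a cubic is the equation of `H`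
times a quadric which is singular at the `u` free double points and contains the complex, the
supports of the degree two schemes and the `v` double points. There is no such quadric
(`generically_no_quadric`, `generically_no_cubic`).

The bounds on `a + b` enter through arithmetic: the lower one keeps the number of double points
within those available in special position, the upper one leaves enough of them for the quadrics to
vanish (`special_position_numerics`). -/

namespace ProjSpace

/-! ### Polynomial functions and generic properties. -/

section Generic

open MvPolynomial

variable {k : Type*} [Field k] {E : Type*} [AddCommGroup E] [Module k E]

/-- The algebra of polynomial functions on a vector space. -/
noncomputable def polyFun (k : Type*) [Field k] (E : Type*) [AddCommGroup E] [Module k E] :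
    Subalgebra k (E → k) :=
  (MvPolynomial.aeval (R := k) fun (φ : Module.Dual k E) (e : E) => φ e).range

theorem mem_polyFun {f : E → k} : f ∈ polyFun k E ↔
    ∃ F : MvPolynomial (Module.Dual k E) k,
      ∀ e, MvPolynomial.eval (fun φ : Module.Dual k E => φ e) F = f e := by
  have key : ∀ (F : MvPolynomial (Module.Dual k E) k) (e : E),
      (MvPolynomial.aeval (R := k) fun (φ : Module.Dual k E) (e : E) => φ e) F e =
        MvPolynomial.eval (fun φ : Module.Dual k E => φ e) F := by
    intro F e
    induction F using MvPolynomial.induction_on with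
    | C a => simp
    | add p q hp hq => simp [hp, hq]
    | mul_X p n hp => simp [hp]
  constructor
  · rintro ⟨F, rfl⟩
    exact ⟨F, fun e => (key F e).symm⟩
  · rintro ⟨F, hF⟩
    exact ⟨F, by ext e; rw [← hF e]; exact key F e⟩

theorem linear_mem_polyFun (φ : E →ₗ[k] k) : (fun e => φ e) ∈ polyFun k E :=
  mem_polyFun.2 ⟨MvPolynomial.X φ, fun e => by simp⟩

theorem const_mem_polyFun (c : k) : (fun _ => c) ∈ polyFun k E :=
  (polyFun k E).algebraMap_mem c

theorem add_mem_polyFun {f g : E → k} (hf : f ∈ polyFun k E) (hg : g ∈ polyFun k E) :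
    (fun e => f e + g e) ∈ polyFun k E := (polyFun k E).add_mem hf hg

theorem sub_mem_polyFun {f g : E → k} (hf : f ∈ polyFun k E) (hg : g ∈ polyFun k E) :
    (fun e => f e - g e) ∈ polyFun k E := (polyFun k E).sub_mem hf hg

theorem mul_mem_polyFun {f g : E → k} (hf : f ∈ polyFun k E) (hg : g ∈ polyFun k E) :
    (fun e => f e * g e) ∈ polyFun k E := (polyFun k E).mul_mem hf hg

theorem sum_mem_polyFun {ι : Type*} (s : Finset ι) {f : ι → E → k}
    (hf : ∀ i ∈ s, f i ∈ polyFun k E) : (fun e => ∑ i ∈ s, f i e) ∈ polyFun k E := by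
  have := (polyFun k E).sum_mem hf
  convert this using 1
  ext e; simp

theorem prod_mem_polyFun {ι : Type*} (s : Finset ι) {f : ι → E → k}
    (hf : ∀ i ∈ s, f i ∈ polyFun k E) : (fun e => ∏ i ∈ s, f i e) ∈ polyFun k E := by
  have := (polyFun k E).prod_mem hf
  convert this using 1
  ext e; simp

theorem eval_mem_polyFun {ι : Type*} {x : E → ι → k}
    (hx : ∀ i, (fun e => x e i) ∈ polyFun k E) (f : MvPolynomial ι k) :
    (fun e => MvPolynomial.eval (x e) f) ∈ polyFun k E := by
  induction f using MvPolynomial.induction_on with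
  | C a => simpa using const_mem_polyFun a
  | add p q hp hq => simpa using add_mem_polyFun hp hq
  | mul_X p n hp => simpa using mul_mem_polyFun hp (hx n)

theorem det_mem_polyFun {ι : Type*} [Fintype ι] [DecidableEq ι] {A : E → Matrix ι ι k}
    (hA : ∀ i j, (fun e => A e i j) ∈ polyFun k E) :
    (fun e => (A e).det) ∈ polyFun k E := by
  simp only [Matrix.det_apply']
  exact sum_mem_polyFun _ fun s _ => mul_mem_polyFun (const_mem_polyFun _)
    (prod_mem_polyFun _ fun i _ => hA _ _)

theorem generically_of_polyFun {P : E → Prop} {f : E → k} (hf : f ∈ polyFun k E) {e₀ : E}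
    (h₀ : f e₀ ≠ 0) (h : ∀ e, f e ≠ 0 → P e) : Generically k P := by
  obtain ⟨F, hF⟩ := mem_polyFun.1 hf
  exact ⟨F, ⟨e₀, by rwa [hF]⟩, fun e he => h e (by rwa [hF] at he)⟩

theorem Generically.mono {P Q : E → Prop} (hP : Generically k P) (h : ∀ e, P e → Q e) :
    Generically k Q := by
  obtain ⟨F, h₀, hF⟩ := hP
  exact ⟨F, h₀, fun e he => h e (hF e he)⟩

theorem Generically.exists {P : E → Prop} (hP : Generically k P) : ∃ e, P e := by
  obtain ⟨F, ⟨e, h₀⟩, hF⟩ := hP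
  exact ⟨e, hF e h₀⟩

theorem generically_of_forall {P : E → Prop} (h : ∀ e, P e) : Generically k P :=
  ⟨1, ⟨0, by simp⟩, fun e _ => h e⟩

theorem exists_polynomial_line (F : MvPolynomial (Module.Dual k E) k) (e d : E) :
    ∃ p : Polynomial k, ∀ t : k, p.eval t =
      MvPolynomial.eval (fun φ : Module.Dual k E => φ (e + t • d)) F := by
  refine ⟨MvPolynomial.eval₂ Polynomial.C
    (fun φ : Module.Dual k E => Polynomial.C (φ e) + Polynomial.X * Polynomial.C (φ d)) F, ?_⟩
  intro t
  induction F using MvPolynomial.induction_on with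
  | C a => simp
  | add p q hp hq => rw [eval₂_add, Polynomial.eval_add, hp, hq, map_add]
  | mul_X p n hp =>
    rw [eval₂_mul, Polynomial.eval_mul, hp, map_mul, eval₂_X, eval_X, Polynomial.eval_add,
      Polynomial.eval_mul, Polynomial.eval_C, Polynomial.eval_X, Polynomial.eval_C, map_add,
      map_smul, smul_eq_mul]

/-- Restricted to the line through a point where the first polynomial is nonzero and a point where
the second is, both become nonzero polynomials in one variable, so their product has a nonroot in
the infinite field. -/
theorem Generically.and [Infinite k] {P Q : E → Prop} (hP : Generically k P)
    (hQ : Generically k Q) : Generically k fun e => P e ∧ Q e := by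
  obtain ⟨F, ⟨e, he⟩, hF⟩ := hP
  obtain ⟨G, ⟨e', he'⟩, hG⟩ := hQ
  obtain ⟨p, hp⟩ := exists_polynomial_line F e (e' - e)
  obtain ⟨q, hq⟩ := exists_polynomial_line G e (e' - e)
  have hp0 : p ≠ 0 := by
    rintro rfl
    have := hp 0
    simp at this
    exact he this.symm
  have hq0 : q ≠ 0 := by
    rintro rfl
    have := hq 1
    simp at this
    exact he' this.symm
  obtain ⟨t, ht⟩ : ∃ t, (p * q).eval t ≠ 0 := by
    by_contra! h
    exact mul_ne_zero hp0 hq0 (Polynomial.funext (by simpa using h))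
  rw [Polynomial.eval_mul, hp, hq] at ht
  exact ⟨F * G, ⟨_, by rwa [map_mul]⟩, fun x hx => by
    rw [map_mul] at hx
    exact ⟨hF x (left_ne_zero_of_mul hx), hG x (right_ne_zero_of_mul hx)⟩⟩

theorem generically_forall [Infinite k] {ι : Type*} [Finite ι] {P : ι → E → Prop}
    (h : ∀ i, Generically k (P i)) : Generically k fun e => ∀ i, P i e := by
  classical
  have := Fintype.ofFinite ι
  suffices H : ∀ s : Finset ι, Generically k fun e => ∀ i ∈ s, P i e from
    (H Finset.univ).mono fun e he i => he i (Finset.mem_univ i)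
  intro s
  induction s using Finset.induction_on with
  | empty => exact generically_of_forall fun e i hi => by simp at hi
  | insert i s _ ih =>
    refine ((h i).and ih).mono fun e he j hj => ?_
    rcases Finset.mem_insert.1 hj with rfl | hj
    · exact he.1
    · exact he.2 j hj

/-- The injectivity of a linear map depending polynomially on a parameter is an open condition. -/
theorem generically_injective {M : Type*} [AddCommGroup M] [Module k M] [Module.Finite k M]
    {R : Type*} [Finite R] (f : E → M → R → k)
    (hlin : ∀ e r, IsLinearMap k fun m => f e m r)
    (hpoly : ∀ m r, (fun e => f e m r) ∈ polyFun k E) {e₀ : E}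
    (h₀ : ∀ m, (∀ r, f e₀ m r = 0) → m = 0) :
    Generically k fun e => ∀ m, (∀ r, f e m r = 0) → m = 0 := by
  classical
  have := Fintype.ofFinite R
  let A : E → M →ₗ[k] (R → k) := fun e => LinearMap.pi fun r => (hlin e r).mk' _
  have hA : ∀ e m r, A e m r = f e m r := fun e m r => rfl
  -- With `B` a left inverse of `A e₀`, the determinant of `B ∘ A e` is polynomial in `e`, equals
  -- one at `e₀`, and forces injectivity of `A e` wherever it is nonzero.
  obtain ⟨B, hB⟩ := (A e₀).exists_leftInverse_of_injective <| by
    rw [LinearMap.ker_eq_bot']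
    intro m hm
    exact h₀ m fun r => by rw [← hA, hm]; rfl
  let b := Module.finBasis k M
  have hdet : (fun e => (LinearMap.toMatrix b b (B ∘ₗ A e)).det) ∈ polyFun k E := by
    refine det_mem_polyFun fun i j => ?_
    have : ∀ e, LinearMap.toMatrix b b (B ∘ₗ A e) i j =
        ∑ r, f e (b j) r * (b.repr (B (Pi.single r 1)) i) := by
      intro e
      rw [LinearMap.toMatrix_apply, LinearMap.comp_apply]
      conv_lhs => rw [← Finset.univ_sum_single (A e (b j))]
      rw [map_sum, map_sum, Finsupp.finsetSum_apply]
      refine Finset.sum_congr rfl fun r _ => ?_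
      have : (Pi.single r (A e (b j) r) : R → k) =
          f e (b j) r • (Pi.single r (1 : k) : R → k) := by
        rw [hA, ← Pi.single_smul]; simp
      rw [this, map_smul, map_smul]
      simp
    simp only [this]
    exact sum_mem_polyFun _ fun r _ => mul_mem_polyFun (hpoly _ _) (const_mem_polyFun _)
  refine generically_of_polyFun hdet (e₀ := e₀) ?_ ?_
  · rw [hB]; simp
  · intro e he m hm
    rw [LinearMap.det_toMatrix] at he
    have hAm : A e m = 0 := funext fun r => by rw [hA, hm]; rfl
    have hker : LinearMap.ker (B ∘ₗ A e) = ⊥ :=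
      not_not.1 fun h => he (LinearMap.det_eq_zero_iff_ker_ne_bot.2 h)
    exact LinearMap.ker_eq_bot'.1 hker m (by rw [LinearMap.comp_apply, hAm, map_zero])

end Generic

end ProjSpace

namespace ProjSpace

/-! ### Explicit small linear systems with only the zero solution. -/

section Local

variable {k : Type*} [Field k]

/-- The value on the monomial `X_a X_b X_c`, for distinct `a, b, c`, of the functional
`f ↦ w_i f(p) + ∑_{j ≠ i} w_j ∂_j f(p)`. -/
def jetMon {τ : Type*} [DecidableEq τ] (p : τ → k) (i : τ) (w : τ → k) (a b c : τ) : k :=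
  w i * (p a * p b * p c) + (if a = i then 0 else w a) * (p b * p c) +
    (if b = i then 0 else w b) * (p a * p c) + (if c = i then 0 else w c) * (p a * p b)

/-- The explicit systems with a parameter have only the zero solution once it avoids these three
values. -/
theorem exists_ne_zero_one_neg_one [Infinite k] :
    ∃ t : k, t ≠ 0 ∧ t - 1 ≠ 0 ∧ t + 1 ≠ 0 := by
  classical
  obtain ⟨t, ht⟩ := Infinite.exists_notMem_finset ({0, 1, -1} : Finset k)
  simp only [Finset.mem_insert, Finset.mem_singleton, not_or] at ht
  exact ⟨t, ht.1, sub_ne_zero.2 ht.2.1, fun h => ht.2.2 (eq_neg_of_add_eq_zero_left h)⟩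

/-- A square system of size 27. For three blocks, the equations are the monomials with one variable
in each. The unknowns are the coefficients, for the three points of each pair of blocks, of the
derivatives along the remaining block. `A`, `B` are the coordinates of the points of the first pair,
`A'`, `C` and `B'`, `C'` those of the other two. -/
theorem exists_trilinear [Infinite k] : ∃ A B A' C B' C' : Fin 3 → Fin 3 → k,
    ∀ a b c : Fin 3 → Fin 3 → k,
      (∀ x y z, ∑ s, (A s x * B s y * a s z + A' s x * C s z * b s y +
        B' s y * C' s z * c s x) = 0) → a = 0 ∧ b = 0 ∧ c = 0 := by
  obtain ⟨t, ht, -, ht1⟩ := exists_ne_zero_one_neg_one (k := k)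
  refine ⟨![![1, 0, 1], ![1, t, 0], ![0, 1, 0]], ![![1, 0, 0], ![1, t, 0], ![0, -1, 0]],
    ![![0, 0, 1], ![0, 1, 1], ![-1, 0, 0]], ![![0, 0, t], ![0, -1, -1], ![0, 1, 0]],
    ![![1, -1, 0], ![0, -1, 1], ![0, 0, 1]], ![![1, 0, 0], ![1, 0, 0], ![-1, -1, t]], ?_⟩
  intro a b c h
  simp only [Fin.forall_fin_succ, Fin.sum_univ_succ] at h
  simp at h
  simp only [funext_iff, Fin.forall_fin_succ]
  simp
  grind

/-- A square system of size 18: nine squarefree monomials of each of the two shapes in two blocks,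
against six jet coordinates at each of three points in the span of these blocks. -/
theorem exists_bipartite [Infinite k] : ∃ p : Fin 3 → (Fin 3 ⊕ Fin 3) → k,
    ∀ w : Fin 3 → (Fin 3 ⊕ Fin 3) → k,
      (∀ x x' y, x ≠ x' →
        ∑ s, jetMon (p s) (.inl 0) (w s) (.inl x) (.inl x') (.inr y) = 0) →
      (∀ x y y', y ≠ y' →
        ∑ s, jetMon (p s) (.inl 0) (w s) (.inl x) (.inr y) (.inr y') = 0) → w = 0 := by
  obtain ⟨t, ht, ht1, ht2⟩ := exists_ne_zero_one_neg_one (k := k)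
  refine ⟨![Sum.elim ![1, 0, t] ![t, 0, 1], Sum.elim ![1, 1, 0] ![-1, 1, 0],
    Sum.elim ![1, 1, 1] ![0, t, -1]], ?_⟩
  intro w h h'
  have h1 := fun y => h 0 1 y (by decide)
  have h2 := fun y => h 0 2 y (by decide)
  have h3 := fun y => h 1 2 y (by decide)
  have h4 := fun x => h' x 0 1 (by decide)
  have h5 := fun x => h' x 0 2 (by decide)
  have h6 := fun x => h' x 1 2 (by decide)
  clear h h'
  simp only [Fin.forall_fin_succ, Fin.sum_univ_succ, jetMon] at h1 h2 h3 h4 h5 h6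
  simp at h1 h2 h3 h4 h5 h6
  simp only [funext_iff, Fin.forall_fin_succ, Sum.forall]
  simp
  grind

/-- The monomials with `u = 0` and neither `x` nor `y` equal to 2 are given up, because the complex
will be visible there; the 23 equations left still determine the 21 unknowns. The vanishing of `qU 0
2` and `qU' 0 2` lets the first point of each block survive when the last variable is dropped. -/
theorem exists_bipartite_vertex (k : Type*) [Field k] : ∃ A B q qU q' qU' : Fin 3 → Fin 3 → k,
    qU 0 2 = 0 ∧ qU' 0 2 = 0 ∧ ∀ (a : Fin 3 → Fin 3 → k) (c d : Fin 2 → Fin 3 → k),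
      (∀ x y u, (u = 0 → x ≠ 2 → y = 2) →
        ∑ s, A s x * B s y * a s u + ∑ r : Fin 2, q r.castSucc x * qU r.castSucc u * c r y +
          ∑ r : Fin 2, q' r.castSucc y * qU' r.castSucc u * d r x = 0) →
      a = 0 ∧ c = 0 ∧ d = 0 := by
  refine ⟨![![1, 0, 0], ![0, 1, 0], ![1, 0, 1]], ![![0, 1, 1], ![0, 1, 1], ![1, 1, 0]],
    ![![0, 0, 1], ![0, 0, 1], 0], ![![0, 1, 0], ![0, 0, 1], 0],
    ![![0, 0, 1], ![1, 0, 0], 0], ![![1, 1, 0], ![1, 0, 1], 0], by simp, by simp, ?_⟩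
  intro a c d h
  have h0 := fun x y => h x y 1 (by simp)
  have h1 := fun x y => h x y 2 (by simp)
  have h2 := fun y => h 2 y 0 (by simp)
  have h3 := h 0 2 0 (by decide)
  have h4 := h 1 2 0 (by decide)
  clear h
  simp only [Fin.forall_fin_succ, Fin.sum_univ_succ] at h0 h1 h2 h3 h4
  simp at h0 h1 h2 h3 h4
  simp only [funext_iff, Fin.forall_fin_succ]
  simp
  grind

/-- As before, monomials that the complex can reach are given up: 14 equations remain for 12
unknowns. -/
theorem exists_block_vertex [Infinite k] : ∃ p : Fin 2 → (Fin 3 ⊕ Fin 3) → k,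
    p 0 (.inr 2) = 0 ∧ ∀ w : Fin 2 → (Fin 3 ⊕ Fin 3) → k,
      (∑ s, jetMon (p s) (.inl 0) (w s) (.inl 0) (.inl 1) (.inl 2) = 0) →
      (∀ x x' u, x ≠ x' → (u = 0 → x' = 2) →
        ∑ s, jetMon (p s) (.inl 0) (w s) (.inl x) (.inl x') (.inr u) = 0) →
      (∀ x u u', u ≠ u' → (u = 0 → x = 2) → u' ≠ 0 →
        ∑ s, jetMon (p s) (.inl 0) (w s) (.inl x) (.inr u) (.inr u') = 0) → w = 0 := by
  obtain ⟨t, ht, ht1, ht2⟩ := exists_ne_zero_one_neg_one (k := k)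
  refine ⟨![Sum.elim ![1, t, 1] ![0, 1, 0], Sum.elim ![1, 0, t] ![1, 1, 1]], by simp, ?_⟩
  intro w h0 h h'
  have h1 := fun u => h 0 2 u (by decide) (by simp)
  have h2 := fun u => h 1 2 u (by decide) (by simp)
  have h3 := h 0 1 1 (by decide) (by decide)
  have h4 := h 0 1 2 (by decide) (by decide)
  have h5 := fun x => h' x 1 2 (by decide) (by simp) (by decide)
  have h6 := h' 2 0 1 (by decide) (by simp) (by decide)
  have h7 := h' 2 0 2 (by decide) (by simp) (by decide)
  clear h h'
  simp only [Fin.forall_fin_succ, Fin.sum_univ_succ, jetMon] at h0 h1 h2 h3 h4 h5 h6 h7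
  simp at h0 h1 h2 h3 h4 h5 h6 h7
  simp only [funext_iff, Fin.forall_fin_succ, Sum.forall]
  simp
  grind

end Local

end ProjSpace

namespace ProjSpace

/-! ### Coordinates for which all the small systems are nonsingular. -/

section Parameters

variable {k : Type*} [Field k]

theorem isLinearMap_jetMon {τ : Type*} [DecidableEq τ] (p : τ → k) (i : τ) (a b c : τ) :
    IsLinearMap k fun w : τ → k => jetMon p i w a b c := by
  constructor
  · intro w w'
    simp only [jetMon, Pi.add_apply]
    split_ifs <;> ring
  · intro t w
    simp only [jetMon, Pi.smul_apply, smul_eq_mul]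
    split_ifs <;> ring

theorem isLinearMap_sum {M : Type*} [AddCommGroup M] [Module k M] {ι : Type*} (s : Finset ι)
    {f : ι → M → k} (hf : ∀ i ∈ s, IsLinearMap k (f i)) :
    IsLinearMap k fun m => ∑ i ∈ s, f i m := by
  constructor
  · intro x y
    rw [← Finset.sum_add_distrib]
    exact Finset.sum_congr rfl fun i hi => (hf i hi).map_add x y
  · intro t x
    rw [Finset.smul_sum]
    exact Finset.sum_congr rfl fun i hi => (hf i hi).map_smul t x

theorem isLinearMap_jetMon_comp {τ M : Type*} [DecidableEq τ] [AddCommGroup M] [Module k M]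
    (p : τ → k) (i : τ) (a b c : τ) (g : M →ₗ[k] (τ → k)) :
    IsLinearMap k fun m : M => jetMon p i (g m) a b c :=
  (((isLinearMap_jetMon p i a b c).mk' _).comp g).isLinear

theorem isLinearMap_ite {M : Type*} [AddCommGroup M] [Module k M] (P : Prop) [Decidable P]
    {f : M → k} (hf : IsLinearMap k f) : IsLinearMap k fun m => if P then f m else 0 := by
  split_ifs
  · exact hf
  · exact (0 : M →ₗ[k] k).isLinear

variable {E : Type*} [AddCommGroup E] [Module k E]

theorem isLinearMap_mem_polyFun {f : E → k} (hf : IsLinearMap k f) : f ∈ polyFun k E :=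
  linear_mem_polyFun (hf.mk' f)

theorem jetMon_mem_polyFun {τ : Type*} [DecidableEq τ] {p : E → τ → k}
    (hp : ∀ a, (fun e => p e a) ∈ polyFun k E) (i : τ) (w : τ → k) (a b c : τ) :
    (fun e => jetMon (p e) i w a b c) ∈ polyFun k E := by
  unfold jetMon
  exact add_mem_polyFun (add_mem_polyFun (add_mem_polyFun
    (mul_mem_polyFun (const_mem_polyFun _)
      (mul_mem_polyFun (mul_mem_polyFun (hp a) (hp b)) (hp c)))
    (mul_mem_polyFun (const_mem_polyFun _) (mul_mem_polyFun (hp b) (hp c))))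
    (mul_mem_polyFun (const_mem_polyFun _) (mul_mem_polyFun (hp a) (hp c))))
    (mul_mem_polyFun (const_mem_polyFun _) (mul_mem_polyFun (hp a) (hp b)))

theorem ite_mem_polyFun (P : Prop) [Decidable P] {f : E → k} (hf : f ∈ polyFun k E) :
    (fun e => if P then f e else 0) ∈ polyFun k E := by
  split_ifs
  · exact hf
  · exact const_mem_polyFun 0

/-- The coordinates of points in the span of two blocks of three variables, and of points in
the span of a block and the block `U` of the last three variables. -/
abbrev Params (k : Type*) (m : ℕ) : Type _ :=
  (Fin m → Fin m → Fin 3 → Fin 3 → k) × (Fin m → Fin 2 → Fin 3 → k) ×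
    (Fin m → Fin 2 → Fin 3 → k)

/-- The coordinates of `U` of a point in the span of a block and `U`; the first of the two points
of each block has last coordinate zero. -/
def Params.qU {m : ℕ} (e : Params k m) (i : Fin m) (r : Fin 2) (u : Fin 3) : k :=
  if r = 0 ∧ u = 2 then 0 else e.2.2 i r u

theorem pairCoord_mem_polyFun {m : ℕ} (i j : Fin m) (s c : Fin 3) :
    (fun e : Params k m => e.1 i j s c) ∈ polyFun k (Params k m) :=
  isLinearMap_mem_polyFun ⟨fun _ _ => rfl, fun _ _ => rfl⟩

theorem qCoord_mem_polyFun {m : ℕ} (i : Fin m) (r : Fin 2) (c : Fin 3) :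
    (fun e : Params k m => e.2.1 i r c) ∈ polyFun k (Params k m) :=
  isLinearMap_mem_polyFun ⟨fun _ _ => rfl, fun _ _ => rfl⟩

theorem qU_mem_polyFun {m : ℕ} (i : Fin m) (r : Fin 2) (u : Fin 3) :
    (fun e : Params k m => e.qU i r u) ∈ polyFun k (Params k m) := by
  unfold Params.qU
  split_ifs
  · exact const_mem_polyFun 0
  · exact isLinearMap_mem_polyFun ⟨fun _ _ => rfl, fun _ _ => rfl⟩

theorem generically_trilinear [Infinite k] {m : ℕ} {i j l : Fin m} (hij : i < j) (hjl : j < l) :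
    Generically k fun e : Params k m => ∀ a b c : Fin 3 → Fin 3 → k,
      (∀ x y z, ∑ s, (e.1 i j s x * e.1 j i s y * a s z + e.1 i l s x * e.1 l i s z * b s y +
        e.1 j l s y * e.1 l j s z * c s x) = 0) → a = 0 ∧ b = 0 ∧ c = 0 := by
  obtain ⟨A, B, A', C, B', C', h⟩ := exists_trilinear (k := k)
  -- Only the six ordered pairs formed by `i`, `j`, `l` occur in the system, so the values elsewhere
  -- are irrelevant.
  let e₀ : Params k m := ⟨fun i' j' => if i' = i then (if j' = j then A else A') else
    if i' = j then (if j' = i then B else B') else (if j' = i then C else C'), 0, 0⟩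
  have := generically_injective (k := k) (e₀ := e₀)
    (M := (Fin 3 → Fin 3 → k) × (Fin 3 → Fin 3 → k) × (Fin 3 → Fin 3 → k))
    (R := Fin 3 × Fin 3 × Fin 3)
    (fun e M r => ∑ s, (e.1 i j s r.1 * e.1 j i s r.2.1 * M.1 s r.2.2 +
      e.1 i l s r.1 * e.1 l i s r.2.2 * M.2.1 s r.2.1 +
        e.1 j l s r.2.1 * e.1 l j s r.2.2 * M.2.2 s r.1)) ?_ ?_ ?_
  · refine this.mono fun e he a b c H => ?_
    have := he (a, b, c) fun r => H _ _ _
    simpa using this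
  · intro e r
    refine isLinearMap_sum _ fun s _ => ⟨fun M M' => ?_, fun t M => ?_⟩
    · simp only [Prod.fst_add, Prod.snd_add, Pi.add_apply]; ring
    · simp only [Prod.smul_fst, Prod.smul_snd, Pi.smul_apply, smul_eq_mul]; ring
  · intro M r
    refine sum_mem_polyFun _ fun s _ => add_mem_polyFun (add_mem_polyFun ?_ ?_) ?_ <;>
    exact mul_mem_polyFun (mul_mem_polyFun (pairCoord_mem_polyFun _ _ _ _)
      (pairCoord_mem_polyFun _ _ _ _)) (const_mem_polyFun _)
  · rintro ⟨a, b, c⟩ H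
    have := h a b c fun x y z => by
      simpa [e₀, hij.ne', hjl.ne', (hij.trans hjl).ne'] using H (x, y, z)
    simpa using this

theorem generically_bipartite [Infinite k] {m : ℕ} {i j : Fin m} (hij : i < j) :
    Generically k fun e : Params k m => ∀ w : Fin 3 → (Fin 3 ⊕ Fin 3) → k,
      (∀ x x' y, x ≠ x' → ∑ s, jetMon (Sum.elim (e.1 i j s) (e.1 j i s)) (.inl 0) (w s)
        (.inl x) (.inl x') (.inr y) = 0) →
      (∀ x y y', y ≠ y' → ∑ s, jetMon (Sum.elim (e.1 i j s) (e.1 j i s)) (.inl 0) (w s)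
        (.inl x) (.inr y) (.inr y') = 0) → w = 0 := by
  obtain ⟨p, h⟩ := exists_bipartite (k := k)
  let e₀ : Params k m := ⟨fun i' _ s c => if i' = i then p s (.inl c) else p s (.inr c), 0, 0⟩
  have := generically_injective (k := k) (e₀ := e₀)
    (M := Fin 3 → (Fin 3 ⊕ Fin 3) → k) (R := (Fin 3 × Fin 3 × Fin 3) ⊕ (Fin 3 × Fin 3 × Fin 3))
    (fun e w r => Sum.elim
      (fun r => if r.1 ≠ r.2.1 then ∑ s, jetMon (Sum.elim (e.1 i j s) (e.1 j i s)) (.inl 0) (w s)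
        (.inl r.1) (.inl r.2.1) (.inr r.2.2) else 0)
      (fun r => if r.2.1 ≠ r.2.2 then ∑ s, jetMon (Sum.elim (e.1 i j s) (e.1 j i s)) (.inl 0)
        (w s) (.inl r.1) (.inr r.2.1) (.inr r.2.2) else 0) r) ?_ ?_ ?_
  · refine this.mono fun e he w H H' => he w ?_
    rintro (r | r)
    · simp only [Sum.elim_inl]
      split_ifs with hr
      · exact H _ _ _ hr
      · rfl
    · simp only [Sum.elim_inr]
      split_ifs with hr
      · exact H' _ _ _ hr
      · rfl
  · rintro e (r | r) <;>
    exact isLinearMap_ite _ (isLinearMap_sum _ fun s _ =>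
      isLinearMap_jetMon_comp _ _ _ _ _
        (LinearMap.proj (φ := fun _ : Fin 3 => Fin 3 ⊕ Fin 3 → k) s))
  · have hp : ∀ s a, (fun e : Params k m =>
        (Sum.elim (e.1 i j s) (e.1 j i s) : Fin 3 ⊕ Fin 3 → k) a) ∈ polyFun k (Params k m) := by
      rintro s (a | a) <;> exact pairCoord_mem_polyFun _ _ _ _
    rintro w (r | r) <;>
    exact ite_mem_polyFun _ (sum_mem_polyFun _ fun s _ => jetMon_mem_polyFun (hp s) _ _ _ _ _)
  · intro w H
    have hp : ∀ s, (Sum.elim (e₀.1 i j s) (e₀.1 j i s) : Fin 3 ⊕ Fin 3 → k) = p s := by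
      intro s
      ext (a | a) <;> simp [e₀, hij.ne']
    refine h w (fun x x' y hx => ?_) (fun x y y' hy => ?_)
    · simpa only [Sum.elim_inl, hp, if_pos hx] using H (.inl (x, x', y))
    · simpa only [Sum.elim_inr, hp, if_pos hy] using H (.inr (x, y, y'))

theorem generically_bipartite_vertex [Infinite k] {m : ℕ} {i j : Fin m} (hij : i < j) :
    Generically k fun e : Params k m => ∀ (a : Fin 3 → Fin 3 → k) (c d : Fin 2 → Fin 3 → k),
      (∀ x y u, (u = 0 → x ≠ 2 → y = 2) →
        ∑ s, e.1 i j s x * e.1 j i s y * a s u + ∑ r, e.2.1 i r x * e.qU i r u * c r y +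
          ∑ r, e.2.1 j r y * e.qU j r u * d r x = 0) → a = 0 ∧ c = 0 ∧ d = 0 := by
  obtain ⟨A, B, q, qU, q', qU', h0, h0', h⟩ := exists_bipartite_vertex k
  let e₀ : Params k m := ⟨fun i' _ s c => if i' = i then A s c else B s c,
    fun i' r c => if i' = i then q r.castSucc c else q' r.castSucc c,
    fun i' r c => if i' = i then qU r.castSucc c else qU' r.castSucc c⟩
  have := generically_injective (k := k) (e₀ := e₀)
    (M := (Fin 3 → Fin 3 → k) × (Fin 2 → Fin 3 → k) × (Fin 2 → Fin 3 → k))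
    (R := Fin 3 × Fin 3 × Fin 3)
    (fun e M r => if (r.2.2 = 0 → r.1 ≠ 2 → r.2.1 = 2) then
      ∑ s, e.1 i j s r.1 * e.1 j i s r.2.1 * M.1 s r.2.2 +
        ∑ t, e.2.1 i t r.1 * e.qU i t r.2.2 * M.2.1 t r.2.1 +
          ∑ t, e.2.1 j t r.2.1 * e.qU j t r.2.2 * M.2.2 t r.1 else 0) ?_ ?_ ?_
  · refine this.mono fun e he a c d H => ?_
    have := he (a, c, d) fun r => by
      split_ifs with hr
      · exact H _ _ _ hr
      · rfl
    simpa using this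
  · intro e r
    refine isLinearMap_ite _ ⟨fun M M' => ?_, fun t M => ?_⟩
    · simp only [Prod.fst_add, Prod.snd_add, Pi.add_apply, mul_add, Finset.sum_add_distrib]
      ring
    · simp only [Prod.smul_fst, Prod.smul_snd, Pi.smul_apply, smul_eq_mul, mul_add,
        Finset.mul_sum]
      refine congr_arg₂ _ (congr_arg₂ _ ?_ ?_) ?_ <;>
      exact Finset.sum_congr rfl fun _ _ => by ring
  · intro M r
    refine ite_mem_polyFun _ (add_mem_polyFun (add_mem_polyFun ?_ ?_) ?_) <;>
    refine sum_mem_polyFun _ fun s _ => mul_mem_polyFun (mul_mem_polyFun ?_ ?_)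
      (const_mem_polyFun _) <;>
    first
    | exact pairCoord_mem_polyFun _ _ _ _
    | exact qCoord_mem_polyFun _ _ _
    | exact qU_mem_polyFun _ _ _
  · rintro ⟨a, c, d⟩ H
    have hqU : ∀ r u, e₀.qU i r u = qU r.castSucc u := by
      intro r u
      simp only [Params.qU, e₀]
      split_ifs with hr
      · rw [hr.1, hr.2, Fin.castSucc_zero, h0]
      · rfl
    have hqU' : ∀ r u, e₀.qU j r u = qU' r.castSucc u := by
      intro r u
      simp only [Params.qU, e₀, if_neg hij.ne']
      split_ifs with hr
      · rw [hr.1, hr.2, Fin.castSucc_zero, h0']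
      · rfl
    have := h a c d fun x y u hu => by
      have := H (x, y, u)
      simp only [hqU, hqU', if_pos hu] at this
      simpa only [e₀, if_true, if_neg hij.ne'] using this
    simpa using this

theorem generically_block_vertex [Infinite k] {m : ℕ} (i : Fin m) :
    Generically k fun e : Params k m => ∀ w : Fin 2 → (Fin 3 ⊕ Fin 3) → k,
      (∑ s, jetMon (Sum.elim (e.2.1 i s) (e.qU i s)) (.inl 0) (w s)
        (.inl 0) (.inl 1) (.inl 2) = 0) →
      (∀ x x' u, x ≠ x' → (u = 0 → x' = 2) → ∑ s, jetMon (Sum.elim (e.2.1 i s) (e.qU i s))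
        (.inl 0) (w s) (.inl x) (.inl x') (.inr u) = 0) →
      (∀ x u u', u ≠ u' → (u = 0 → x = 2) → u' ≠ 0 →
        ∑ s, jetMon (Sum.elim (e.2.1 i s) (e.qU i s)) (.inl 0) (w s)
          (.inl x) (.inr u) (.inr u') = 0) → w = 0 := by
  obtain ⟨p, h0, h⟩ := exists_block_vertex (k := k)
  let e₀ : Params k m := ⟨0, fun _ r c => p r (.inl c), fun _ r c => p r (.inr c)⟩
  have := generically_injective (k := k) (e₀ := e₀)
    (M := Fin 2 → (Fin 3 ⊕ Fin 3) → k)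
    (R := Unit ⊕ (Fin 3 × Fin 3 × Fin 3) ⊕ (Fin 3 × Fin 3 × Fin 3))
    (fun e w r => Sum.elim
      (fun _ => ∑ s, jetMon (Sum.elim (e.2.1 i s) (e.qU i s)) (.inl 0) (w s)
        (.inl 0) (.inl 1) (.inl 2)) (Sum.elim
      (fun r => if r.1 ≠ r.2.1 ∧ (r.2.2 = 0 → r.2.1 = 2) then
        ∑ s, jetMon (Sum.elim (e.2.1 i s) (e.qU i s)) (.inl 0) (w s)
        (.inl r.1) (.inl r.2.1) (.inr r.2.2) else 0)
      (fun r => if r.2.1 ≠ r.2.2 ∧ (r.2.1 = 0 → r.1 = 2) ∧ r.2.2 ≠ 0 then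
        ∑ s, jetMon (Sum.elim (e.2.1 i s) (e.qU i s)) (.inl 0)
        (w s) (.inl r.1) (.inr r.2.1) (.inr r.2.2) else 0)) r) ?_ ?_ ?_
  · refine this.mono fun e he w H H' H'' => he w ?_
    rintro (r | r | r)
    · exact H
    · simp only [Sum.elim_inl, Sum.elim_inr]
      split_ifs with hr
      · exact H' _ _ _ hr.1 hr.2
      · rfl
    · simp only [Sum.elim_inr]
      split_ifs with hr
      · exact H'' _ _ _ hr.1 hr.2.1 hr.2.2
      · rfl
  · have hl := fun (e : Params k m) a b c => isLinearMap_sum (k := k) Finset.univ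
      fun (s : Fin 2) _ => isLinearMap_jetMon_comp (Sum.elim (e.2.1 i s) (e.qU i s))
        (.inl 0) a b c (LinearMap.proj (φ := fun _ : Fin 2 => Fin 3 ⊕ Fin 3 → k) s)
    rintro e (r | r | r)
    · exact hl e _ _ _
    · exact isLinearMap_ite _ (hl e _ _ _)
    · exact isLinearMap_ite _ (hl e _ _ _)
  · have hp : ∀ s a, (fun e : Params k m =>
        (Sum.elim (e.2.1 i s) (e.qU i s) : Fin 3 ⊕ Fin 3 → k) a) ∈ polyFun k (Params k m) := by
      rintro s (a | a)
      · exact qCoord_mem_polyFun _ _ _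
      · exact qU_mem_polyFun _ _ _
    have hs := fun (w : Fin 2 → Fin 3 ⊕ Fin 3 → k) a b c => sum_mem_polyFun Finset.univ
      fun s _ => jetMon_mem_polyFun (hp s) (.inl 0) (w s) a b c
    rintro w (r | r | r)
    · exact hs w _ _ _
    · exact ite_mem_polyFun _ (hs w _ _ _)
    · exact ite_mem_polyFun _ (hs w _ _ _)
  · intro w H
    have hp : ∀ s, (Sum.elim (e₀.2.1 i s) (e₀.qU i s) : Fin 3 ⊕ Fin 3 → k) = p s := by
      intro s
      ext (a | a)
      · simp [e₀]
      · simp only [Params.qU, e₀, Sum.elim_inr]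
        split_ifs with hr
        · rw [hr.1, hr.2, h0]
        · rfl
    simp only [hp] at H
    refine h w (H (.inl ())) (fun x x' u hx hu => ?_) (fun x u u' hu hx hu' => ?_)
    · simpa only [Sum.elim_inl, Sum.elim_inr, if_pos (And.intro hx hu)] using
        H (.inr (.inl (x, x', u)))
    · simpa only [Sum.elim_inl, Sum.elim_inr, if_pos (And.intro hu (And.intro hx hu'))] using
        H (.inr (.inr (x, u, u')))

/-- The parameters for which the linear systems that compute the relations between the double
points of the configuration are nonsingular. -/
structure Params.Regular {m : ℕ} (e : Params k m) : Prop where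
  trilinear : ∀ i j l, i < j → j < l → ∀ a b c : Fin 3 → Fin 3 → k,
      (∀ x y z, ∑ s, (e.1 i j s x * e.1 j i s y * a s z + e.1 i l s x * e.1 l i s z * b s y +
        e.1 j l s y * e.1 l j s z * c s x) = 0) → a = 0 ∧ b = 0 ∧ c = 0
  bipartite : ∀ i j, i < j → ∀ w : Fin 3 → (Fin 3 ⊕ Fin 3) → k,
      (∀ x x' y, x ≠ x' → ∑ s, jetMon (Sum.elim (e.1 i j s) (e.1 j i s)) (.inl 0) (w s)
        (.inl x) (.inl x') (.inr y) = 0) →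
      (∀ x y y', y ≠ y' → ∑ s, jetMon (Sum.elim (e.1 i j s) (e.1 j i s)) (.inl 0) (w s)
        (.inl x) (.inr y) (.inr y') = 0) → w = 0
  bipartite_vertex : ∀ i j, i < j → ∀ (a : Fin 3 → Fin 3 → k) (c d : Fin 2 → Fin 3 → k),
      (∀ x y u, (u = 0 → x ≠ 2 → y = 2) →
        ∑ s, e.1 i j s x * e.1 j i s y * a s u + ∑ r, e.2.1 i r x * e.qU i r u * c r y +
          ∑ r, e.2.1 j r y * e.qU j r u * d r x = 0) → a = 0 ∧ c = 0 ∧ d = 0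
  block_vertex : ∀ i, ∀ w : Fin 2 → (Fin 3 ⊕ Fin 3) → k,
      (∑ s, jetMon (Sum.elim (e.2.1 i s) (e.qU i s)) (.inl 0) (w s)
        (.inl 0) (.inl 1) (.inl 2) = 0) →
      (∀ x x' u, x ≠ x' → (u = 0 → x' = 2) → ∑ s, jetMon (Sum.elim (e.2.1 i s) (e.qU i s))
        (.inl 0) (w s) (.inl x) (.inl x') (.inr u) = 0) →
      (∀ x u u', u ≠ u' → (u = 0 → x = 2) → u' ≠ 0 →
        ∑ s, jetMon (Sum.elim (e.2.1 i s) (e.qU i s)) (.inl 0) (w s)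
          (.inl x) (.inr u) (.inr u') = 0) → w = 0

/-- Regularity is a finite conjunction of open conditions, each of which holds somewhere, so the
explicit solutions for different blocks need not be compatible with each other. -/
theorem exists_regular (k : Type*) [Field k] [Infinite k] (m : ℕ) :
    ∃ e : Params k m, e.Regular := by
  have h1 : Generically k fun e : Params k m => ∀ p : {p : Fin m × Fin m × Fin m //
      p.1 < p.2.1 ∧ p.2.1 < p.2.2}, _ :=
    generically_forall fun p => generically_trilinear p.2.1 p.2.2
  have h2 : Generically k fun e : Params k m => ∀ p : {p : Fin m × Fin m // p.1 < p.2}, _ :=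
    generically_forall fun p => generically_bipartite p.2
  have h3 : Generically k fun e : Params k m => ∀ p : {p : Fin m × Fin m // p.1 < p.2}, _ :=
    generically_forall fun p => generically_bipartite_vertex p.2
  have h4 : Generically k fun e : Params k m => ∀ i : Fin m, _ :=
    generically_forall fun i => generically_block_vertex i
  obtain ⟨e, ⟨⟨h1, h2⟩, h3⟩, h4⟩ := (((h1.and h2).and h3).and h4).exists
  exact ⟨e, fun i j l hij hjl => h1 ⟨(i, j, l), hij, hjl⟩, fun i j hij => h2 ⟨(i, j), hij⟩,
    fun i j hij => h3 ⟨(i, j), hij⟩, h4⟩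

end Parameters

end ProjSpace

namespace ProjSpace

/-! ### Independence of double points and of a complex in special position. -/

section Relations

variable {k : Type*} [Field k]

section JetMon

variable {τ : Type*} [DecidableEq τ] {p w : τ → k} {i a b c : τ}

theorem jetMon_eq_zero_of_left (ha : p a = 0) (hb : p b = 0) : jetMon p i w a b c = 0 := by
  simp [jetMon, ha, hb]

theorem jetMon_eq_zero_of_right (hb : p b = 0) (hc : p c = 0) : jetMon p i w a b c = 0 := by
  simp [jetMon, hb, hc]

theorem jetMon_eq_zero_of_outer (ha : p a = 0) (hc : p c = 0) : jetMon p i w a b c = 0 := by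
  simp [jetMon, ha, hc]

/-- When a variable of the monomial vanishes at `p`, only the derivative along it survives. The
pivot has to be excluded because the functional uses the value at `p` in place of the derivative
along `i`. -/
theorem jetMon_of_first (ha : p a = 0) (hi : a ≠ i) :
    jetMon p i w a b c = w a * (p b * p c) := by
  simp [jetMon, ha, hi]

theorem jetMon_of_second (hb : p b = 0) (hi : b ≠ i) :
    jetMon p i w a b c = w b * (p a * p c) := by
  simp [jetMon, hb, hi]

theorem jetMon_of_third (hc : p c = 0) (hi : c ≠ i) :
    jetMon p i w a b c = w c * (p a * p b) := by
  simp [jetMon, hc, hi]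

theorem jetMon_comp {τ' : Type*} [DecidableEq τ'] {f : τ' → τ} (hf : Function.Injective f)
    {i a b c : τ'} :
    jetMon p (f i) w (f a) (f b) (f c) = jetMon (p ∘ f) i (w ∘ f) a b c := by
  simp [jetMon, hf.eq_iff]

/-- Two of three distinct variables vanish at a coordinate point, so squarefree monomials are
singular there and do not see these double points. -/
theorem jetMon_single {x : τ} (hab : a ≠ b) (hbc : b ≠ c) (hac : a ≠ c) :
    jetMon (Pi.single x 1 : τ → k) x w a b c = 0 := by
  by_cases ha : a = x
  · exact jetMon_eq_zero_of_right (Pi.single_eq_of_ne (ha ▸ hab.symm) _)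
      (Pi.single_eq_of_ne (ha ▸ hac.symm) _)
  · by_cases hb : b = x
    · exact jetMon_eq_zero_of_outer (Pi.single_eq_of_ne ha _)
        (Pi.single_eq_of_ne (hb ▸ hbc.symm) _)
    · exact jetMon_eq_zero_of_left (Pi.single_eq_of_ne ha _) (Pi.single_eq_of_ne hb _)

end JetMon

/-- The variables: `m` blocks of three variables and the block `U` of the last three. -/
abbrev Vertex (m : ℕ) : Type := (Fin m × Fin 3) ⊕ Fin 3

/-- The indices of the double points of the configuration. -/
abbrev PointIndex (m : ℕ) : Type :=
  Vertex m ⊕ ({p : Fin m × Fin m // p.1 < p.2} × Fin 3) ⊕ (Fin m × Fin 2)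

variable {m : ℕ}

/-- A point in the span of two blocks. -/
def Params.pairPt (e : Params k m) (i j : Fin m) (s : Fin 3) : Vertex m → k :=
  Sum.elim (fun x => if x.1 = i then e.1 i j s x.2 else if x.1 = j then e.1 j i s x.2 else 0) 0

/-- A point in the span of a block and `U`. -/
def Params.vertexPt (e : Params k m) (i : Fin m) (r : Fin 2) : Vertex m → k :=
  Sum.elim (fun x => if x.1 = i then e.2.1 i r x.2 else 0) (e.qU i r)

/-- The double points of the configuration. -/
def Params.pt (e : Params k m) : PointIndex m → Vertex m → k :=
  Sum.elim (fun x => Pi.single x 1)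
    (Sum.elim (fun p => e.pairPt p.1.1.1 p.1.1.2 p.2) fun p => e.vertexPt p.1 p.2)

/-- For each double point of the configuration, a coordinate which does not vanish there. -/
def pivot : PointIndex m → Vertex m :=
  Sum.elim id (Sum.elim (fun p => .inl (p.1.1.1, 0)) fun p => .inl (p.1, 0))

/-- The variables whose vertices can be used, after a translation along the first variable
of `U`, for a complex. -/
def Vertex.Allowed : Vertex m → Prop :=
  Sum.elim (fun x => x.2 ≠ 2) fun u => u ≠ 0

/-- The vertices of a complex. -/
def complexVertex {l : ℕ} (v : Fin l → Vertex m) (s : Fin l → k) (a : Fin l) : Vertex m → k :=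
  Pi.single (v a) 1 + s a • Pi.single (.inr 0) 1

/-- The value on `X_a X_b X_c` of a linear combination of the evaluations at the points of a
complex. -/
def complexMon {τ : Type*} {l : ℕ} (y : Fin l → Fin l → τ → k) (μ : Fin l → Fin l → k)
    (a b c : τ) : k :=
  ∑ i, ∑ j, if i < j then μ i j * (y i j a * y i j b * y i j c) else 0

section Complex

variable {l : ℕ} {v : Fin l → Vertex m} {s : Fin l → k} {μ : Fin l → Fin l → k}

theorem complexVertex_sub_eq_zero {x : Vertex m} {i j : Fin l} (hx : x ≠ .inr 0) (hi : x ≠ v i)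
    (hj : x ≠ v j) : (complexVertex v s i - complexVertex v s j) x = 0 := by
  simp [complexVertex, Pi.single_eq_of_ne hx, Pi.single_eq_of_ne hi, Pi.single_eq_of_ne hj]

theorem complexMon_eq_zero {a b c : Vertex m}
    (h : ∀ i j, i < j → (complexVertex v s i - complexVertex v s j) a = 0 ∨
      (complexVertex v s i - complexVertex v s j) b = 0 ∨
      (complexVertex v s i - complexVertex v s j) c = 0) :
    complexMon (fun i j => complexVertex v s i - complexVertex v s j) μ a b c = 0 := by
  refine Finset.sum_eq_zero fun i _ => Finset.sum_eq_zero fun j _ => ?_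
  split_ifs with hij
  · rcases h i j hij with h | h | h <;> simp [h]
  · rfl

/-- Apart from the first variable of `U`, at most two coordinates of a point of the complex are
nonzero. -/
theorem complexMon_eq_zero_of_ne {a b c : Vertex m} (hab : a ≠ b) (hac : a ≠ c) (hbc : b ≠ c)
    (ha : a ≠ .inr 0) (hb : b ≠ .inr 0) (hc : c ≠ .inr 0) :
    complexMon (fun i j => complexVertex v s i - complexVertex v s j) μ a b c = 0 := by
  refine complexMon_eq_zero fun i j _ => ?_
  by_contra! h
  have key : ∀ x : Vertex m, x ≠ .inr 0 → (complexVertex v s i - complexVertex v s j) x ≠ 0 →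
      x = v i ∨ x = v j := by
    intro x hx hx'
    by_contra! H
    exact hx' (complexVertex_sub_eq_zero hx H.1 H.2)
  rcases key a ha h.1 with h1 | h1 <;> rcases key b hb h.2.1 with h2 | h2 <;>
  rcases key c hc h.2.2 with h3 | h3 <;>
  first
  | exact hab (h1.trans h2.symm)
  | exact hac (h1.trans h3.symm)
  | exact hbc (h2.trans h3.symm)

theorem complexMon_eq_zero_of_not_allowed (hv : ∀ i, (v i).Allowed) {a b c : Vertex m}
    (h : (¬ a.Allowed ∧ a ≠ .inr 0) ∨ (¬ b.Allowed ∧ b ≠ .inr 0)) :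
    complexMon (fun i j => complexVertex v s i - complexVertex v s j) μ a b c = 0 := by
  refine complexMon_eq_zero fun i j _ => ?_
  rcases h with h | h
  · exact .inl (complexVertex_sub_eq_zero h.2 (fun e => h.1 (e ▸ hv i)) fun e => h.1 (e ▸ hv j))
  · exact .inr (.inl (complexVertex_sub_eq_zero h.2 (fun e => h.1 (e ▸ hv i))
      fun e => h.1 (e ▸ hv j)))

/-- Only the point on the line through the vertices `i` and `j` has both coordinates nonzero. The
translations `s` are essential: without them the complex would lie on lines joining coordinate
points, where every squarefree cubic vanishes. -/
theorem complexMon_vertices (hv : ∀ i, (v i).Allowed) (hv' : Function.Injective v)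
    {i j : Fin l} (hij : i < j) :
    complexMon (fun i j => complexVertex v s i - complexVertex v s j) μ (.inr 0) (v i) (v j) =
      μ i j * ((s i - s j) * (1 * -1)) := by
  have h0 : ∀ i, v i ≠ .inr 0 := fun i h => by simpa [h, Vertex.Allowed] using hv i
  have key : ∀ i' j', (complexVertex v s i' - complexVertex v s j') (.inr 0) = s i' - s j' := by
    intro i' j'
    simp [complexVertex, Pi.single_eq_of_ne (h0 _).symm]
  have key' : ∀ i' j' x, (complexVertex v s i' - complexVertex v s j') (v x) =
      (if x = i' then 1 else 0) - (if x = j' then 1 else 0) := by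
    intro i' j' x
    simp [complexVertex, Pi.single_eq_of_ne (h0 _), Pi.single_apply, hv'.eq_iff]
  unfold complexMon
  simp only [key, key']
  rw [Finset.sum_eq_single i, Finset.sum_eq_single j]
  · simp [hij, hij.ne, hij.ne']
  · intro j' _ hj'
    split_ifs <;> simp_all
  · simp
  · intro i' _ hi'
    refine Finset.sum_eq_zero fun j' _ => ?_
    split_ifs <;> first | omega | simp
  · simp

end Complex

theorem Params.pairPt_of_ne (e : Params k m) {i j l : Fin m} (hi : l ≠ i) (hj : l ≠ j) (s x) :
    e.pairPt i j s (.inl (l, x)) = 0 := by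
  simp [Params.pairPt, hi, hj]

theorem Params.pairPt_left (e : Params k m) (i j : Fin m) (s x) :
    e.pairPt i j s (.inl (i, x)) = e.1 i j s x := by
  simp [Params.pairPt]

theorem Params.pairPt_right (e : Params k m) {i j : Fin m} (hij : i ≠ j) (s x) :
    e.pairPt i j s (.inl (j, x)) = e.1 j i s x := by
  simp [Params.pairPt, hij.symm]

theorem Params.pairPt_inr (e : Params k m) (i j : Fin m) (s u) :
    e.pairPt i j s (.inr u) = 0 := rfl

theorem Params.vertexPt_of_ne (e : Params k m) {i l : Fin m} (hi : l ≠ i) (r x) :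
    e.vertexPt i r (.inl (l, x)) = 0 := by
  simp [Params.vertexPt, hi]

theorem Params.vertexPt_self (e : Params k m) (i : Fin m) (r x) :
    e.vertexPt i r (.inl (i, x)) = e.2.1 i r x := by
  simp [Params.vertexPt]

theorem Params.vertexPt_inr (e : Params k m) (i : Fin m) (r u) :
    e.vertexPt i r (.inr u) = e.qU i r u := rfl

theorem blocks_injective {i j : Fin m} (hij : i ≠ j) : Function.Injective
    (Sum.elim (fun x => .inl (i, x)) fun y => .inl (j, y) : Fin 3 ⊕ Fin 3 → Vertex m) := by
  rintro (x | x) (y | y) hxy <;> simp_all [hij.symm]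

theorem block_injective (i : Fin m) : Function.Injective
    (Sum.elim (fun x => .inl (i, x)) fun u => .inr u : Fin 3 ⊕ Fin 3 → Vertex m) := by
  rintro (x | x) (y | y) hxy <;> simp_all

set_option maxHeartbeats 1000000 in
/-- For regular parameters, there is no relation between the conditions that the double points
and the points of the complex impose on cubics. -/
theorem Params.Regular.relation_trivial {e : Params k m} (he : e.Regular) {l : ℕ}
    {v : Fin l → Vertex m} (hv : ∀ i, (v i).Allowed) (hv' : Function.Injective v)
    {s : Fin l → k} (hs : Function.Injective s) (W : PointIndex m → Vertex m → k)
    (μ : Fin l → Fin l → k)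
    (h : ∀ a b c, ∑ π, jetMon (e.pt π) (pivot π) (W π) a b c +
      complexMon (fun i j => complexVertex v s i - complexVertex v s j) μ a b c = 0) :
    W = 0 ∧ ∀ i j, i < j → μ i j = 0 := by
  classical
  simp only [Fintype.sum_sum_type (α₁ := Vertex m),
    Fintype.sum_sum_type (α₁ := {p : Fin m × Fin m // p.1 < p.2} × Fin 3), Params.pt, pivot,
    Sum.elim_inl, Sum.elim_inr, id, ← add_assoc] at h
  -- On squarefree monomials the coordinate points contribute nothing; they are set aside until the
  -- very end.
  have h' : ∀ a b c : Vertex m, a ≠ b → a ≠ c → b ≠ c →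
      ∑ p : {p : Fin m × Fin m // p.1 < p.2}, ∑ s, jetMon (e.pairPt p.1.1 p.1.2 s)
          (.inl (p.1.1, 0)) (W (.inr (.inl (p, s)))) a b c +
        ∑ i, ∑ r, jetMon (e.vertexPt i r) (.inl (i, 0)) (W (.inr (.inr (i, r)))) a b c +
      complexMon (fun i j => complexVertex v s i - complexVertex v s j) μ a b c = 0 := by
    intro a b c hab hac hbc
    have := h a b c
    rwa [Finset.sum_eq_zero fun x _ => jetMon_single hab hbc hac, zero_add,
      Fintype.sum_prod_type, Fintype.sum_prod_type] at this
  -- three blocks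
  have F1 : ∀ i j l, ∀ hij : i < j, ∀ hjl : j < l,
      (fun s z => W (.inr (.inl (⟨(i, j), hij⟩, s))) (.inl (l, z))) = 0 ∧
      (fun s z => W (.inr (.inl (⟨(i, l), hij.trans hjl⟩, s))) (.inl (j, z))) = 0 ∧
      (fun s z => W (.inr (.inl (⟨(j, l), hjl⟩, s))) (.inl (i, z))) = 0 := by
    -- With one variable in each of three blocks, only the points of the three pairs contribute,
    -- each through the derivative along the third block.
    intro i j l hij hjl
    have hil := hij.trans hjl
    refine he.trilinear i j l hij hjl _ _ _ fun x y z => ?_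
    have := h' (.inl (i, x)) (.inl (j, y)) (.inl (l, z)) (by simp [hij.ne]) (by simp [hil.ne])
      (by simp [hjl.ne])
    rw [complexMon_eq_zero_of_ne (by simp [hij.ne]) (by simp [hil.ne]) (by simp [hjl.ne])
      (by simp) (by simp) (by simp), add_zero, Finset.sum_eq_zero (s := Finset.univ (α := Fin m)),
      add_zero, ← Finset.sum_subset (Finset.subset_univ
        {⟨(i, j), hij⟩, ⟨(i, l), hil⟩, ⟨(j, l), hjl⟩}), Finset.sum_insert, Finset.sum_pair] at this
    · rw [← this, ← Finset.sum_add_distrib, ← Finset.sum_add_distrib]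
      refine Finset.sum_congr rfl fun s _ => ?_
      rw [jetMon_of_third (e.pairPt_of_ne hil.ne' hjl.ne' _ _) (by simp [hil.ne']),
        jetMon_of_second (e.pairPt_of_ne hij.ne' hjl.ne _ _) (by simp [hij.ne']),
        jetMon_of_first (e.pairPt_of_ne hij.ne hil.ne _ _) (by simp [hij.ne]),
        e.pairPt_left, e.pairPt_left, e.pairPt_left, e.pairPt_right hij.ne,
        e.pairPt_right hil.ne, e.pairPt_right hjl.ne]
      ring
    · simp [hij.ne]
    · simp [hij.ne, hjl.ne]
    · rintro ⟨⟨i', j'⟩, hij'⟩ - hp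
      simp only [Finset.mem_insert, Finset.mem_singleton, Subtype.mk.injEq, Prod.mk.injEq,
        not_or] at hp
      refine Finset.sum_eq_zero fun s _ => ?_
      dsimp only at hij' ⊢
      by_cases hi : i ≠ i' ∧ i ≠ j'
      · by_cases hj : j ≠ i' ∧ j ≠ j'
        · exact jetMon_eq_zero_of_left (e.pairPt_of_ne hi.1 hi.2 _ _)
            (e.pairPt_of_ne hj.1 hj.2 _ _)
        · exact jetMon_eq_zero_of_outer (e.pairPt_of_ne hi.1 hi.2 _ _)
            (e.pairPt_of_ne (by grind) (by grind) _ _)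
      · exact jetMon_eq_zero_of_right (e.pairPt_of_ne (by grind) (by grind) _ _)
          (e.pairPt_of_ne (by grind) (by grind) _ _)
    · intro i' _
      refine Finset.sum_eq_zero fun r _ => ?_
      by_cases hi : i = i'
      · exact jetMon_eq_zero_of_right (e.vertexPt_of_ne (by grind) _ _)
          (e.vertexPt_of_ne (by grind) _ _)
      · by_cases hj : j = i'
        · exact jetMon_eq_zero_of_outer (e.vertexPt_of_ne hi _ _)
            (e.vertexPt_of_ne (by grind) _ _)
        · exact jetMon_eq_zero_of_left (e.vertexPt_of_ne hi _ _) (e.vertexPt_of_ne hj _ _)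
  have G1 : ∀ i j, ∀ hij : i < j, ∀ l, l ≠ i → l ≠ j → ∀ s z,
      W (.inr (.inl (⟨(i, j), hij⟩, s))) (.inl (l, z)) = 0 := by
    intro i j hij l hi hj s z
    rcases lt_or_gt_of_ne hi with hi | hi
    · exact congr_fun (congr_fun (F1 l i j hi hij).2.2 s) z
    · rcases lt_or_gt_of_ne hj with hj | hj
      · exact congr_fun (congr_fun (F1 i l j hi hj).2.1 s) z
      · exact congr_fun (congr_fun (F1 i j l hij hj).1 s) z
  -- two blocks and `U`
  have F2 : ∀ i j, ∀ hij : i < j,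
      (fun s u => W (.inr (.inl (⟨(i, j), hij⟩, s))) (.inr u)) = 0 ∧
      (fun r y => W (.inr (.inr (i, r))) (.inl (j, y))) = 0 ∧
      (fun r y => W (.inr (.inr (j, r))) (.inl (i, y))) = 0 := by
    intro i j hij
    refine he.bipartite_vertex i j hij _ _ _ fun x y u hu => ?_
    have := h' (.inl (i, x)) (.inl (j, y)) (.inr u) (by simp [hij.ne]) (by simp) (by simp)
    -- For `u = 0` the equations in use have `x = 2` or `y = 2`, and this variable vanishes on the
    -- complex.
    have hc : complexMon (fun i j => complexVertex v s i - complexVertex v s j) μ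
        (.inl (i, x)) (.inl (j, y)) (.inr u) = 0 := by
      by_cases hu0 : u = 0
      · refine complexMon_eq_zero_of_not_allowed hv ?_
        by_cases hx : x = 2
        · exact .inl (by simp [Vertex.Allowed, hx])
        · exact .inr (by simp [Vertex.Allowed, hu hu0 hx])
      · exact complexMon_eq_zero_of_ne (by simp [hij.ne]) (by simp) (by simp) (by simp) (by simp)
          (by simpa using hu0)
    rw [hc, add_zero, Finset.sum_eq_single ⟨(i, j), hij⟩, ← Finset.sum_subset (Finset.subset_univ
        {i, j}), Finset.sum_pair hij.ne, ← add_assoc] at this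
    · rw [← this]
      refine congr_arg₂ _ (congr_arg₂ _ ?_ ?_) ?_
      · refine Finset.sum_congr rfl fun s _ => ?_
        rw [jetMon_of_third (e.pairPt_inr _ _ _ _) (by simp), e.pairPt_left,
          e.pairPt_right hij.ne]
        ring
      · refine Finset.sum_congr rfl fun r _ => ?_
        rw [jetMon_of_second (e.vertexPt_of_ne hij.ne' _ _) (by simp [hij.ne']), e.vertexPt_self,
          e.vertexPt_inr]
        ring
      · refine Finset.sum_congr rfl fun r _ => ?_
        rw [jetMon_of_first (e.vertexPt_of_ne hij.ne _ _) (by simp [hij.ne]), e.vertexPt_self,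
          e.vertexPt_inr]
        ring
    · intro l _ hl
      simp only [Finset.mem_insert, Finset.mem_singleton, not_or] at hl
      exact Finset.sum_eq_zero fun r _ => jetMon_eq_zero_of_left (e.vertexPt_of_ne (Ne.symm hl.1) _ _)
        (e.vertexPt_of_ne (Ne.symm hl.2) _ _)
    · rintro ⟨⟨i', j'⟩, hij'⟩ - hp
      simp only [ne_eq, Subtype.mk.injEq, Prod.mk.injEq] at hp
      refine Finset.sum_eq_zero fun s _ => ?_
      dsimp only at hij' ⊢
      by_cases hi : i ≠ i' ∧ i ≠ j'
      · exact jetMon_eq_zero_of_outer (e.pairPt_of_ne hi.1 hi.2 _ _) (e.pairPt_inr _ _ _ _)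
      · exact jetMon_eq_zero_of_right (e.pairPt_of_ne (by grind) (by grind) _ _)
          (e.pairPt_inr _ _ _ _)
    · simp
  have G2 : ∀ i j, i ≠ j → ∀ r y, W (.inr (.inr (i, r))) (.inl (j, y)) = 0 := by
    intro i j hij r y
    rcases lt_or_gt_of_ne hij with hij | hij
    · exact congr_fun (congr_fun (F2 i j hij).2.1 r) y
    · exact congr_fun (congr_fun (F2 j i hij).2.2 r) y
  -- two blocks
  have F3 : ∀ i j, ∀ hij : i < j, (fun s => W (.inr (.inl (⟨(i, j), hij⟩, s))) ∘
      (Sum.elim (fun x => .inl (i, x)) fun y => .inl (j, y) : Fin 3 ⊕ Fin 3 → Vertex m)) = 0 := by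
    intro i j hij
    set f : Fin 3 ⊕ Fin 3 → Vertex m := Sum.elim (fun x => .inl (i, x)) fun y => .inl (j, y)
    have hf : Function.Injective f := blocks_injective hij.ne
    -- Other pairs and the points in the span of a block and `U` either have two vanishing
    -- coordinates in the monomial, or contribute through derivatives already shown to have
    -- coefficient zero in `G1` and `G2`.
    have key : ∀ a b c : Fin 3 ⊕ Fin 3, a ≠ b → a ≠ c → b ≠ c →
        (∀ p : {p : Fin m × Fin m // p.1 < p.2}, p ≠ ⟨(i, j), hij⟩ → ∀ s,
          jetMon (e.pairPt p.1.1 p.1.2 s) (.inl (p.1.1, 0)) (W (.inr (.inl (p, s))))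
            (f a) (f b) (f c) = 0) →
        (∀ l r, jetMon (e.vertexPt l r) (.inl (l, 0)) (W (.inr (.inr (l, r))))
            (f a) (f b) (f c) = 0) →
        ∑ s, jetMon (Sum.elim (e.1 i j s) (e.1 j i s)) (.inl 0)
          (W (.inr (.inl (⟨(i, j), hij⟩, s))) ∘ f) a b c = 0 := by
      intro a b c hab hac hbc hp hq
      have := h' (f a) (f b) (f c) (hf.ne hab) (hf.ne hac) (hf.ne hbc)
      have hz : ∀ x, f x ≠ .inr 0 := by rintro (x | x) <;> simp [f]
      rw [complexMon_eq_zero_of_ne (hf.ne hab) (hf.ne hac) (hf.ne hbc) (hz _) (hz _) (hz _),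
        add_zero, Finset.sum_eq_zero (s := Finset.univ (α := Fin m))
          fun l _ => Finset.sum_eq_zero fun r _ => hq l r, add_zero,
        Finset.sum_eq_single ⟨(i, j), hij⟩ (fun p _ hne => Finset.sum_eq_zero fun s _ => hp p hne s)
          (by simp)] at this
      rw [← this]
      refine Finset.sum_congr rfl fun s _ => ?_
      have h0 : (.inl (i, 0) : Vertex m) = f (.inl 0) := rfl
      dsimp only
      rw [h0, jetMon_comp hf]
      congr 1
      ext (x | x)
      · exact (e.pairPt_left i j s x).symm
      · exact (e.pairPt_right hij.ne s x).symm
    refine he.bipartite i j hij _ (fun x x' y hx => ?_) fun x y y' hy => ?_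
    · refine key _ _ _ (by simpa using hx) (by simp) (by simp) ?_ ?_
      · rintro ⟨⟨i', j'⟩, hij'⟩ hp s
        simp only [ne_eq, Subtype.mk.injEq, Prod.mk.injEq] at hp
        dsimp only at hij' ⊢
        by_cases hi : i ≠ i' ∧ i ≠ j'
        · exact jetMon_eq_zero_of_left (e.pairPt_of_ne hi.1 hi.2 _ _)
            (e.pairPt_of_ne hi.1 hi.2 _ _)
        · have hj : j ≠ i' ∧ j ≠ j' := by grind
          rw [show f (.inr y) = .inl (j, y) from rfl,
            jetMon_of_third (e.pairPt_of_ne hj.1 hj.2 _ _) (by simp [hj.1]),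
            G1 i' j' hij' j hj.1 hj.2, zero_mul]
      · intro l r
        by_cases hi : i = l
        · subst hi
          rw [show f (.inr y) = .inl (j, y) from rfl,
            jetMon_of_third (e.vertexPt_of_ne hij.ne' _ _) (by simp [hij.ne']),
            G2 i j hij.ne, zero_mul]
        · exact jetMon_eq_zero_of_left (e.vertexPt_of_ne hi _ _) (e.vertexPt_of_ne hi _ _)
    · refine key _ _ _ (by simp) (by simp) (by simpa using hy) ?_ ?_
      · rintro ⟨⟨i', j'⟩, hij'⟩ hp s
        simp only [ne_eq, Subtype.mk.injEq, Prod.mk.injEq] at hp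
        dsimp only at hij' ⊢
        by_cases hj : j ≠ i' ∧ j ≠ j'
        · exact jetMon_eq_zero_of_right (e.pairPt_of_ne hj.1 hj.2 _ _)
            (e.pairPt_of_ne hj.1 hj.2 _ _)
        · have hi : i ≠ i' ∧ i ≠ j' := by grind
          rw [show f (.inl x) = .inl (i, x) from rfl,
            jetMon_of_first (e.pairPt_of_ne hi.1 hi.2 _ _) (by simp [hi.1]),
            G1 i' j' hij' i hi.1 hi.2, zero_mul]
      · intro l r
        by_cases hj : j = l
        · subst hj
          rw [show f (.inl x) = .inl (i, x) from rfl,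
            jetMon_of_first (e.vertexPt_of_ne hij.ne _ _) (by simp [hij.ne]),
            G2 j i hij.ne', zero_mul]
        · exact jetMon_eq_zero_of_right (e.vertexPt_of_ne hj _ _) (e.vertexPt_of_ne hj _ _)
  have G3 : ∀ p s, W (.inr (.inl (p, s))) = 0 := by
    rintro ⟨⟨i, j⟩, hij⟩ s
    ext (⟨l, x⟩ | u)
    · by_cases hi : l = i
      · subst hi
        exact congr_fun (congr_fun (F3 l j hij) s) (.inl x)
      · by_cases hj : l = j
        · subst hj
          exact congr_fun (congr_fun (F3 i l hij) s) (.inr x)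
        · exact G1 i j hij l hi hj s x
    · exact congr_fun (congr_fun (F2 i j hij).1 s) u
  have hjet0 : ∀ (p : Vertex m → k) i a b c, jetMon p i 0 a b c = 0 := by
    intro p i a b c
    simp [jetMon]
  -- one block and `U`
  have F4 : ∀ i, (fun r => W (.inr (.inr (i, r))) ∘
      (Sum.elim (fun x => .inl (i, x)) fun u => .inr u : Fin 3 ⊕ Fin 3 → Vertex m)) = 0 := by
    intro i
    set f : Fin 3 ⊕ Fin 3 → Vertex m := Sum.elim (fun x => .inl (i, x)) fun u => .inr u
    have hf : Function.Injective f := block_injective i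
    have key : ∀ a b c : Fin 3 ⊕ Fin 3, a ≠ b → a ≠ c → b ≠ c →
        complexMon (fun i j => complexVertex v s i - complexVertex v s j) μ
          (f a) (f b) (f c) = 0 →
        (∀ l, l ≠ i → ∀ r, jetMon (e.vertexPt l r) (.inl (l, 0)) (W (.inr (.inr (l, r))))
            (f a) (f b) (f c) = 0) →
        ∑ r, jetMon (Sum.elim (e.2.1 i r) (e.qU i r)) (.inl 0)
          (W (.inr (.inr (i, r))) ∘ f) a b c = 0 := by
      intro a b c hab hac hbc hc hq
      have := h' (f a) (f b) (f c) (hf.ne hab) (hf.ne hac) (hf.ne hbc)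
      rw [hc, add_zero, Finset.sum_eq_zero fun p _ => Finset.sum_eq_zero fun s _ => by
          rw [G3 p s]; exact hjet0 _ _ _ _ _, zero_add, Finset.sum_eq_single i
          (fun l _ hne => Finset.sum_eq_zero fun s _ => hq l hne s) (by simp)] at this
      rw [← this]
      refine Finset.sum_congr rfl fun r _ => ?_
      have h0 : (.inl (i, 0) : Vertex m) = f (.inl 0) := rfl
      rw [h0, jetMon_comp hf]
      congr 1
      ext (x | x)
      · exact (e.vertexPt_self i r x).symm
      · rfl
    refine he.block_vertex i _ ?_ (fun x x' u hx hu => ?_) fun x u u' hu hx hu' => ?_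
    · exact key _ _ _ (by simp) (by simp) (by simp)
        (complexMon_eq_zero_of_ne (hf.ne (by simp)) (hf.ne (by simp)) (hf.ne (by simp))
          (by simp [f]) (by simp [f]) (by simp [f])) fun l hl r =>
        jetMon_eq_zero_of_left (e.vertexPt_of_ne hl.symm _ _) (e.vertexPt_of_ne hl.symm _ _)
    · refine key _ _ _ (by simpa using hx) (by simp) (by simp) ?_ fun l hl r =>
        jetMon_eq_zero_of_left (e.vertexPt_of_ne hl.symm _ _) (e.vertexPt_of_ne hl.symm _ _)
      by_cases hu0 : u = 0
      · exact complexMon_eq_zero_of_not_allowed hv (.inr (by simp [f, Vertex.Allowed, hu hu0]))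
      · exact complexMon_eq_zero_of_ne (hf.ne (by simpa using hx)) (hf.ne (by simp))
          (hf.ne (by simp)) (by simp [f]) (by simp [f]) (by simpa [f] using hu0)
    · refine key _ _ _ (by simp) (by simp) (by simpa using hu) ?_ fun l hl r => ?_
      · by_cases hu0 : u = 0
        · exact complexMon_eq_zero_of_not_allowed hv (.inl (by simp [f, Vertex.Allowed, hx hu0]))
        · exact complexMon_eq_zero_of_ne (hf.ne (by simp)) (hf.ne (by simp))
            (hf.ne (by simpa using hu)) (by simp [f]) (by simpa [f] using hu0)
            (by simpa [f] using hu')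
      · rw [show f (.inl x) = .inl (i, x) from rfl,
          jetMon_of_first (e.vertexPt_of_ne hl.symm _ _) (by simp [hl.symm]), G2 l i hl, zero_mul]
  have G4 : ∀ p, W (.inr (.inr p)) = 0 := by
    rintro ⟨i, r⟩
    ext (⟨l, x⟩ | u)
    · by_cases hi : l = i
      · subst hi
        exact congr_fun (congr_fun (F4 l) r) (.inl x)
      · exact G2 i l (Ne.symm hi) r x
    · exact congr_fun (congr_fun (F4 i) r) (.inr u)
  have hW2 : ∀ a b c : Vertex m, ∑ p : {p : Fin m × Fin m // p.1 < p.2} × Fin 3,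
      jetMon (e.pairPt p.1.1.1 p.1.1.2 p.2) (.inl (p.1.1.1, 0)) (W (.inr (.inl p))) a b c = 0 :=
    fun a b c => Finset.sum_eq_zero fun p _ => by rw [G3 p.1 p.2]; exact hjet0 _ _ _ _ _
  have hW3 : ∀ a b c : Vertex m, ∑ p : Fin m × Fin 2,
      jetMon (e.vertexPt p.1 p.2) (.inl (p.1, 0)) (W (.inr (.inr p))) a b c = 0 :=
    fun a b c => Finset.sum_eq_zero fun p _ => by rw [G4 p]; exact hjet0 _ _ _ _ _
  -- All double points off the coordinate points have been eliminated, so this monomial isolates one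
  -- point of the complex.
  have hμ : ∀ i j, i < j → μ i j = 0 := by
    intro i j hij
    have h0 : ∀ i, v i ≠ .inr 0 := fun i h => by simpa [h, Vertex.Allowed] using hv i
    have := h (.inr 0) (v i) (v j)
    rw [hW2, hW3, Finset.sum_eq_zero fun x _ => jetMon_single (h0 i).symm (hv'.ne hij.ne)
      (h0 j).symm, complexMon_vertices hv hv' hij] at this
    have hne : (s i - s j) * (1 * -1) ≠ 0 := by simpa [sub_eq_zero] using hs.ne hij.ne'
    simp only [zero_add] at this
    exact (mul_eq_zero.1 this).resolve_right hne
  refine ⟨?_, hμ⟩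
  have hμ' : ∀ a b c, complexMon (fun i j => complexVertex v s i - complexVertex v s j) μ
      a b c = 0 := fun a b c => Finset.sum_eq_zero fun i _ => Finset.sum_eq_zero fun j _ => by
    split_ifs with hij
    · rw [hμ i j hij, zero_mul]
    · rfl
  ext (x | p | p) j
  · have := h x x j
    rw [hW2, hW3, hμ', Finset.sum_eq_single x] at this
    · by_cases hj : j = x
      · subst hj
        simpa [jetMon] using this
      · simpa [jetMon, hj] using this
    · intro x' _ hx'
      exact jetMon_eq_zero_of_left (Pi.single_eq_of_ne hx'.symm _) (Pi.single_eq_of_ne hx'.symm _)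
    · simp
  · rw [G3 p.1 p.2]; rfl
  · rw [G4 p]; rfl

end Relations

end ProjSpace

namespace ProjSpace

/-! ### Restriction to `n + 1` variables, for every residue of `n` modulo three. -/

section Restriction

variable {k : Type*} [Field k]

theorem card_lt_pairs (m : ℕ) :
    Fintype.card {p : Fin m × Fin m // p.1 < p.2} = m.choose 2 := by
  have e : {p : Fin m × Fin m // p.1 < p.2} ≃ (Σ j : Fin m, {i : Fin m // i < j}) :=
    { toFun := fun p => ⟨p.1.2, p.1.1, p.2⟩
      invFun := fun q => ⟨(q.2.1, q.1), q.2.2⟩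
      left_inv := fun p => rfl
      right_inv := fun q => rfl }
  rw [Fintype.card_congr e, Fintype.card_sigma]
  have : ∀ j : Fin m, Fintype.card {i : Fin m // i < j} = j := by
    intro j
    rw [Fintype.card_subtype]
    convert Fin.card_Iio j using 2
    ext i; simp
  simp only [this]
  rw [Fin.sum_univ_eq_sum_range (fun i => i), Finset.sum_range_id, Nat.choose_two_right]

theorem complexMon_comp {τ τ' : Type*} {l : ℕ} (y : Fin l → Fin l → τ → k) (μ : Fin l → Fin l → k)
    (f : τ' → τ) (a b c : τ') :
    complexMon y μ (f a) (f b) (f c) = complexMon (fun i j => y i j ∘ f) μ a b c := rfl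

/-- The variables of `P^n`, as the first ones in the list of `n / 3` blocks of three variables and
of the variables in `U`. -/
def vertexOfFin (n : ℕ) (j : Fin (n + 1)) : Vertex (n / 3) :=
  if h : j.1 < 3 * (n / 3) then .inl (⟨j.1 / 3, by omega⟩, ⟨j.1 % 3, by omega⟩)
  else .inr ⟨j.1 - 3 * (n / 3), by omega⟩

theorem vertexOfFin_injective (n : ℕ) : Function.Injective (vertexOfFin n) := by
  intro i j h
  unfold vertexOfFin at h
  split_ifs at h with h1 h2 h2
  · simp only [Sum.inl.injEq, Prod.mk.injEq, Fin.mk.injEq] at h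
    exact Fin.ext (by omega)
  · simp only [Sum.inr.injEq, Fin.mk.injEq] at h
    exact Fin.ext (by omega)

theorem inl_mem_range_vertexOfFin (n : ℕ) (x : Fin (n / 3) × Fin 3) :
    .inl x ∈ Set.range (vertexOfFin n) := by
  have h1 := x.1.2
  have h2 := x.2.2
  refine ⟨⟨3 * x.1.1 + x.2.1, by omega⟩, ?_⟩
  have h : 3 * x.1.1 + x.2.1 < 3 * (n / 3) := by omega
  rw [vertexOfFin, dif_pos h]
  congr 1
  ext
  · simp only; omega
  · simp only; omega

theorem inr_mem_range_vertexOfFin (n : ℕ) (u : Fin 3) (hu : u.1 ≤ n % 3) :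
    .inr u ∈ Set.range (vertexOfFin n) := by
  refine ⟨⟨3 * (n / 3) + u.1, by omega⟩, ?_⟩
  rw [vertexOfFin, dif_neg (by simp)]
  congr 1
  ext
  simp

theorem lt_of_notMem_range_vertexOfFin {n : ℕ} {x : Vertex (n / 3)}
    (hx : x ∉ Set.range (vertexOfFin n)) : ∃ u : Fin 3, x = .inr u ∧ n % 3 < u.1 := by
  rcases x with x | u
  · exact absurd (inl_mem_range_vertexOfFin n x) hx
  · exact ⟨u, rfl, by by_contra h; exact hx (inr_mem_range_vertexOfFin n u (by omega))⟩

/-- The double points of the configuration which lie in the subspace of the first `n + 1`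
variables. -/
def pointIndexOf (n : ℕ) :
    Fin (n + 1) ⊕ (({p : Fin (n / 3) × Fin (n / 3) // p.1 < p.2} × Fin 3) ⊕
      (Fin (n / 3) × Fin (n % 3))) → PointIndex (n / 3) :=
  Sum.map (vertexOfFin n) (Sum.map id (Prod.map id
    (Fin.castLE (Nat.le_of_lt_succ (Nat.mod_lt n (by norm_num))))))

theorem pointIndexOf_injective (n : ℕ) : Function.Injective (pointIndexOf n) :=
  (vertexOfFin_injective n).sumMap (Function.injective_id.sumMap
    (Function.injective_id.prodMap (Fin.castLE_injective _)))

/-- If `n % 3 = 0`, no point in the span of a block and `U` is used. If `n % 3 = 1`, only the last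
variable is dropped and only the first such point of each block is used, whose last coordinate is
zero by construction of `Params.qU`. If `n % 3 = 2`, no variable is dropped. -/
theorem pt_pointIndexOf_eq_zero {n : ℕ} (e : Params k (n / 3)) (π) {x : Vertex (n / 3)}
    (hx : x ∉ Set.range (vertexOfFin n)) : e.pt (pointIndexOf n π) x = 0 := by
  obtain ⟨u, rfl, hu⟩ := lt_of_notMem_range_vertexOfFin hx
  rcases π with j | p | ⟨i, r⟩
  · exact Pi.single_eq_of_ne (fun h => hx ⟨j, h.symm⟩) _
  · rfl
  · have hr := r.2
    have hu2 : u = 2 := by ext; simp; omega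
    have hr0 : (Fin.castLE (Nat.le_of_lt_succ (Nat.mod_lt n (by norm_num))) r : Fin 2) = 0 := by
      ext; simp; omega
    simp only [Params.pt, pointIndexOf, Sum.map_inr, Prod.map, Sum.elim_inr, Params.vertexPt,
      Params.qU, id, hr0, hu2, and_self, if_true]

theorem pivot_pointIndexOf_mem (n : ℕ) (π) :
    pivot (pointIndexOf n π) ∈ Set.range (vertexOfFin n) := by
  rcases π with j | p | p
  · exact ⟨j, rfl⟩
  · exact inl_mem_range_vertexOfFin n _
  · exact inl_mem_range_vertexOfFin n _

theorem exists_allowed (n l : ℕ) (hl : l ≤ 2 * (n / 3) + n % 3) :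
    ∃ v : Fin l → Vertex (n / 3), (∀ i, (v i).Allowed) ∧ Function.Injective v ∧
      ∀ i, v i ∈ Set.range (vertexOfFin n) := by
  let g : (Fin (n / 3) × Fin 2) ⊕ Fin (n % 3) → Vertex (n / 3) :=
    Sum.map (Prod.map id Fin.castSucc)
      fun u => Fin.succ (Fin.castLE (Nat.le_of_lt_succ (Nat.mod_lt n (by norm_num))) u)
  have hg : Function.Injective g :=
    (Function.injective_id.prodMap (Fin.castSucc_injective 2)).sumMap
      ((Fin.succ_injective 2).comp (Fin.castLE_injective _))
  obtain ⟨f⟩ : Nonempty (Fin l ↪ (Fin (n / 3) × Fin 2) ⊕ Fin (n % 3)) :=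
    Function.Embedding.nonempty_of_card_le (by simp; omega)
  refine ⟨g ∘ f, fun i => ?_, hg.comp f.injective, fun i => ?_⟩
  · show (g (f i)).Allowed
    rcases f i with x | u
    · exact (Fin.castSucc_lt_last x.2).ne
    · exact Fin.succ_ne_zero _
  · show g (f i) ∈ _
    rcases f i with x | u
    · exact inl_mem_range_vertexOfFin n _
    · refine inr_mem_range_vertexOfFin n _ ?_
      exact u.2

/-- The point in which the line joining `x` and `y` meets the hyperplane `κ = 0`. -/
def meet {n : ℕ} (κ : Module.Dual k (Fin (n + 1) → k)) (x y : Fin (n + 1) → k) :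
    Fin (n + 1) → k :=
  κ y • x - κ x • y

/-- There are double points, including the coordinate points, and a complex, which impose
independent conditions on cubics. -/
theorem exists_independent [Infinite k] (n r l : ℕ)
    (hr : r ≤ 3 * (n / 3).choose 2 + n / 3 * (n % 3)) (hl : l ≤ 2 * (n / 3) + n % 3) :
    ∃ (p : Fin r → Fin (n + 1) → k) (piv : Fin r → Fin (n + 1)) (x : Fin l → Fin (n + 1) → k)
      (κ : Module.Dual k (Fin (n + 1) → k)),
      ∀ (W : Fin (n + 1) ⊕ Fin r → Fin (n + 1) → k) (μ : Fin l → Fin l → k),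
        (∀ a b c, ∑ π, jetMon (Sum.elim (fun j => Pi.single j 1) p π) (Sum.elim id piv π)
          (W π) a b c + complexMon (fun i j => meet κ (x i) (x j)) μ a b c = 0) →
        W = 0 ∧ ∀ i j, i < j → μ i j = 0 := by
  classical
  obtain ⟨e, he⟩ := exists_regular k (n / 3)
  obtain ⟨v, hv, hv', hvr⟩ := exists_allowed n l hl
  obtain ⟨g⟩ : Nonempty (Fin r ↪ ({p : Fin (n / 3) × Fin (n / 3) // p.1 < p.2} × Fin 3) ⊕
      (Fin (n / 3) × Fin (n % 3))) := by
    refine Function.Embedding.nonempty_of_card_le ?_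
    rw [Fintype.card_sum, Fintype.card_prod, card_lt_pairs]
    simp
    omega
  let s : Fin l → k := fun i => Infinite.natEmbedding k i
  have hs : Function.Injective s := fun i j h =>
    Fin.ext ((Infinite.natEmbedding k).injective h)
  set τ := vertexOfFin n with hτ
  have hτi : Function.Injective τ := vertexOfFin_injective n
  let ψ : Fin (n + 1) ⊕ Fin r → PointIndex (n / 3) := fun π => pointIndexOf n (Sum.map id g π)
  have hψ : Function.Injective ψ :=
    (pointIndexOf_injective n).comp (Function.injective_id.sumMap g.injective)
  choose piv hpiv using fun π => pivot_pointIndexOf_mem n (Sum.map id g π)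
  have hvz : ∀ i, v i ≠ .inr 0 := fun i h => by simpa [h, Vertex.Allowed] using hv i
  -- The form omits the variable of the translations, so it takes the value one at every vertex and
  -- the points of the complex become differences of vertices.
  let κ : Module.Dual k (Fin (n + 1) → k) :=
    ∑ j, if τ j = .inr 0 then 0 else LinearMap.proj j
  let x : Fin l → Fin (n + 1) → k := fun i => complexVertex v s i ∘ τ
  have hκ : ∀ i, κ (x i) = 1 := by
    intro i
    obtain ⟨j, hj⟩ := hvr i
    simp only [κ, x, LinearMap.sum_apply]
    rw [Finset.sum_eq_single j]
    · rw [if_neg (by rw [hj]; exact hvz i)]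
      simp [complexVertex, hj, Pi.single_eq_of_ne (hvz i)]
    · intro j' _ hj'
      split_ifs with h
      · rfl
      · have : τ j' ≠ v i := by rw [← hj]; exact hτi.ne hj'
        simp [complexVertex, Pi.single_eq_of_ne h, Pi.single_eq_of_ne this]
    · simp
  refine ⟨fun i => e.pt (ψ (.inr i)) ∘ τ, fun i => piv (.inr i), x, κ, fun W μ h => ?_⟩
  have hp : ∀ π : Fin (n + 1) ⊕ Fin r, (Sum.elim (fun j => Pi.single j 1)
      (fun i => e.pt (ψ (.inr i)) ∘ τ) π : Fin (n + 1) → k) = e.pt (ψ π) ∘ τ := by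
    rintro (j | i)
    · ext j'
      simp [ψ, Params.pt, pointIndexOf, Pi.single_apply, hτi.eq_iff, ← hτ]
    · rfl
  have hpv : ∀ π : Fin (n + 1) ⊕ Fin r, τ (Sum.elim id (fun i => piv (.inr i)) π) =
      pivot (ψ π) := by
    rintro (j | i)
    · rfl
    · exact hpiv _
  have hy : ∀ i j, meet κ (x i) (x j) =
      (complexVertex v s i - complexVertex v s j) ∘ τ := by
    intro i j
    simp only [meet, hκ, one_smul]
    rfl
  -- All chosen points have zero coordinates outside the first `n + 1` variables, so a relation
  -- extended by zero is a relation for the full configuration.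
  let W' : PointIndex (n / 3) → Vertex (n / 3) → k :=
    Function.extend ψ (fun π => Function.extend τ (W π) 0) 0
  have hW' : ∀ π, W' (ψ π) = Function.extend τ (W π) 0 := fun π => hψ.extend_apply _ _ π
  have hsum : ∀ a b c, ∑ π, jetMon (e.pt π) (pivot π) (W' π) a b c =
      ∑ π, jetMon (e.pt (ψ π)) (pivot (ψ π)) (W' (ψ π)) a b c := by
    intro a b c
    symm
    refine Fintype.sum_of_injective ψ hψ _ _ (fun π hπ => ?_) fun _ => rfl
    have : W' π = 0 := Function.extend_apply' _ _ _ (by simpa using hπ)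
    simp [this, jetMon]
  have hout : ∀ π x, x ∉ Set.range τ → e.pt (ψ π) x = 0 ∧ W' (ψ π) x = 0 := by
    intro π x hx
    refine ⟨pt_pointIndexOf_eq_zero e _ hx, ?_⟩
    rw [hW', Function.extend_apply' _ _ _ (by simpa using hx)]
    rfl
  have hyout : ∀ i j x, x ∉ Set.range τ →
      (complexVertex v s i - complexVertex v s j) x = 0 := by
    intro i j x hx
    have h0 : (.inr 0 : Vertex (n / 3)) ∈ Set.range τ := inr_mem_range_vertexOfFin n 0 (by simp)
    exact complexVertex_sub_eq_zero (fun h => hx (h ▸ h0)) (fun h => hx (h ▸ hvr i))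
      fun h => hx (h ▸ hvr j)
  have key : ∀ a b c, ∑ π, jetMon (e.pt π) (pivot π) (W' π) a b c +
      complexMon (fun i j => complexVertex v s i - complexVertex v s j) μ a b c = 0 := by
    intro a b c
    rw [hsum]
    by_cases habc : a ∈ Set.range τ ∧ b ∈ Set.range τ ∧ c ∈ Set.range τ
    · obtain ⟨⟨a, rfl⟩, ⟨b, rfl⟩, ⟨c, rfl⟩⟩ := habc
      rw [← h a b c]
      refine congr_arg₂ _ (Finset.sum_congr rfl fun π _ => ?_) ?_
      · rw [← hpv, jetMon_comp hτi, hp, hW', Function.extend_comp hτi]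
      · rw [complexMon_comp]
        simp only [hy]
    · have hne : a ∉ Set.range τ ∨ b ∉ Set.range τ ∨ c ∉ Set.range τ := by tauto
      rw [complexMon_eq_zero fun i j _ => hne.imp (hyout i j a)
        (Or.imp (hyout i j b) (hyout i j c)), add_zero]
      refine Finset.sum_eq_zero fun π _ => ?_
      rcases hne with hne | hne | hne <;> simp [jetMon, hout π _ hne]
  obtain ⟨hW0, hμ⟩ := he.relation_trivial hv hv' hs W' μ key
  refine ⟨?_, hμ⟩
  ext π j
  have := congr_fun (hW' π) (τ j)
  rw [hW0, hτi.extend_apply] at this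
  exact this.symm

end Restriction

end ProjSpace

namespace ProjSpace

/-! ### Directional derivatives, double points and squarefree forms. -/

section Derivative

open MvPolynomial

variable {k : Type*} [Field k] {σ : Type*} [Fintype σ]

/-- The derivative at `x` in the direction `w`. -/
noncomputable def dirDeriv (x w : σ → k) : MvPolynomial σ k →ₗ[k] k :=
  ∑ j, w j • ((aeval x).toLinearMap ∘ₗ (pderiv j).toLinearMap)

theorem dirDeriv_apply (x w : σ → k) (f : MvPolynomial σ k) :
    dirDeriv x w f = ∑ j, w j * eval x (pderiv j f) := by
  simp [dirDeriv, LinearMap.sum_apply, aeval_eq_eval]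

theorem dirDeriv_mul (x w : σ → k) (f g : MvPolynomial σ k) :
    dirDeriv x w (f * g) = dirDeriv x w f * eval x g + eval x f * dirDeriv x w g := by
  simp only [dirDeriv_apply, Derivation.leibniz, map_add, smul_eq_mul, map_mul, mul_add,
    Finset.sum_add_distrib, Finset.sum_mul, Finset.mul_sum]
  rw [add_comm]
  congr 1 <;> exact Finset.sum_congr rfl fun _ _ => by ring

theorem dirDeriv_X [DecidableEq σ] (x w : σ → k) (i : σ) : dirDeriv x w (X i) = w i := by
  rw [dirDeriv_apply, Finset.sum_eq_single i]
  · simp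
  · intro j _ hj
    simp [pderiv_X_of_ne hj.symm]
  · simp

theorem dirDeriv_C (x w : σ → k) (c : k) : dirDeriv x w (C c : MvPolynomial σ k) = 0 := by
  simp [dirDeriv_apply]

theorem dirDeriv_single [DecidableEq σ] (x : σ → k) (i : σ) (f : MvPolynomial σ k) :
    dirDeriv x (Pi.single i 1) f = eval x (pderiv i f) := by
  rw [dirDeriv_apply, Finset.sum_eq_single i]
  · simp
  · intro j _ hj
    simp [hj]
  · simp

theorem dirDeriv_add_right (x w w' : σ → k) (f : MvPolynomial σ k) :
    dirDeriv x (w + w') f = dirDeriv x w f + dirDeriv x w' f := by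
  simp [dirDeriv_apply, add_mul, Finset.sum_add_distrib]

theorem dirDeriv_smul_right (x w : σ → k) (c : k) (f : MvPolynomial σ k) :
    dirDeriv x (c • w) f = c * dirDeriv x w f := by
  simp [dirDeriv_apply, Finset.mul_sum, mul_assoc]

theorem dirDeriv_self {f : MvPolynomial σ k} {d : ℕ} (hf : f.IsHomogeneous d) (x : σ → k) :
    dirDeriv x x f = d * eval x f := by
  have := congr_arg (eval x) hf.sum_X_mul_pderiv
  simpa [dirDeriv_apply] using this

/-- The polynomial `f` vanishes to order two at `x`. -/
def DoubleAt (x : σ → k) (f : MvPolynomial σ k) : Prop :=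
  eval x f = 0 ∧ ∀ w, dirDeriv x w f = 0

/-- The polynomials which vanish to order two at `x`. -/
def doubleSubmodule (x : σ → k) : Submodule k (MvPolynomial σ k) where
  carrier := {f | DoubleAt x f}
  zero_mem' := ⟨by simp, by simp⟩
  add_mem' := fun hf hg => ⟨by rw [map_add, hf.1, hg.1, add_zero], fun w => by
    rw [map_add, hf.2, hg.2, add_zero]⟩
  smul_mem' := fun c f hf => ⟨by rw [smul_eval, hf.1, mul_zero], fun w => by
    rw [map_smul, hf.2, smul_zero]⟩

theorem mem_doubleSubmodule {x : σ → k} {f : MvPolynomial σ k} :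
    f ∈ doubleSubmodule x ↔ DoubleAt x f := Iff.rfl

/-- The polynomials whose values at `x` vanish. -/
noncomputable def vanishSubmodule (x : σ → k) : Submodule k (MvPolynomial σ k) :=
  LinearMap.ker (aeval x).toLinearMap

theorem mem_vanishSubmodule {x : σ → k} {f : MvPolynomial σ k} :
    f ∈ vanishSubmodule x ↔ eval x f = 0 := by
  simp [vanishSubmodule, aeval_eq_eval]

/-- The polynomials which vanish at `x`, as well as their derivative in the direction `w`. -/
noncomputable def tangentSubmodule (x w : σ → k) : Submodule k (MvPolynomial σ k) :=
  vanishSubmodule x ⊓ LinearMap.ker (dirDeriv x w)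

theorem mem_tangentSubmodule {x w : σ → k} {f : MvPolynomial σ k} :
    f ∈ tangentSubmodule x w ↔ eval x f = 0 ∧ dirDeriv x w f = 0 := by
  simp [tangentSubmodule, mem_vanishSubmodule]

theorem eval_coordinate [DecidableEq σ] {f : MvPolynomial σ k} {d : ℕ} (hf : f.IsHomogeneous d)
    (i : σ) : eval (Pi.single i 1) f = coeff (Finsupp.single i d) f := by
  rw [eval_eq', Finset.sum_eq_single (Finsupp.single i d)]
  · rw [Finset.prod_eq_one, mul_one]
    intro j _
    by_cases hj : j = i
    · subst hj; simp
    · simp [hj]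
  · intro e he hne
    have : ∃ j, j ≠ i ∧ e j ≠ 0 := by
      by_contra! H
      apply hne
      have he' : e = Finsupp.single i (e i) := by
        ext j
        by_cases hj : j = i
        · subst hj; simp
        · rw [H j hj, Finsupp.single_eq_of_ne hj]
      have hdeg := hf.degree_eq_sum_deg_support he
      have hdeg' : d = e.degree := hdeg
      rw [he', Finsupp.degree_single] at hdeg'
      rw [he', ← hdeg']
    obtain ⟨j, hj, hej⟩ := this
    rw [Finset.prod_eq_zero (Finset.mem_univ j), mul_zero]
    rw [Pi.single_eq_of_ne hj, zero_pow hej]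
  · intro h
    rw [notMem_support_iff.1 h, zero_mul]

theorem finrank_homogeneousSubmodule (d : ℕ) :
    Module.finrank k (homogeneousSubmodule σ k d) = (Fintype.card σ + d - 1).choose d := by
  classical
  rw [homogeneousSubmodule_eq_finsupp_supported,
    (AddMonoidAlgebra.supportedEquivFinsupp _).finrank_eq]
  have : {e : σ →₀ ℕ | e.degree = d} = ((Finset.univ : Finset σ).finsuppAntidiag d : Set _) := by
    ext e
    simp [Finset.mem_finsuppAntidiag, Finsupp.degree_eq_sum]
  rw [this, Module.finrank_finsupp_self, ← Nat.card_eq_fintype_card, Nat.card_coe_set_eq,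
    Set.ncard_coe_finset, Finset.card_finsuppAntidiag_nat_eq_choose, Finset.card_univ]

instance (d : ℕ) : Module.Finite k (homogeneousSubmodule σ k d) :=
  Module.Finite.iff_fg.2 (homogeneousSubmodule_fg σ k d)

/-- The degree in `X_i` of a cubic with a double point at the `i`-th coordinate point
is at most one. -/
theorem support_le_one [DecidableEq σ] {f : MvPolynomial σ k} (hf : f.IsHomogeneous 3) {i : σ}
    (h : DoubleAt (Pi.single i 1) f) {d : σ →₀ ℕ} (hd : d ∈ f.support) : d i ≤ 1 := by
  by_contra! hi
  have hdeg : ∑ j, d j = 3 := by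
    rw [← Finsupp.degree_eq_sum]
    exact (hf.degree_eq_sum_deg_support hd).symm
  rw [← Finset.add_sum_erase _ _ (Finset.mem_univ i)] at hdeg
  by_cases h3 : d i = 3
  · have h0 : ∀ j, j ≠ i → d j = 0 := by
      intro j hj
      have : ∑ j ∈ Finset.univ.erase i, d j = 0 := by omega
      exact Finset.sum_eq_zero_iff.1 this j (by simp [hj])
    have hd' : d = Finsupp.single i 3 := by
      ext j
      by_cases hj : j = i
      · subst hj; simp [h3]
      · rw [h0 j hj, Finsupp.single_eq_of_ne hj]
    have := h.1
    rw [eval_coordinate hf, ← hd'] at this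
    exact mem_support_iff.1 hd this
  · have h1 : ∑ j ∈ Finset.univ.erase i, d j = 1 := by omega
    obtain ⟨j, hj, hdj⟩ : ∃ j ∈ Finset.univ.erase i, d j ≠ 0 := by
      by_contra! H
      rw [Finset.sum_eq_zero H] at h1
      omega
    have hji : j ≠ i := Finset.ne_of_mem_erase hj
    rw [← Finset.add_sum_erase _ _ hj] at h1
    have h0 : ∀ l, l ≠ i → l ≠ j → d l = 0 := by
      intro l hl hl'
      have : ∑ j ∈ (Finset.univ.erase i).erase j, d j = 0 := by omega
      exact Finset.sum_eq_zero_iff.1 this l (by simp [hl, hl'])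
    have hd' : d = Finsupp.single i 2 + Finsupp.single j 1 := by
      ext l
      by_cases hl : l = i
      · subst hl
        simp [hji.symm]
        omega
      · by_cases hl' : l = j
        · subst hl'
          simp [hl]
          omega
        · simp [hl, hl', h0]
    have := h.2 (Pi.single j 1)
    rw [dirDeriv_single, eval_coordinate hf.pderiv, coeff_pderiv] at this
    rw [hd'] at hd
    simp [hji] at this
    exact mem_support_iff.1 hd this

/-- For a polynomial affine in one variable the first order expansion along that variable is exact,
in every characteristic. -/
theorem eval_update_of_support_le_one [DecidableEq σ] {f : MvPolynomial σ k} {i : σ}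
    (h : ∀ d ∈ f.support, d i ≤ 1) (x : σ → k) (t : k) :
    eval (Function.update x i (x i + t)) f = eval x f + t * eval x (pderiv i f) := by
  have key : ∀ d ∈ f.support, eval (Function.update x i (x i + t)) (monomial d (coeff d f)) =
      eval x (monomial d (coeff d f)) + t * eval x (pderiv i (monomial d (coeff d f))) := by
    intro d hd
    have hsplit : ∀ y : σ → k, eval y (monomial d (coeff d f)) =
        coeff d f * (y i ^ d i * ∏ j ∈ Finset.univ.erase i, y j ^ d j) := by
      intro y
      rw [eval_monomial, Finsupp.prod_fintype _ _ (by simp),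
        ← Finset.mul_prod_erase _ _ (Finset.mem_univ i)]
    have hprod : ∏ j ∈ Finset.univ.erase i, (Function.update x i (x i + t)) j ^ d j =
        ∏ j ∈ Finset.univ.erase i, x j ^ d j :=
      Finset.prod_congr rfl fun j hj => by
        rw [Function.update_of_ne (Finset.ne_of_mem_erase hj)]
    rw [hsplit, hsplit, hprod, Function.update_self, pderiv_monomial]
    have := h d hd
    interval_cases hdi : d i
    · simp
    · have hprod' : eval x (monomial (d - Finsupp.single i 1) (coeff d f * ((1 : ℕ) : k))) =
          coeff d f * ∏ j ∈ Finset.univ.erase i, x j ^ d j := by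
        rw [eval_monomial, Finsupp.prod_fintype _ _ (by simp),
          ← Finset.mul_prod_erase _ _ (Finset.mem_univ i)]
        simp only [Finsupp.coe_tsub, Pi.sub_apply, hdi, Finsupp.single_eq_same, Nat.sub_self,
          pow_zero, one_mul, Nat.cast_one, mul_one]
        congr 1
        refine Finset.prod_congr rfl fun j hj => ?_
        rw [Finsupp.single_eq_of_ne (Finset.ne_of_mem_erase hj), Nat.sub_zero]
      rw [hprod']
      ring
  conv_lhs => rw [f.as_sum]
  conv_rhs => rw [f.as_sum]
  simp only [map_sum, Finset.mul_sum]
  rw [← Finset.sum_add_distrib]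
  exact Finset.sum_congr rfl key

/-- The nonvanishing loci of two nonzero polynomial functions meet, so polynomial functions can be
cancelled. -/
theorem polyFun_eq_zero_of_mul [Infinite k] {E : Type*} [AddCommGroup E] [Module k E]
    {f g : E → k} (hf : f ∈ polyFun k E) (hg : g ∈ polyFun k E) {e : E} (he : f e ≠ 0)
    (h : ∀ e, f e * g e = 0) (e' : E) : g e' = 0 := by
  by_contra hne
  obtain ⟨x, hx, hx'⟩ := ((generically_of_polyFun (P := fun e => f e ≠ 0) hf he fun _ h => h).and
    (generically_of_polyFun (P := fun e => g e ≠ 0) hg hne fun _ h => h)).exists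
  exact mul_ne_zero hx hx' (h x)

/-- Two polynomials which are affine in every variable are proportional if their logarithmic
derivatives are equal. -/
theorem exists_smul_of_deriv_eq [Infinite k] [DecidableEq σ] {f g : MvPolynomial σ k}
    (hf : ∀ d ∈ f.support, ∀ i, d i ≤ 1) (hg : ∀ d ∈ g.support, ∀ i, d i ≤ 1) (hg0 : g ≠ 0)
    (h : ∀ x i, eval x f * eval x (pderiv i g) = eval x g * eval x (pderiv i f)) :
    ∃ c : k, f = c • g := by
  obtain ⟨x₀, hx₀⟩ : ∃ x, eval x g ≠ 0 := by
    by_contra! H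
    exact hg0 (MvPolynomial.funext (by simpa using H))
  -- Along a coordinate line both polynomials are affine, so equality of logarithmic derivatives
  -- integrates to proportionality. Without this restriction on degrees, `p`-th powers would be
  -- counterexamples in characteristic `p`.
  have step : ∀ x i t, eval (Function.update x i t) f * eval x g =
      eval x f * eval (Function.update x i t) g := by
    intro x i t
    have e1 := eval_update_of_support_le_one (fun d hd => hf d hd i) x (t - x i)
    have e2 := eval_update_of_support_le_one (fun d hd => hg d hd i) x (t - x i)
    rw [add_sub_cancel] at e1 e2
    rw [e1, e2]
    linear_combination (-(t - x i)) * h x i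
  -- The coordinates of `x` are replaced by those of `y` one at a time. Combining two steps produces
  -- the value of `g` at the intermediate point as a factor, cancelled as a nonzero polynomial
  -- function of the pair `(x, y)`.
  have main : ∀ S : Finset σ, ∀ x y : σ → k, eval (S.piecewise y x) f * eval x g =
      eval x f * eval (S.piecewise y x) g := by
    intro S
    induction S using Finset.induction_on with
    | empty => intro x y; simp
    | insert i S hi ih =>
      have hP : ∀ S : Finset σ, ∀ j, (fun e : (σ → k) × (σ → k) => S.piecewise e.2 e.1 j) ∈
          polyFun k ((σ → k) × (σ → k)) := by
        intro S j
        by_cases hj : j ∈ S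
        · simp only [Finset.piecewise_eq_of_mem _ _ _ hj]
          exact isLinearMap_mem_polyFun ⟨fun _ _ => rfl, fun _ _ => rfl⟩
        · simp only [Finset.piecewise_eq_of_notMem _ _ _ hj]
          exact isLinearMap_mem_polyFun ⟨fun _ _ => rfl, fun _ _ => rfl⟩
      have hQ : ∀ j, (fun e : (σ → k) × (σ → k) => e.1 j) ∈ polyFun k ((σ → k) × (σ → k)) :=
        fun j => isLinearMap_mem_polyFun ⟨fun _ _ => rfl, fun _ _ => rfl⟩
      intro x y
      have := polyFun_eq_zero_of_mul (k := k) (E := (σ → k) × (σ → k))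
        (f := fun e => eval (S.piecewise e.2 e.1) g)
        (g := fun e => eval ((insert i S).piecewise e.2 e.1) f * eval e.1 g -
          eval e.1 f * eval ((insert i S).piecewise e.2 e.1) g)
        (eval_mem_polyFun (hP S) g)
        (sub_mem_polyFun
          (mul_mem_polyFun (eval_mem_polyFun (hP _) f) (eval_mem_polyFun hQ g))
          (mul_mem_polyFun (eval_mem_polyFun hQ f) (eval_mem_polyFun (hP _) g)))
        (e := (x₀, x₀)) (by simpa [Finset.piecewise_same] using hx₀) ?_ (x, y)
      · exact sub_eq_zero.1 this
      · rintro ⟨x, y⟩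
        dsimp only
        rw [Finset.piecewise_insert]
        have h1 := step (S.piecewise y x) i (y i)
        have h2 := ih x y
        linear_combination eval x g * h1 + eval (Function.update (S.piecewise y x) i (y i)) g * h2
  refine ⟨eval x₀ f / eval x₀ g, MvPolynomial.funext fun y => ?_⟩
  have := main Finset.univ x₀ y
  rw [Finset.piecewise_univ] at this
  rw [smul_eval]
  field_simp
  exact this

end Derivative

end ProjSpace

namespace ProjSpace

/-! ### Dimension counts for families of linear conditions. -/

section DimensionCount

variable {k : Type*} [Field k] {P : Type*} [AddCommGroup P] [Module k P]

/-- Linear functionals which are independent on a subspace cut its dimension by their number. -/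
theorem finrank_inf_ker_add_card {J : Type*} [Fintype J] (M : Submodule k P) [Module.Finite k M]
    (L : J → P →ₗ[k] k) (hL : ∀ c : J → k, (∀ m ∈ M, ∑ j, c j * L j m = 0) → c = 0) :
    Module.finrank k ↥(M ⊓ ⨅ j, LinearMap.ker (L j)) + Fintype.card J = Module.finrank k M := by
  classical
  let φ : M →ₗ[k] (J → k) := LinearMap.pi fun j => L j ∘ₗ M.subtype
  have hφ : LinearMap.range φ = ⊤ := by
    by_contra hne
    obtain ⟨ψ, hψ0, hψ⟩ := Submodule.exists_le_ker_of_lt_top _ (lt_top_iff_ne_top.2 hne)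
    apply hψ0
    have hψe : ∀ w : J → k, ψ w = ∑ j, ψ (Pi.single j 1) * w j := by
      intro w
      conv_lhs => rw [pi_eq_sum_univ' w]
      simp [map_sum, mul_comm]
    have := hL (fun j => ψ (Pi.single j 1)) fun m hm => by
      have h0 : ψ (φ ⟨m, hm⟩) = 0 := hψ (LinearMap.mem_range_self φ _)
      rwa [hψe] at h0
    ext j
    simpa using congr_fun this j
  have hrank := φ.finrank_range_add_finrank_ker
  rw [hφ, finrank_top, Module.finrank_fintype_fun_eq_card] at hrank
  have hker : LinearMap.ker φ = (⨅ j, LinearMap.ker (L j)).comap M.subtype := by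
    ext m
    simp [φ, funext_iff]
  have : Module.finrank k ↥(M ⊓ ⨅ j, LinearMap.ker (L j)) = Module.finrank k (LinearMap.ker φ) := by
    rw [hker, ← Submodule.map_comap_subtype]
    exact (Submodule.equivMapOfInjective _ M.injective_subtype _).finrank_eq.symm
  omega

theorem finrank_le_inf_ker_add_card {J : Type*} [Fintype J] (M : Submodule k P)
    [Module.Finite k M] (L : J → P →ₗ[k] k) :
    Module.finrank k M ≤ Module.finrank k ↥(M ⊓ ⨅ j, LinearMap.ker (L j)) + Fintype.card J := by
  let φ : M →ₗ[k] (J → k) := LinearMap.pi fun j => L j ∘ₗ M.subtype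
  have hrank := φ.finrank_range_add_finrank_ker
  have hle := Submodule.finrank_le (LinearMap.range φ)
  rw [Module.finrank_fintype_fun_eq_card] at hle
  have hker : LinearMap.ker φ = (⨅ j, LinearMap.ker (L j)).comap M.subtype := by
    ext m
    simp [φ, funext_iff]
  have : Module.finrank k ↥(M ⊓ ⨅ j, LinearMap.ker (L j)) = Module.finrank k (LinearMap.ker φ) := by
    rw [hker, ← Submodule.map_comap_subtype]
    exact (Submodule.equivMapOfInjective _ M.injective_subtype _).finrank_eq.symm
  omega

/-- Separating points: if no nonzero element of a subspace of dimension at most `a` vanishes under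
all functionals of a family, then no nonzero element vanishes under some `a` of them. -/
theorem exists_separating {I : Type*} [Nonempty I] (L : I → P →ₗ[k] k) (a : ℕ) :
    ∀ (Z : Submodule k P) [Module.Finite k Z], Module.finrank k Z ≤ a →
    (∀ f ∈ Z, (∀ i, L i f = 0) → f = 0) →
    ∃ s : Fin a → I, ∀ f ∈ Z, (∀ j, L (s j) f = 0) → f = 0 := by
  induction a with
  | zero =>
    intro Z _ hZ _
    have : Z = ⊥ := Submodule.finrank_eq_zero.1 (by omega)
    exact ⟨Fin.elim0, fun f hf _ => by simpa [this] using hf⟩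
  | succ a ih =>
    intro Z _ hZ h
    obtain ⟨i, hi⟩ : ∃ i, Module.finrank k ↥(Z ⊓ LinearMap.ker (L i)) ≤ a := by
      by_cases hbot : Z = ⊥
      · subst hbot
        refine ⟨Classical.arbitrary I, ?_⟩
        rw [bot_inf_eq, finrank_bot]
        exact Nat.zero_le _
      obtain ⟨f, hf, hf0⟩ := Submodule.exists_mem_ne_zero_of_ne_bot hbot
      obtain ⟨i, hi⟩ : ∃ i, L i f ≠ 0 := by
        by_contra! H
        exact hf0 (h f hf H)
      refine ⟨i, ?_⟩
      have hlt : Z ⊓ LinearMap.ker (L i) < Z := by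
        refine lt_of_le_of_ne inf_le_left fun he => hi ?_
        rw [← he] at hf
        exact hf.2
      have := Submodule.finrank_lt_finrank_of_lt hlt
      omega
    have : Module.Finite k ↥(Z ⊓ LinearMap.ker (L i)) :=
      Submodule.finiteDimensional_of_le inf_le_left
    obtain ⟨s, hs⟩ := ih (Z ⊓ LinearMap.ker (L i)) hi fun f hf h' => h f hf.1 h'
    refine ⟨Fin.cons i s, fun f hf hj => hs f ⟨hf, ?_⟩ fun j => ?_⟩
    · simpa using hj 0
    · simpa using hj j.succ

end DimensionCount

/-! ### Jets at a point as linear functionals on polynomials. -/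

section Conditions

open MvPolynomial

variable {k : Type*} [Field k] {σ : Type*} [Fintype σ]

/-- The coordinates of the first order jet at `x`, with respect to the directions other than `i`. -/
noncomputable def jetForm [DecidableEq σ] (x : σ → k) (i j : σ) : MvPolynomial σ k →ₗ[k] k :=
  if j = i then (aeval x).toLinearMap else dirDeriv x (Pi.single j 1)

theorem jetForm_eq_zero [DecidableEq σ] {x : σ → k} {f : MvPolynomial σ k} (h : DoubleAt x f)
    (i j : σ) : jetForm x i j f = 0 := by
  unfold jetForm
  split_ifs
  · simpa [aeval_eq_eval] using h.1
  · exact h.2 _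

/-- Identifies the combinatorial expression `jetMon` with a combination of honest functionals on
cubics. -/
theorem sum_jetForm [DecidableEq σ] (x : σ → k) (i : σ) (w : σ → k) (a b c : σ) :
    ∑ j, w j * jetForm x i j (X a * X b * X c) = jetMon x i w a b c := by
  have h : ∀ j, w j * jetForm x i j (X a * X b * X c) =
      (if j = i then w i * (x a * x b * x c) else 0) +
      ((if j = a then (if a = i then 0 else w a) * (x b * x c) else 0) +
      ((if j = b then (if b = i then 0 else w b) * (x a * x c) else 0) +
      (if j = c then (if c = i then 0 else w c) * (x a * x b) else 0))) := by
    intro j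
    by_cases hj : j = i
    · subst hj
      simp [jetForm, aeval_eq_eval]
      grind
    · simp only [jetForm, hj, if_false, dirDeriv_mul, dirDeriv_X, map_mul, eval_X, Pi.single_apply]
      grind
  simp only [h, Finset.sum_add_distrib, Finset.sum_ite_eq', Finset.mem_univ, if_true, jetMon]
  ring

end Conditions

/-! ### Spaces of forms satisfying the conditions of a configuration. -/

section Forms

open MvPolynomial

variable {k : Type*} [Field k]

/-- The forms of degree `d` which vanish to order two at the points `p i`, vanish at the points of
the complex given by `x` and `κ`, and vanish on the tangent vectors `t i`. -/
noncomputable def formsThrough {n : ℕ} (d : ℕ) {ι : Type*} {l b : ℕ} (p : ι → Fin (n + 1) → k) (x : Fin l → Fin (n + 1) → k)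
    (κ : Module.Dual k (Fin (n + 1) → k)) (t : Fin b → (Fin (n + 1) → k) × (Fin (n + 1) → k)) : Submodule k (MvPolynomial (Fin (n + 1)) k) :=
  homogeneousSubmodule (Fin (n + 1)) k d ⊓ (⨅ i, doubleSubmodule (p i)) ⊓
    (⨅ i, ⨅ j, ⨅ (_ : i < j), vanishSubmodule (meet κ (x i) (x j))) ⊓
    ⨅ i, tangentSubmodule (t i).1 (t i).2

theorem mem_formsThrough {n d : ℕ} {ι : Type*} {l b : ℕ} {p : ι → Fin (n + 1) → k} {x : Fin l → Fin (n + 1) → k}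
    {κ : Module.Dual k (Fin (n + 1) → k)} {t : Fin b → (Fin (n + 1) → k) × (Fin (n + 1) → k)} {f : MvPolynomial (Fin (n + 1)) k} :
    f ∈ formsThrough d p x κ t ↔ f.IsHomogeneous d ∧ (∀ i, DoubleAt (p i) f) ∧
      (∀ i j, i < j → eval (meet κ (x i) (x j)) f = 0) ∧
      ∀ i, eval (t i).1 f = 0 ∧ dirDeriv (t i).1 (t i).2 f = 0 := by
  simp only [formsThrough, Submodule.mem_inf, mem_homogeneousSubmodule, Submodule.mem_iInf,
    mem_doubleSubmodule, mem_vanishSubmodule, mem_tangentSubmodule, and_assoc]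

theorem formsThrough_le {n d : ℕ} {ι : Type*} {l b : ℕ} (p : ι → Fin (n + 1) → k) (x : Fin l → Fin (n + 1) → k)
    (κ : Module.Dual k (Fin (n + 1) → k)) (t : Fin b → (Fin (n + 1) → k) × (Fin (n + 1) → k)) :
    formsThrough d p x κ t ≤ homogeneousSubmodule (Fin (n + 1)) k d :=
  fun _ hf => (mem_formsThrough.1 hf).1

instance {n d : ℕ} {ι : Type*} {l b : ℕ} (p : ι → Fin (n + 1) → k) (x : Fin l → Fin (n + 1) → k)
    (κ : Module.Dual k (Fin (n + 1) → k)) (t : Fin b → (Fin (n + 1) → k) × (Fin (n + 1) → k)) :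
    Module.Finite k (formsThrough d p x κ t) :=
  Submodule.finiteDimensional_of_le (formsThrough_le p x κ t)

end Forms

end ProjSpace

namespace ProjSpace

/-! ### Configurations in special position with few cubics. -/

section Existence

open MvPolynomial

variable {k : Type*} [Field k] {n : ℕ}

theorem sum_lt_pairs {l : ℕ} {M : Type*} [AddCommMonoid M]
    (F : {e : Fin l × Fin l // e.1 < e.2} → M) :
    ∑ e, F e = ∑ i, ∑ j, if h : i < j then F ⟨(i, j), h⟩ else 0 := by
  rw [← Fintype.sum_prod_type' (f := fun i j => if h : i < j then F ⟨(i, j), h⟩ else 0)]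
  refine Fintype.sum_of_injective Subtype.val Subtype.val_injective _ _ (fun e he => ?_) fun e => ?_
  · rw [dif_neg]
    exact fun h => he ⟨⟨e, h⟩, rfl⟩
  · rw [dif_pos e.2]

theorem exists_double_complex [Infinite k] (n r l : ℕ)
    (hr : r ≤ 3 * (n / 3).choose 2 + n / 3 * (n % 3)) (hl : l ≤ 2 * (n / 3) + n % 3) :
    ∃ (p : Fin r → Fin (n + 1) → k) (x : Fin l → Fin (n + 1) → k)
      (κ : Module.Dual k (Fin (n + 1) → k)),
      Module.finrank k (formsThrough 3 (Sum.elim (fun j => Pi.single j 1) p) x κ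
        (b := 0) Fin.elim0) + ((n + 1) * (n + 1 + r) + l.choose 2) ≤ (n + 3).choose 3 := by
  classical
  obtain ⟨p, piv, x, κ, h⟩ := exists_independent (k := k) n r l hr hl
  refine ⟨p, x, κ, ?_⟩
  set q : Fin (n + 1) ⊕ Fin r → Fin (n + 1) → k := Sum.elim (fun j => Pi.single j 1) p
  set pv : Fin (n + 1) ⊕ Fin r → Fin (n + 1) := Sum.elim id piv
  let L : ((Fin (n + 1) ⊕ Fin r) × Fin (n + 1)) ⊕ {e : Fin l × Fin l // e.1 < e.2} →
      MvPolynomial (Fin (n + 1)) k →ₗ[k] k :=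
    Sum.elim (fun s => jetForm (q s.1) (pv s.1) s.2)
      fun e => (aeval (meet κ (x e.1.1) (x e.1.2))).toLinearMap
  have hcount := finrank_inf_ker_add_card (homogeneousSubmodule (Fin (n + 1)) k 3) L ?_
  · rw [finrank_homogeneousSubmodule, Fintype.card_sum, Fintype.card_prod, Fintype.card_sum,
      card_lt_pairs] at hcount
    simp only [Fintype.card_fin] at hcount
    rw [show n + 1 + 3 - 1 = n + 3 by omega] at hcount
    rw [← hcount, mul_comm (n + 1) (n + 1 + r)]
    refine Nat.add_le_add_right (Submodule.finrank_mono ?_) _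
    intro f hf
    obtain ⟨hhom, hd, hm, -⟩ := mem_formsThrough.1 hf
    refine ⟨hhom, (Submodule.mem_iInf _).2 ?_⟩
    rintro (⟨s, j⟩ | ⟨⟨i, j⟩, hij⟩)
    · exact jetForm_eq_zero (hd s) _ _
    · simpa [L, aeval_eq_eval] using hm i j hij
  · intro c hc
    -- A linear relation between the conditions on cubics, evaluated on monomials, is the kind of
    -- relation excluded by `exists_independent`.
    have hrel : ∀ a b d, ∑ π, jetMon (q π) (pv π) (fun j => c (.inl (π, j))) a b d +
        complexMon (fun i j => meet κ (x i) (x j))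
          (fun i j => if hij : i < j then c (.inr ⟨(i, j), hij⟩) else 0) a b d = 0 := by
      intro a b d
      refine Eq.trans ?_ (hc (X a * X b * X d) (((isHomogeneous_X k a).mul
        (isHomogeneous_X k b)).mul (isHomogeneous_X k d)))
      rw [Fintype.sum_sum_type (fun j => c j * _), Fintype.sum_prod_type]
      congr 1
      · refine Finset.sum_congr rfl fun π _ => ?_
        rw [← sum_jetForm]
        rfl
      · rw [complexMon, sum_lt_pairs]
        refine Finset.sum_congr rfl fun i _ => Finset.sum_congr rfl fun j _ => ?_
        split_ifs with hij
        · simp [L, aeval_eq_eval]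
        · rfl
    obtain ⟨hW, hμ⟩ := h _ _ hrel
    ext (⟨π, j⟩ | ⟨⟨i, j⟩, hij⟩)
    · exact congr_fun (congr_fun hW π) j
    · have := hμ i j hij
      rwa [dif_pos hij] at this

/-- The degree in every variable of the forms considered is at most one. -/
theorem exists_tangent [Infinite k] (Z : Submodule k (MvPolynomial (Fin (n + 1)) k))
    [Module.Finite k Z] (hZ : ∀ f ∈ Z, ∀ d ∈ f.support, ∀ i, d i ≤ 1) {c : ℕ}
    (h : Module.finrank k Z ≤ c + 2) :
    ∃ t : (Fin (n + 1) → k) × (Fin (n + 1) → k),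
      Module.finrank k ↥(Z ⊓ tangentSubmodule t.1 t.2) ≤ c := by
  classical
  by_cases hbot : Z = ⊥
  · subst hbot
    exact ⟨0, by rw [bot_inf_eq, finrank_bot]; exact Nat.zero_le _⟩
  obtain ⟨g, hg, hg0⟩ := Submodule.exists_mem_ne_zero_of_ne_bot hbot
  by_cases hf : ∃ f ∈ Z, ∀ c : k, f ≠ c • g
  · obtain ⟨f, hf, hfg⟩ := hf
    -- If the value and every partial derivative were dependent on the span of `f` and `g` at all
    -- points, the logarithmic derivatives would agree and `f` would be a multiple of `g`.
    obtain ⟨x, i, hx⟩ : ∃ x i, eval x f * eval x (pderiv i g) ≠ eval x g * eval x (pderiv i f) := by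
      by_contra! H
      obtain ⟨c, hc⟩ := exists_smul_of_deriv_eq (hZ f hf) (hZ g hg) hg0 H
      exact hfg c hc
    refine ⟨(x, Pi.single i 1), ?_⟩
    let L : Fin 2 → MvPolynomial (Fin (n + 1)) k →ₗ[k] k :=
      ![(aeval x).toLinearMap, dirDeriv x (Pi.single i 1)]
    have := finrank_inf_ker_add_card Z L fun c hc => by
        have h1 := hc f hf
        have h2 := hc g hg
        simp only [L, Fin.sum_univ_two, Matrix.cons_val_zero, Matrix.cons_val_one,
          AlgHom.toLinearMap_apply, aeval_eq_eval, dirDeriv_single] at h1 h2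
        have hx' := sub_ne_zero.2 hx
        have e0 : c 0 * (eval x f * eval x (pderiv i g) - eval x g * eval x (pderiv i f)) = 0 := by
          linear_combination eval x (pderiv i g) * h1 - eval x (pderiv i f) * h2
        have e1 : c 1 * (eval x f * eval x (pderiv i g) - eval x g * eval x (pderiv i f)) = 0 := by
          linear_combination eval x f * h2 - eval x g * h1
        ext j
        fin_cases j
        · exact (mul_eq_zero.1 e0).resolve_right hx'
        · exact (mul_eq_zero.1 e1).resolve_right hx'
    rw [Fintype.card_fin] at this
    have he : Z ⊓ tangentSubmodule x (Pi.single i 1) = Z ⊓ ⨅ j, LinearMap.ker (L j) := by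
      ext f
      simp [L, mem_tangentSubmodule, Fin.forall_fin_two, aeval_eq_eval]
    dsimp only
    rw [he]
    omega
  · push Not at hf
    obtain ⟨x, hx⟩ : ∃ x, eval x g ≠ 0 := by
      by_contra! H
      exact hg0 (MvPolynomial.funext (by simpa using H))
    have hle : Z ≤ Submodule.span k {g} := fun f hfZ => by
      obtain ⟨c, hc⟩ := hf f hfZ
      exact Submodule.mem_span_singleton.2 ⟨c, hc.symm⟩
    -- In dimension one a point off the zero locus of `g` is enough; the direction plays no role.
    refine ⟨(x, 0), ?_⟩
    have : Z ⊓ tangentSubmodule x 0 = ⊥ := by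
      rw [eq_bot_iff]
      intro f hf'
      obtain ⟨c, rfl⟩ := hf f hf'.1
      have := (mem_tangentSubmodule.1 hf'.2).1
      rw [smul_eval] at this
      simp [(mul_eq_zero.1 this).resolve_right hx]
    rw [this, finrank_bot]
    exact Nat.zero_le _

theorem exists_tangents [Infinite k] (b : ℕ) {c : ℕ} :
    ∀ (Z : Submodule k (MvPolynomial (Fin (n + 1)) k)) [Module.Finite k Z],
      (∀ f ∈ Z, ∀ d ∈ f.support, ∀ i, d i ≤ 1) → Module.finrank k Z ≤ c + 2 * b →
    ∃ t : Fin b → (Fin (n + 1) → k) × (Fin (n + 1) → k),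
      Module.finrank k ↥(Z ⊓ ⨅ i, tangentSubmodule (t i).1 (t i).2) ≤ c := by
  induction b with
  | zero =>
    intro Z _ _ h
    exact ⟨Fin.elim0, (Submodule.finrank_mono inf_le_left).trans h⟩
  | succ b ih =>
    intro Z _ hZ h
    obtain ⟨t₀, h₀⟩ := exists_tangent Z hZ (c := c + 2 * b) (by omega)
    have : Module.Finite k ↥(Z ⊓ tangentSubmodule t₀.1 t₀.2) :=
      Submodule.finiteDimensional_of_le inf_le_left
    obtain ⟨t, ht⟩ := ih (Z ⊓ tangentSubmodule t₀.1 t₀.2) (fun f hf => hZ f hf.1) h₀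
    have : Module.Finite k ↥(Z ⊓ tangentSubmodule t₀.1 t₀.2 ⊓
        ⨅ i, tangentSubmodule (t i).1 (t i).2) :=
      Submodule.finiteDimensional_of_le (inf_le_left.trans inf_le_left)
    refine ⟨Fin.cons t₀ t, (Submodule.finrank_mono ?_).trans ht⟩
    rintro f ⟨hf, hf'⟩
    have hf' := (Submodule.mem_iInf _).1 hf'
    refine ⟨⟨hf, by simpa using hf' 0⟩, (Submodule.mem_iInf _).2 fun i => ?_⟩
    simpa using hf' i.succ

theorem exists_double_complex_tangents [Infinite k] {r l b c : ℕ}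
    (hr : r ≤ 3 * (n / 3).choose 2 + n / 3 * (n % 3)) (hl : l ≤ 2 * (n / 3) + n % 3)
    (hc : (n + 3).choose 3 ≤ (n + 1) * (n + 1 + r) + l.choose 2 + c + 2 * b) :
    ∃ (p : Fin r → Fin (n + 1) → k) (x : Fin l → Fin (n + 1) → k)
      (κ : Module.Dual k (Fin (n + 1) → k)) (t : Fin b → (Fin (n + 1) → k) × (Fin (n + 1) → k)),
      Module.finrank k (formsThrough 3 (Sum.elim (fun j => Pi.single j 1) p) x κ t) ≤ c := by
  obtain ⟨p, x, κ, h⟩ := exists_double_complex (k := k) n r l hr hl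
  obtain ⟨t, ht⟩ := exists_tangents b (c := c)
    (formsThrough 3 (Sum.elim (fun j => Pi.single j 1) p) x κ (b := 0) Fin.elim0)
    (fun f hf d hd i => by
      obtain ⟨hhom, hdb, -⟩ := mem_formsThrough.1 hf
      exact support_le_one hhom (hdb (.inl i)) hd) (by omega)
  have he : formsThrough 3 (Sum.elim (fun j => Pi.single j 1) p) x κ t =
      formsThrough 3 (Sum.elim (fun j => Pi.single j 1) p) x κ (b := 0) Fin.elim0 ⊓
        ⨅ i, tangentSubmodule (t i).1 (t i).2 := by
    ext f
    rw [Submodule.mem_inf, mem_formsThrough, mem_formsThrough]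
    simp [mem_tangentSubmodule, and_assoc]
  exact ⟨p, x, κ, t, he ▸ ht⟩

/-- Each jet coordinate not already zero on `M` costs at most one dimension. The derivative along
the point itself comes for free from the value, by Euler's relation. -/
theorem finrank_double_le {d : ℕ} (M : Submodule k (MvPolynomial (Fin (n + 1)) k))
    [Module.Finite k M] (hM : M ≤ homogeneousSubmodule (Fin (n + 1)) k d) (i : Fin (n + 1))
    (S : Finset (Fin (n + 1))) (hS : ∀ f ∈ M, ∀ j ∉ S, jetForm (Pi.single i 1) i j f = 0) :
    Module.finrank k M ≤ Module.finrank k ↥(M ⊓ doubleSubmodule (Pi.single i 1)) + S.card := by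
  have h := finrank_le_inf_ker_add_card M fun j : S => jetForm (Pi.single i 1) i j.1
  rw [Fintype.card_coe] at h
  refine h.trans (Nat.add_le_add_right (Submodule.finrank_mono ?_) _)
  rintro f ⟨hf, hf'⟩
  refine ⟨hf, ?_⟩
  have hj : ∀ j, jetForm (Pi.single i 1) i j f = 0 := by
    intro j
    by_cases hjS : j ∈ S
    · exact (Submodule.mem_iInf _).1 hf' ⟨j, hjS⟩
    · exact hS f hf j hjS
  have h0 : eval (Pi.single i 1) f = 0 := by
    simpa [jetForm, aeval_eq_eval] using hj i
  refine ⟨h0, fun w => ?_⟩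
  have : w = ∑ j, w j • (Pi.single j 1 : Fin (n + 1) → k) := by
    ext j
    simp [Pi.single_apply]
  rw [dirDeriv_apply]
  refine Finset.sum_eq_zero fun j _ => ?_
  by_cases hji : j = i
  · subst hji
    have := dirDeriv_self (hM hf) (Pi.single j 1)
    rw [h0, dirDeriv_single] at this
    rw [this]
    simp
  · have := hj j
    rw [jetForm, if_neg hji, dirDeriv_single] at this
    rw [this, mul_zero]

/-- Double points in special position impose independent conditions, up to a defect which can be
filled by simple points. -/
theorem exists_special_position [Infinite k] {r l a b : ℕ} (hl : l ≤ 2 * (n / 3) + n % 3)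
    (hr : (n + 1 ≤ r ∧ r ≤ n + 1 + (3 * (n / 3).choose 2 + n / 3 * (n % 3))) ∨
      (r = n ∧ 1 ≤ b ∧ n ≤ a + 1 ∧ 1 ≤ n) ∨ (r = n ∧ b = 0 ∧ n + 1 ≤ a))
    (hc : (n + 1) * r + l.choose 2 + a + 2 * b = (n + 3).choose 3) :
    ∃ (p : Fin r → Fin (n + 1) → k) (x : Fin l → Fin (n + 1) → k)
      (κ : Module.Dual k (Fin (n + 1) → k)) (t : Fin b → (Fin (n + 1) → k) × (Fin (n + 1) → k)),
      Module.finrank k (formsThrough 3 p x κ t) ≤ a := by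
  classical
  rcases hr with ⟨h1, h2⟩ | ⟨rfl, hb, ha, hr⟩ | ⟨rfl, rfl, ha⟩
  · obtain ⟨r, rfl⟩ := Nat.exists_eq_add_of_le h1
    obtain ⟨p, x, κ, t, h⟩ := exists_double_complex_tangents (k := k) (n := n) (r := r) (l := l)
      (b := b) (c := a) (by omega) hl hc.ge
    refine ⟨fun i => Sum.elim (fun j => Pi.single j 1) p (finSumFinEquiv.symm i), x, κ, t,
      h.trans' (Submodule.finrank_mono fun f hf => ?_)⟩
    rw [mem_formsThrough] at hf ⊢
    exact ⟨hf.1, fun i => by simpa using hf.2.1 (finSumFinEquiv i), hf.2.2⟩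
  -- The last coordinate point is promoted to a double point. One degree two scheme, supported there
  -- and pointing to the first coordinate point, supplies two of its conditions; the other `r - 1`
  -- are charged to the simple points, whence the bound `a - (r - 1)`.
  · obtain ⟨b, rfl⟩ := Nat.exists_eq_add_of_le' hb
    obtain ⟨p, x, κ, t, h⟩ := exists_double_complex_tangents (k := k) (n := r) (r := 0) (l := l)
      (b := b) (c := a - (r - 1)) (by omega) hl (by
        have : (r + 1) * (r + 1 + 0) = (r + 1) * r + (r + 1) := by ring
        omega)
    refine ⟨fun i => Pi.single i.castSucc 1, x, κ,
      Fin.cons (Pi.single (Fin.last r) 1, Pi.single 0 1) t, ?_⟩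
    have hM := finrank_double_le (formsThrough (k := k) 3 (fun i : Fin r => Pi.single i.castSucc 1) x κ
      (Fin.cons (Pi.single (Fin.last r) 1, Pi.single 0 1) t)) (formsThrough_le _ _ _ _) (Fin.last r)
      ((Finset.univ.erase (Fin.last r)).erase 0) (by
        intro f hf j hj
        have h0 : (Fin.last r) ≠ 0 := by
          rw [Ne, Fin.ext_iff]
          simp
          omega
        have hj' : j = Fin.last r ∨ j = 0 := by
          by_contra! H
          exact hj (by simp [H.1, H.2])
        have := (mem_formsThrough.1 hf).2.2.2 0
        rcases hj' with rfl | rfl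
        · simpa [jetForm, aeval_eq_eval] using this.1
        · rw [jetForm, if_neg h0.symm]
          simpa using this.2)
    rw [Finset.card_erase_of_mem, Finset.card_erase_of_mem (Finset.mem_univ _), Finset.card_univ,
      Fintype.card_fin] at hM
    · refine hM.trans ?_
      have : Module.finrank k ↥(formsThrough (k := k) 3 (fun i : Fin r => Pi.single i.castSucc 1) x κ
          (Fin.cons (Pi.single (Fin.last r) 1, Pi.single 0 1) t) ⊓
            doubleSubmodule (Pi.single (Fin.last r) 1)) ≤ a - (r - 1) := by
        refine (Submodule.finrank_mono ?_).trans h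
        rintro f ⟨hf, hf'⟩
        rw [SetLike.mem_coe, mem_formsThrough] at hf
        refine mem_formsThrough.2 ⟨hf.1, ?_, hf.2.2.1, fun i => by simpa using hf.2.2.2 i.succ⟩
        rintro (j | j)
        · induction j using Fin.lastCases with
          | last => exact hf'
          | cast j => exact hf.2.1 j
        · exact j.elim0
      omega
    · refine Finset.mem_erase.2 ⟨?_, Finset.mem_univ _⟩
      rw [Ne, Fin.ext_iff]
      simp
      omega
  -- No degree two scheme is available, so all `r + 1` conditions at the last coordinate point are
  -- charged to the simple points.
  · obtain ⟨p, x, κ, t, h⟩ := exists_double_complex_tangents (k := k) (n := r) (r := 0) (l := l)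
      (b := 0) (c := a - (r + 1)) (by omega) hl (by
        have : (r + 1) * (r + 1 + 0) = (r + 1) * r + (r + 1) := by ring
        omega)
    refine ⟨fun i => Pi.single i.castSucc 1, x, κ, t, ?_⟩
    have hM := finrank_double_le (formsThrough (k := k) 3 (fun i : Fin r => Pi.single i.castSucc 1) x κ
      t) (formsThrough_le _ _ _ _) (Fin.last r) Finset.univ (by simp)
    rw [Finset.card_univ, Fintype.card_fin] at hM
    refine hM.trans ?_
    have : Module.finrank k ↥(formsThrough (k := k) 3 (fun i : Fin r => Pi.single i.castSucc 1) x κ t ⊓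
        doubleSubmodule (Pi.single (Fin.last r) 1)) ≤ a - (r + 1) := by
      refine (Submodule.finrank_mono ?_).trans h
      rintro f ⟨hf, hf'⟩
      rw [SetLike.mem_coe, mem_formsThrough] at hf
      refine mem_formsThrough.2 ⟨hf.1, ?_, hf.2.2⟩
      rintro (j | j)
      · induction j using Fin.lastCases with
        | last => exact hf'
        | cast j => exact hf.2.1 j
      · exact j.elim0
    omega

end Existence

end ProjSpace

namespace ProjSpace

/-! ### Linear changes of coordinates. -/

section Pullback

open MvPolynomial

variable {k : Type*} [Field k] {σ : Type*} [Fintype σ]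

theorem eval_smul_of_isHomogeneous {f : MvPolynomial σ k} {d : ℕ} (hf : f.IsHomogeneous d)
    (c : k) (x : σ → k) : eval (c • x) f = c ^ d * eval x f := by
  rw [eval_eq', eval_eq', Finset.mul_sum]
  refine Finset.sum_congr rfl fun e he => ?_
  have hdeg : d = ∑ i, e i := by
    rw [← Finsupp.degree_eq_sum]
    exact hf.degree_eq_sum_deg_support he
  simp only [Pi.smul_apply, smul_eq_mul, mul_pow, Finset.prod_mul_distrib,
    Finset.prod_pow_eq_pow_sum, hdeg]
  ring

/-- The polynomial `f ∘ g`, for a linear map `g`. -/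
noncomputable def pullback [DecidableEq σ] (g : (σ → k) →ₗ[k] (σ → k)) :
    MvPolynomial σ k →ₐ[k] MvPolynomial σ k :=
  aeval fun i => ∑ j, C (g (Pi.single j 1) i) * X j

variable [DecidableEq σ] (g : (σ → k) →ₗ[k] (σ → k))

theorem sum_single_apply (x : σ → k) (i : σ) : ∑ j, g (Pi.single j 1) i * x j = g x i := by
  conv_rhs => rw [pi_eq_sum_univ' x, map_sum, Finset.sum_apply]
  exact Finset.sum_congr rfl fun j _ => by rw [map_smul, Pi.smul_apply, smul_eq_mul, mul_comm]

theorem eval_pullback (f : MvPolynomial σ k) (x : σ → k) :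
    eval x (pullback g f) = eval (g x) f := by
  induction f using MvPolynomial.induction_on with
  | C a => simp [pullback]
  | add p q hp hq => simp [hp, hq]
  | mul_X p i hp =>
    rw [map_mul, map_mul, hp, map_mul, eval_X]
    congr 1
    simp [pullback, sum_single_apply]

theorem dirDeriv_pullback (f : MvPolynomial σ k) (x w : σ → k) :
    dirDeriv x w (pullback g f) = dirDeriv (g x) (g w) f := by
  induction f using MvPolynomial.induction_on with
  | C a => simp [pullback, dirDeriv_C]
  | add p q hp hq => simp [hp, hq]
  | mul_X p i hp =>
    rw [map_mul, dirDeriv_mul, dirDeriv_mul, hp, eval_pullback, eval_pullback, dirDeriv_X]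
    congr 2
    simp [pullback, dirDeriv_mul, dirDeriv_C, dirDeriv_X, sum_single_apply]

theorem isHomogeneous_pullback {f : MvPolynomial σ k} {d : ℕ} (hf : f.IsHomogeneous d) :
    (pullback g f).IsHomogeneous d := by
  have := hf.aeval (n := 1) (fun i => ∑ j, C (g (Pi.single j 1) i) * X j) fun i =>
    IsHomogeneous.sum _ _ _ fun j _ => isHomogeneous_C_mul_X _ _
  simpa only [one_mul, pullback] using this

theorem pullback_injective [Infinite k] {g : (σ → k) →ₗ[k] (σ → k)}
    (hg : Function.Surjective g) {f : MvPolynomial σ k} (h : pullback g f = 0) : f = 0 := by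
  refine MvPolynomial.funext fun y => ?_
  obtain ⟨x, rfl⟩ := hg y
  rw [← eval_pullback, h, map_zero, map_zero]

end Pullback

/-! ### Forms vanishing on a hyperplane, and singular quadrics. -/

section Linear

open MvPolynomial

variable {k : Type*} [Field k] {σ : Type*} [Fintype σ]

/-- A form which vanishes on a hyperplane is divisible by its equation. -/
theorem exists_eq_mul_of_vanish [Infinite k] {f : MvPolynomial σ k} {d : ℕ}
    (hf : f.IsHomogeneous (d + 1)) {c : σ → k} (hc : c ≠ 0)
    (h : ∀ x, ∑ i, c i * x i = 0 → eval x f = 0) :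
    ∃ q : MvPolynomial σ k, q.IsHomogeneous d ∧ f = (∑ i, C (c i) * X i) * q := by
  classical
  obtain ⟨i, hi⟩ := Function.ne_iff.1 hc
  simp only [Pi.zero_apply] at hi
  set F : MvPolynomial σ k := ∑ i, C (c i) * X i with hF
  -- This substitution projects onto the hyperplane: it sends `F` to zero and is the identity modulo
  -- `F`.
  let s : σ → MvPolynomial σ k := fun j => X j - C (if j = i then (c i)⁻¹ else 0) * F
  have hs : aeval s f = 0 := by
    refine MvPolynomial.funext fun x => ?_
    have e1 : eval x (aeval s f) = eval (fun j => eval x (s j)) f := by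
      rw [← aeval_eq_eval, ← aeval_eq_eval]
      exact comp_aeval_apply s (aeval x) f
    rw [e1, map_zero]
    refine h _ ?_
    simp only [s, map_sub, map_mul, eval_X, eval_C, mul_sub, Finset.sum_sub_distrib]
    simp [hF]
    field_simp
    ring
  have hmod : F ∣ f - aeval s f := by
    rw [← Ideal.mem_span_singleton, ← Ideal.Quotient.eq]
    have : (Ideal.Quotient.mkₐ k (Ideal.span {F})).comp (aeval s) =
        Ideal.Quotient.mkₐ k (Ideal.span {F}) := by
      ext j
      simp only [AlgHom.comp_apply, aeval_X, Ideal.Quotient.mkₐ_eq_mk, s]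
      rw [Ideal.Quotient.eq, Ideal.mem_span_singleton, sub_sub_cancel_left]
      exact (Dvd.intro_left _ rfl).neg_right
    exact (DFunLike.congr_fun this f).symm
  rw [hs, sub_zero] at hmod
  obtain ⟨q, hq⟩ := hmod
  refine ⟨homogeneousComponent d q, homogeneousComponent_isHomogeneous _ _, ?_⟩
  have hFh : F.IsHomogeneous 1 := IsHomogeneous.sum _ _ _ fun j _ => isHomogeneous_C_mul_X _ _
  have h1 : homogeneousComponent (d + 1) f = f := homogeneousComponent_eq_self hf
  have h2 : ∀ q, homogeneousComponent (d + 1) (F * q) = F * homogeneousComponent d q := by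
    intro q
    conv_lhs => rw [← sum_homogeneousComponent q, Finset.mul_sum, map_sum]
    have : ∀ e, homogeneousComponent (d + 1) (F * homogeneousComponent e q) =
        if e = d then F * homogeneousComponent d q else 0 := by
      intro e
      rw [homogeneousComponent_of_mem (hFh.mul (homogeneousComponent_isHomogeneous e q))]
      by_cases hed : e = d
      · subst hed; simp [add_comm]
      · rw [if_neg (by omega), if_neg hed]
    simp only [this, Finset.sum_ite_eq', Finset.mem_range]
    split_ifs with hlt
    · rfl
    · rw [homogeneousComponent_eq_zero _ _ (by omega), mul_zero]
  rw [← h1, ← h2, ← hq]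

/-- By linearity it is enough to treat products of two linear forms. Written with `Q` itself instead
of second derivatives, the expansion is valid in characteristic two. -/
theorem eval_add_of_isHomogeneous_two [DecidableEq σ] {Q : MvPolynomial σ k}
    (hQ : Q.IsHomogeneous 2) (x z : σ → k) :
    eval (x + z) Q = eval x Q + dirDeriv x z Q + eval z Q := by
  have hlin : ∀ m ∈ homogeneousSubmodule σ k 1, eval (x + z) m = eval x m + eval z m ∧
      dirDeriv x z m = eval z m := by
    intro m hm
    rw [homogeneousSubmodule_one_eq_span_X] at hm
    induction hm using Submodule.span_induction with
    | mem m hm =>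
      obtain ⟨i, rfl⟩ := hm
      simp [dirDeriv_X]
    | zero => simp
    | add a b _ _ ha hb =>
      refine ⟨?_, by simp [ha.2, hb.2]⟩
      rw [map_add, map_add, map_add, ha.1, hb.1]
      ring
    | smul c a _ ha =>
      refine ⟨?_, by simp [ha.2]⟩
      rw [smul_eval, smul_eval, smul_eval, ha.1]
      ring
  have hQ' : Q ∈ homogeneousSubmodule σ k 1 * homogeneousSubmodule σ k 1 := by
    rw [← pow_two, homogeneousSubmodule_one_pow]
    exact hQ
  induction hQ' using Submodule.mul_induction_on' with
  | mem_mul_mem m hm m' hm' =>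
    rw [dirDeriv_mul, map_mul, map_mul, map_mul, (hlin m hm).1, (hlin m' hm').1, (hlin m hm).2,
      (hlin m' hm').2]
    ring
  | add a ha b hb iha ihb =>
    have hm : ∀ a ∈ homogeneousSubmodule σ k 1 * homogeneousSubmodule σ k 1,
      a.IsHomogeneous 2 := fun a ha => by
        rw [← pow_two, homogeneousSubmodule_one_pow] at ha
        exact ha
    rw [map_add, map_add, map_add, map_add, iha (hm a ha), ihb (hm b hb)]
    ring

/-- A quadric which is singular along a subspace of codimension at most two and passes through
three further points of a complement vanishes. -/
theorem quadric_eq_zero [Infinite k] [DecidableEq σ] {Q : MvPolynomial σ k}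
    (hQ : Q.IsHomogeneous 2) {ι : Type*} {p : ι → σ → k} {y y' : σ → k}
    (hspan : Submodule.span k (Set.range p) ⊔ Submodule.span k {y, y'} = ⊤)
    (hp : ∀ i, DoubleAt (p i) Q) (hy : eval y Q = 0) (hy' : eval y' Q = 0)
    (hyy : eval (y + y') Q = 0) : Q = 0 := by
  have hsymm : ∀ x z, dirDeriv x z Q = dirDeriv z x Q := by
    intro x z
    have h1 := eval_add_of_isHomogeneous_two hQ x z
    rw [add_comm x z, eval_add_of_isHomogeneous_two hQ z x] at h1
    linear_combination -h1
  -- The quadric is a cone whose vertex contains the span of its singular points, so translations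
  -- along this span preserve it.
  have hsing : ∀ s ∈ Submodule.span k (Set.range p), ∀ z, eval (s + z) Q = eval z Q := by
    intro s hs
    induction hs using Submodule.span_induction with
    | mem s hs =>
      obtain ⟨i, rfl⟩ := hs
      intro z
      rw [eval_add_of_isHomogeneous_two hQ, (hp i).1, (hp i).2]
      ring
    | zero => simp
    | add a b _ _ ha hb => intro z; rw [add_assoc, ha, hb]
    | smul c a _ ha =>
      intro z
      have h0 : eval a Q = 0 := by
        have := ha 0
        rw [add_zero] at this
        rw [this, ← zero_smul k (0 : σ → k), eval_smul_of_isHomogeneous hQ]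
        simp
      have h1 : dirDeriv a z Q = 0 := by
        have := ha z
        rw [eval_add_of_isHomogeneous_two hQ, h0] at this
        linear_combination this
      rw [eval_add_of_isHomogeneous_two hQ, eval_smul_of_isHomogeneous hQ, h0, hsymm,
        dirDeriv_smul_right, hsymm, h1]
      ring
  refine MvPolynomial.funext fun z => ?_
  obtain ⟨s, hs, t, ht, rfl⟩ := Submodule.mem_sup.1 (hspan ▸ Submodule.mem_top : z ∈ _)
  obtain ⟨c, c', rfl⟩ := Submodule.mem_span_pair.1 ht
  -- The third point kills the mixed term of the binary quadratic form left on the span of `y` and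
  -- `y'`.
  have hB : dirDeriv y y' Q = 0 := by
    rw [eval_add_of_isHomogeneous_two hQ, hy, hy'] at hyy
    linear_combination hyy
  rw [hsing s hs, eval_add_of_isHomogeneous_two hQ, eval_smul_of_isHomogeneous hQ,
    eval_smul_of_isHomogeneous hQ, dirDeriv_smul_right, hsymm, dirDeriv_smul_right, hsymm, hB, hy,
    hy', map_zero]
  ring

end Linear

/-! ### Openness of the absence of forms. -/

section OpenCondition

open MvPolynomial

variable {k : Type*} [Field k] {σ : Type*} [Fintype σ]

/-- The only form of degree `d` with double points at `p i`, vanishing at the points `y i` and on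
the tangent vectors `t i`, is zero. -/
def NoForm (d : ℕ) {ι s τ : Type*} (p : ι → σ → k) (y : s → σ → k)
    (t : τ → (σ → k) × (σ → k)) : Prop :=
  ∀ f : MvPolynomial σ k, f.IsHomogeneous d → (∀ i, DoubleAt (p i) f) → (∀ i, eval (y i) f = 0) →
    (∀ i, eval (t i).1 f = 0 ∧ dirDeriv (t i).1 (t i).2 f = 0) → f = 0

theorem NoForm.map [Infinite k] {d : ℕ} {ι s τ : Type*} {p : ι → σ → k} {y : s → σ → k}
    {t : τ → (σ → k) × (σ → k)} (h : NoForm d p y t) {g : (σ → k) →ₗ[k] (σ → k)}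
    (hg : Function.Surjective g) :
    NoForm d (fun i => g (p i)) (fun i => g (y i)) fun i => (g (t i).1, g (t i).2) := by
  classical
  intro f hf hp hy ht
  refine pullback_injective hg (h _ (isHomogeneous_pullback g hf) (fun i => ⟨?_, fun w => ?_⟩)
    (fun i => ?_) fun i => ⟨?_, ?_⟩)
  · rw [eval_pullback]; exact (hp i).1
  · rw [dirDeriv_pullback]; exact (hp i).2 _
  · rw [eval_pullback]; exact hy i
  · rw [eval_pullback]; exact (ht i).1
  · rw [dirDeriv_pullback]; exact (ht i).2

theorem doubleAt_iff [DecidableEq σ] {x : σ → k} {f : MvPolynomial σ k} :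
    DoubleAt x f ↔ eval x f = 0 ∧ ∀ j, eval x (pderiv j f) = 0 := by
  refine and_congr_right fun _ => ⟨fun h j => ?_, fun h w => ?_⟩
  · rw [← dirDeriv_single]; exact h _
  · rw [dirDeriv_apply]
    exact Finset.sum_eq_zero fun j _ => by rw [h, mul_zero]

theorem generically_noForm [Infinite k] {E : Type*} [AddCommGroup E] [Module k E] (d : ℕ)
    {ι s τ : Type*} [Finite ι] [Finite s] [Finite τ] {p : E → ι → σ → k} {y : E → s → σ → k}
    {t : E → τ → (σ → k) × (σ → k)} (hp : ∀ i j, (fun e => p e i j) ∈ polyFun k E)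
    (hy : ∀ i j, (fun e => y e i j) ∈ polyFun k E)
    (ht : ∀ i j, (fun e => (t e i).1 j) ∈ polyFun k E)
    (ht' : ∀ i j, (fun e => (t e i).2 j) ∈ polyFun k E) {e₀ : E}
    (h₀ : NoForm d (p e₀) (y e₀) (t e₀)) :
    Generically k fun e => NoForm d (p e) (y e) (t e) := by
  classical
  -- In the index set, `none` and `true` stand for values, `some j` and `false` for derivatives.
  let F : E → homogeneousSubmodule σ k d → (ι × Option σ) ⊕ s ⊕ (τ × Bool) → k := fun e f =>
    Sum.elim (fun i => i.2.elim (eval (p e i.1) f.1) fun j => eval (p e i.1) (pderiv j f.1))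
      (Sum.elim (fun i => eval (y e i) f.1)
        fun i => if i.2 then eval (t e i.1).1 f.1 else dirDeriv (t e i.1).1 (t e i.1).2 f.1)
  have hF : ∀ e f, (∀ r, F e f r = 0) ↔ (∀ i, DoubleAt (p e i) f.1) ∧ (∀ i, eval (y e i) f.1 = 0) ∧
      (∀ i, eval (t e i).1 f.1 = 0 ∧ dirDeriv (t e i).1 (t e i).2 f.1 = 0) := by
    intro e f
    simp only [F, doubleAt_iff, Sum.forall, Prod.forall, Option.forall, Sum.elim_inl, Sum.elim_inr,
      Bool.forall_bool, Bool.false_eq_true, if_false, if_true, Option.elim_none, Option.elim_some]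
    exact and_congr_right fun _ => and_congr_right fun _ => forall_congr' fun i => and_comm
  refine (generically_injective F ?_ ?_ (e₀ := e₀) ?_).mono fun e he f hf h1 h2 h3 => ?_
  · rintro e (⟨i, _ | j⟩ | i | ⟨i, _ | _⟩)
    all_goals
      constructor
      · intro f g; simp [F]
      · intro c f; simp [F, smul_eval]
  · rintro f (⟨i, _ | j⟩ | i | ⟨i, _ | _⟩)
    · exact eval_mem_polyFun (hp i) _
    · exact eval_mem_polyFun (hp i) _
    · exact eval_mem_polyFun (hy i) _
    · simp only [F, Sum.elim_inr, Bool.false_eq_true, if_false, dirDeriv_apply]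
      exact sum_mem_polyFun _ fun j _ => mul_mem_polyFun (ht' i j) (eval_mem_polyFun (ht i) _)
    · simp only [F, Sum.elim_inr, if_true]
      exact eval_mem_polyFun (ht i) _
  · intro f hf
    obtain ⟨h1, h2, h3⟩ := (hF e₀ f).1 hf
    exact Subtype.ext (h₀ f.1 f.2 h1 h2 h3)
  · exact congr_arg Subtype.val (he ⟨f, hf⟩ ((hF e _).2 ⟨h1, h2, h3⟩))

end OpenCondition

end ProjSpace

namespace ProjSpace

/-! ### Subspaces, hyperplanes and linear forms. -/

section LinearAlgebra

variable {k : Type*} [Field k] {V : Type*} [AddCommGroup V] [Module k V] [Module.Finite k V]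

theorem exists_dual_ne_zero_of_finrank_lt {S : Submodule k V}
    (h : Module.finrank k S < Module.finrank k V) :
    ∃ η : Module.Dual k V, η ≠ 0 ∧ S ≤ LinearMap.ker η :=
  Submodule.exists_le_ker_of_lt_top S (Submodule.lt_top_of_finrank_lt_finrank h)

theorem exists_eq_ker {H : Submodule k V} (hH : Module.finrank k H + 1 = Module.finrank k V) :
    ∃ η : Module.Dual k V, η ≠ 0 ∧ H = LinearMap.ker η := by
  obtain ⟨η, h0, hle⟩ := exists_dual_ne_zero_of_finrank_lt (S := H) (by omega)
  refine ⟨η, h0, Submodule.eq_of_le_of_finrank_eq hle ?_⟩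
  have := Module.Dual.finrank_ker_add_one_of_ne_zero h0
  omega

/-- A subspace no larger than `H` lies in some hyperplane, and the linear group is transitive on
hyperplanes. This moves into `H` the points that have to lie there. -/
theorem exists_equiv_map_le {H S : Submodule k V}
    (hH : Module.finrank k H + 1 = Module.finrank k V)
    (hS : Module.finrank k S ≤ Module.finrank k H) :
    ∃ g : V ≃ₗ[k] V, ∀ s ∈ S, g s ∈ H := by
  obtain ⟨η, h0, hle⟩ := exists_dual_ne_zero_of_finrank_lt (S := S) (by omega)
  have hk := Module.Dual.finrank_ker_add_one_of_ne_zero h0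
  obtain ⟨C, hC⟩ := Submodule.exists_isCompl (LinearMap.ker η)
  obtain ⟨C', hC'⟩ := Submodule.exists_isCompl H
  have h1 := Submodule.finrank_add_eq_of_isCompl hC
  have h2 := Submodule.finrank_add_eq_of_isCompl hC'
  let e₁ : LinearMap.ker η ≃ₗ[k] H := LinearEquiv.ofFinrankEq _ _ (by omega)
  let e₂ : C ≃ₗ[k] C' := LinearEquiv.ofFinrankEq _ _ (by omega)
  refine ⟨(Submodule.prodEquivOfIsCompl _ _ hC).symm ≪≫ₗ (e₁.prodCongr e₂) ≪≫ₗ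
    Submodule.prodEquivOfIsCompl _ _ hC', fun s hs => ?_⟩
  have : (Submodule.prodEquivOfIsCompl _ _ hC).symm s = (⟨s, hle hs⟩, 0) := by
    rw [LinearEquiv.symm_apply_eq]
    simp
  simp [this]

theorem exists_span_sup_eq_top (S : Submodule k V) {u : ℕ}
    (h : Module.finrank k V ≤ u + Module.finrank k S) :
    ∃ p : Fin u → V, Submodule.span k (Set.range p) ⊔ S = ⊤ := by
  obtain ⟨C, hC⟩ := Submodule.exists_isCompl S
  have h1 := Submodule.finrank_add_eq_of_isCompl hC
  let b := Module.finBasis k C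
  refine ⟨fun i => if hi : (i : ℕ) < Module.finrank k C then b ⟨i, hi⟩ else 0, ?_⟩
  have hCb : C = Submodule.span k (C.subtype '' Set.range b) := by
    rw [← Submodule.map_span, b.span_eq, Submodule.map_subtype_top]
  rw [eq_top_iff, ← hC.sup_eq_top, sup_comm]
  refine sup_le_sup_right (hCb.le.trans (Submodule.span_le.2 ?_)) _
  rintro _ ⟨_, ⟨i, rfl⟩, rfl⟩
  exact Submodule.subset_span ⟨⟨i, by omega⟩, by simp⟩

theorem exists_finrank_span_pair_eq_two {H : Submodule k V} (h : 2 ≤ Module.finrank k H) :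
    ∃ y y' : H, Module.finrank k (Submodule.span k {(y : V), (y' : V)}) = 2 := by
  let β := Module.finBasis k H
  refine ⟨β ⟨0, by omega⟩, β ⟨1, by omega⟩, ?_⟩
  have hli : LinearIndependent k ![(β ⟨0, by omega⟩ : V), β ⟨1, by omega⟩] := by
    have h1 : LinearIndependent k (β ∘ ![⟨0, by omega⟩, ⟨1, by omega⟩]) :=
      β.linearIndependent.comp _ (by
        intro i j hij
        fin_cases i <;> fin_cases j <;> simp_all)
    have h2 := h1.map' H.subtype H.ker_subtype
    have he : ![(β ⟨0, by omega⟩ : V), β ⟨1, by omega⟩] =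
        H.subtype ∘ β ∘ ![⟨0, by omega⟩, ⟨1, by omega⟩] := by
      ext i : 1
      fin_cases i <;> rfl
    rw [he]
    exact h2
  have := finrank_span_eq_card hli
  rw [Matrix.range_cons, Matrix.range_cons, Matrix.range_empty, Set.union_empty] at this
  exact this

/-- The line through `y` and `z` meets `κ = 0` in `y`, so a complex can be made to contain any
prescribed point. -/
theorem exists_dual_zero_one (hV : 2 ≤ Module.finrank k V) (y : V) :
    ∃ (κ : Module.Dual k V) (z : V), κ y = 0 ∧ κ z = 1 := by
  obtain ⟨κ, h0, hle⟩ := exists_dual_ne_zero_of_finrank_lt (S := Submodule.span k {y})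
    (by
      have : Module.finrank k (Submodule.span k {y}) ≤ 1 := by
        have := finrank_span_finset_le_card (R := k) ({y} : Finset V)
        rwa [Set.finrank, Finset.coe_singleton, Finset.card_singleton] at this
      omega)
  obtain ⟨z, hz⟩ : ∃ z, κ z ≠ 0 := by
    by_contra! H
    exact h0 (LinearMap.ext H)
  exact ⟨κ, (κ z)⁻¹ • z, hle (Submodule.mem_span_singleton_self y), by simp [hz]⟩

end LinearAlgebra

/-! ### Specialising the simple points to `H`: no cubic contains a generic configuration. -/

section Configurations

variable {k : Type*} [Field k] {n : ℕ} {H : Submodule k (Fin (n + 1) → k)} {u m a b v : ℕ}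

/-- The double points of a configuration. -/
def Config.doubles (c : Config H u m a b v) : Fin u ⊕ Fin v → Fin (n + 1) → k :=
  Sum.elim c.1 fun i => c.2.2.2.2 i

/-- The points of the complex of a configuration. -/
def Config.meets (c : Config H u m a b v) :
    {e : Fin m × Fin m // e.1 < e.2} → Fin (n + 1) → k :=
  fun e => meet c.2.1.2 (c.2.1.1 e.1.1) (c.2.1.1 e.1.2)

/-- The simple points of a configuration. -/
def Config.simple (c : Config H u m a b v) : Fin a → Fin (n + 1) → k :=
  fun i => c.2.2.1 i

/-- The tangent vectors of a configuration. -/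
def Config.tangents (c : Config H u m a b v) : Fin b → (Fin (n + 1) → k) × (Fin (n + 1) → k) :=
  fun i => ((c.2.2.2.1 i).1, (c.2.2.2.1 i).2)

/-- The points of a configuration with given simple points in the ambient space. -/
def Config.points (c : Config H u m a b v) {s : Type*} (y : s → Fin (n + 1) → k) :
    {e : Fin m × Fin m // e.1 < e.2} ⊕ s → Fin (n + 1) → k :=
  Sum.elim c.meets y

theorem doubles_mem_polyFun (i j) :
    (fun c : Config H u m a b v => c.doubles i j) ∈ polyFun k (Config H u m a b v) := by
  rcases i with i | i <;> exact isLinearMap_mem_polyFun ⟨fun _ _ => rfl, fun _ _ => rfl⟩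

theorem meets_mem_polyFun (i j) :
    (fun c : Config H u m a b v => c.meets i j) ∈ polyFun k (Config H u m a b v) := by
  have hx : ∀ i j, (fun c : Config H u m a b v => c.2.1.1 i j) ∈ polyFun k (Config H u m a b v) :=
    fun i j => isLinearMap_mem_polyFun ⟨fun _ _ => rfl, fun _ _ => rfl⟩
  have hκ : ∀ i, (fun c : Config H u m a b v => c.2.1.2 (c.2.1.1 i)) ∈
      polyFun k (Config H u m a b v) := by
    intro i
    have : ∀ c : Config H u m a b v, c.2.1.2 (c.2.1.1 i) =
        ∑ j, c.2.1.1 i j * c.2.1.2 (Pi.single j 1) := by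
      intro c
      conv_lhs => rw [pi_eq_sum_univ' (c.2.1.1 i)]
      simp
    simp only [this]
    exact sum_mem_polyFun _ fun j _ => mul_mem_polyFun (hx i j)
      (isLinearMap_mem_polyFun ⟨fun _ _ => rfl, fun _ _ => rfl⟩)
  simp only [Config.meets, meet, Pi.sub_apply, Pi.smul_apply, smul_eq_mul]
  exact sub_mem_polyFun (mul_mem_polyFun (hκ _) (hx _ _)) (mul_mem_polyFun (hκ _) (hx _ _))

theorem simple_mem_polyFun (i j) :
    (fun c : Config H u m a b v => c.simple i j) ∈ polyFun k (Config H u m a b v) :=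
  isLinearMap_mem_polyFun ⟨fun _ _ => rfl, fun _ _ => rfl⟩

theorem tangents_fst_mem_polyFun (i j) :
    (fun c : Config H u m a b v => (c.tangents i).1 j) ∈ polyFun k (Config H u m a b v) :=
  isLinearMap_mem_polyFun ⟨fun _ _ => rfl, fun _ _ => rfl⟩

theorem tangents_snd_mem_polyFun (i j) :
    (fun c : Config H u m a b v => (c.tangents i).2 j) ∈ polyFun k (Config H u m a b v) :=
  isLinearMap_mem_polyFun ⟨fun _ _ => rfl, fun _ _ => rfl⟩

/-- Simple points anywhere in space impose generically independent conditions on cubics. -/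
theorem exists_generically_noForm_auxiliary [Infinite k] (hH : Module.finrank k H = n)
    (hbv : b + v ≤ n) {p : Fin (u + v) → Fin (n + 1) → k} {x : Fin m → Fin (n + 1) → k}
    {κ : Module.Dual k (Fin (n + 1) → k)} {t : Fin b → (Fin (n + 1) → k) × (Fin (n + 1) → k)}
    (h : Module.finrank k (formsThrough 3 p x κ t) ≤ a) :
    ∃ y : Fin a → Fin (n + 1) → k, Generically k fun c : Config H u m a b v =>
      NoForm 3 c.doubles (c.points y) c.tangents := by
  classical
  obtain ⟨y, hy⟩ := exists_separating
    (fun x : Fin (n + 1) → k => (MvPolynomial.aeval x).toLinearMap) a (formsThrough 3 p x κ t) h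
    fun f _ hf => MvPolynomial.funext fun z => by
      simpa [MvPolynomial.aeval_eq_eval] using hf z
  -- The supports required to lie in `H` are at most `n` in number, so they span a subspace that an
  -- automorphism carries into `H`.
  let w : Fin b ⊕ Fin v → Fin (n + 1) → k :=
    Sum.elim (fun i => (t i).1) fun i => p (Fin.natAdd u i)
  obtain ⟨g, hg⟩ := exists_equiv_map_le (H := H) (S := Submodule.span k (Set.range w))
    (by rw [hH, Module.finrank_fin_fun]) (by
      rw [hH]
      refine (finrank_range_le_card w).trans ?_
      simpa using hbv)
  have hgw : ∀ i, g (w i) ∈ H := fun i => hg _ (Submodule.subset_span ⟨i, rfl⟩)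
  have hno : NoForm 3 (Sum.elim (fun i => p (Fin.castAdd v i)) fun i => p (Fin.natAdd u i))
      (Sum.elim (fun e : {e : Fin m × Fin m // e.1 < e.2} => meet κ (x e.1.1) (x e.1.2)) y) t := by
    intro f hf h1 h2 h3
    refine hy f (mem_formsThrough.2 ⟨hf, fun i => ?_, fun i j hij => h2 (.inl ⟨(i, j), hij⟩), h3⟩)
      fun j => by simpa [MvPolynomial.aeval_eq_eval] using h2 (.inr j)
    refine Fin.addCases (fun i => h1 (.inl i)) (fun i => h1 (.inr i)) i
  refine ⟨fun i => g (y i), generically_noForm 3 doubles_mem_polyFun ?_ tangents_fst_mem_polyFun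
    tangents_snd_mem_polyFun (e₀ := (fun i => g (p (Fin.castAdd v i)), (fun i => g (x i),
      κ ∘ₗ g.symm.toLinearMap), 0, fun i => (⟨g (t i).1, hgw (.inl i)⟩, g (t i).2),
      fun i => ⟨g (p (Fin.natAdd u i)), hgw (.inr i)⟩)) ?_⟩
  · rintro (i | i) j
    · exact meets_mem_polyFun i j
    · exact const_mem_polyFun _
  · convert hno.map (g := g.toLinearMap) g.surjective using 1
    · ext (i | i) <;> rfl
    · ext (i | i) <;> simp [Config.points, Config.meets, meet]
    · rfl

/-- The quadrics which are singular at the free double points and pass through the remaining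
points of a generic configuration vanish. -/
theorem generically_no_quadric [Infinite k] (hn : 1 ≤ n) (hH : Module.finrank k H = n)
    (h : n + 1 ≤ u ∨ (u = n ∧ (1 ≤ v ∨ 1 ≤ b ∨ 2 ≤ m)) ∨
      (u + 1 = n ∧ 2 ≤ n ∧ 1 ≤ v ∧ 1 ≤ b ∧ (2 ≤ b ∨ 2 ≤ m))) :
    Generically k fun c : Config H u m a b v =>
      NoForm 2 c.1 (c.points (Sum.elim (fun i => (c.tangents i).1)
        fun i => (c.2.2.2.2 i : Fin (n + 1) → k)) : _ ⊕ (Fin b ⊕ Fin v) → _)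
        (Fin.elim0 : Fin 0 → (Fin (n + 1) → k) × (Fin (n + 1) → k)) := by
  classical
  suffices hex : ∃ c : Config H u m a b v,
      NoForm 2 c.1 (c.points (Sum.elim (fun i => (c.tangents i).1)
        fun i => (c.2.2.2.2 i : Fin (n + 1) → k)) : _ ⊕ (Fin b ⊕ Fin v) → _)
        (Fin.elim0 : Fin 0 → (Fin (n + 1) → k) × (Fin (n + 1) → k)) by
    obtain ⟨c, hc⟩ := hex
    refine generically_noForm 2 (fun i j => doubles_mem_polyFun (.inl i) j) ?_
      (fun i => i.elim0) (fun i => i.elim0) hc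
    rintro (i | i | i) j
    · exact meets_mem_polyFun i j
    · exact tangents_fst_mem_polyFun i j
    · exact doubles_mem_polyFun (.inr i) j
  have hV : Module.finrank k (Fin (n + 1) → k) = n + 1 := Module.finrank_fin_fun k
  have hm : ∀ (c : Config H u m a b v) (hm : 2 ≤ m) {y z : Fin (n + 1) → k}
      {f : MvPolynomial (Fin (n + 1)) k}, c.2.1.1 = (fun i : Fin m => if (i : ℕ) = 0 then y else z) →
      c.2.1.2 y = 0 → c.2.1.2 z = 1 → (∀ i, MvPolynomial.eval (c.meets i) f = 0) →
      MvPolynomial.eval y f = 0 := by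
    intro c hm y z f hc hy hz h
    simpa [Config.meets, meet, hc, hy, hz] using
      h ⟨(⟨0, by omega⟩, ⟨1, by omega⟩), by rw [Fin.mk_lt_mk]; omega⟩
  rcases h with hu | ⟨rfl, h⟩ | ⟨rfl, hu2, hv, hb, h⟩
  -- The double points alone span the space.
  · obtain ⟨p, hp⟩ := exists_span_sup_eq_top (k := k) (V := Fin (n + 1) → k) (u := u) ⊥
      (by rw [hV]; omega)
    refine ⟨(p, 0), fun f hf h1 _ _ => ?_⟩
    exact quadric_eq_zero hf (p := p) (y := 0) (y' := 0) (by simpa using hp) h1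
      (by rw [← zero_smul k 0, eval_smul_of_isHomogeneous hf]; simp)
      (by rw [← zero_smul k 0, eval_smul_of_isHomogeneous hf]; simp)
      (by rw [add_zero, ← zero_smul k 0, eval_smul_of_isHomogeneous hf]; simp)
  -- One point `y` completes the double points to a spanning set; it comes from a double point of
  -- `H`, a degree two scheme or the complex.
  · obtain ⟨y, hyH, hy0⟩ := Submodule.exists_mem_ne_zero_of_ne_bot (p := H) (by
      rintro rfl
      rw [finrank_bot] at hH
      omega)
    obtain ⟨p, hp⟩ := exists_span_sup_eq_top (k := k) (V := Fin (u + 1) → k) (u := u)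
      (Submodule.span k {y}) (by rw [hV, finrank_span_singleton hy0])
    obtain ⟨κ, z, hκy, hκz⟩ := exists_dual_zero_one (by rw [hV]; omega) y
    refine ⟨(p, (fun i => if (i : ℕ) = 0 then y else z, κ), 0, fun _ => (⟨y, hyH⟩, 0),
      fun _ => ⟨y, hyH⟩), fun f hf h1 h2 _ => ?_⟩
    have hy : MvPolynomial.eval y f = 0 := by
      rcases h with h | h | h
      · exact h2 (.inr (.inr ⟨0, h⟩))
      · exact h2 (.inr (.inl ⟨0, h⟩))
      · exact hm _ h rfl hκy hκz fun i => h2 (.inl i)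
    have h0 : MvPolynomial.eval 0 f = 0 := by
      rw [← zero_smul k 0, eval_smul_of_isHomogeneous hf]; simp
    refine quadric_eq_zero hf (p := p) (y := y) (y' := 0) ?_ h1 hy h0 (by rwa [add_zero])
    rw [Submodule.span_insert, Submodule.span_zero_singleton, sup_bot_eq]
    exact hp
  -- Two dimensions are missing, so three points are needed: `y` from the double point of `H`, `y'`
  -- from a degree two scheme, and `y + y'` from another one or from the complex.
  · obtain ⟨y, y', hrank⟩ := exists_finrank_span_pair_eq_two (H := H) (by omega)
    obtain ⟨p, hp⟩ := exists_span_sup_eq_top (k := k) (V := Fin (u + 1 + 1) → k) (u := u)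
      (Submodule.span k {(y : Fin (u + 1 + 1) → k), ↑y'}) (by rw [hV, hrank])
    obtain ⟨κ, z, hκy, hκz⟩ := exists_dual_zero_one (by rw [hV]; omega)
      ((y : Fin (u + 1 + 1) → k) + y')
    refine ⟨(p, (fun i => if (i : ℕ) = 0 then (y : Fin (u + 1 + 1) → k) + y' else z, κ), 0,
      fun i => (if (i : ℕ) = 0 then y' else y + y', 0), fun _ => y), fun f hf h1 h2 _ => ?_⟩
    refine quadric_eq_zero hf (p := p) (y := y) (y' := y') hp h1 (h2 (.inr (.inr ⟨0, hv⟩))) ?_ ?_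
    · simpa [Config.points, Config.tangents] using h2 (.inr (.inl ⟨0, hb⟩))
    · rcases h with h | h
      · simpa [Config.points, Config.tangents] using h2 (.inr (.inl ⟨1, h⟩))
      · exact hm _ h rfl hκy hκz fun i => h2 (.inl i)

/-- These conditions allow the equation of `H` to be cancelled; the last one is the transversality
of the degree two schemes. -/
theorem generically_avoid_hyperplane [Infinite k] (hn : 1 ≤ n) {η : Module.Dual k (Fin (n + 1) → k)}
    (h0 : η ≠ 0) :
    Generically k fun c : Config H u m a b v =>
      (∀ i, η (c.1 i) ≠ 0) ∧ (∀ i, η (c.meets i) ≠ 0) ∧ ∀ i, η (c.tangents i).2 ≠ 0 := by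
  obtain ⟨z, hz⟩ : ∃ z, η z ≠ 0 := by
    by_contra! h
    exact h0 (LinearMap.ext h)
  refine (generically_forall fun i => ?_).and
    ((generically_forall fun i => ?_).and (generically_forall fun i => ?_))
  · exact generically_of_polyFun (f := fun c : Config H u m a b v => η (c.1 i))
      (isLinearMap_mem_polyFun ⟨fun _ _ => map_add η _ _, fun _ _ => map_smul η _ _⟩)
      (e₀ := (fun _ => z, 0)) hz fun _ h => h
  · obtain ⟨κ, hκ⟩ : ∃ κ : Module.Dual k (Fin (n + 1) → k), κ ≠ 0 := ⟨η, h0⟩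
    obtain ⟨w, hw0, hw⟩ : ∃ w, w ≠ 0 ∧ η w = 0 := by
      have hk := Module.Dual.finrank_ker_add_one_of_ne_zero h0
      rw [Module.finrank_fin_fun] at hk
      obtain ⟨w, hw, hw0⟩ := Submodule.exists_mem_ne_zero_of_ne_bot (p := LinearMap.ker η) (by
        intro h
        rw [h, finrank_bot] at hk
        omega)
      exact ⟨w, hw0, hw⟩
    obtain ⟨κ, hκ⟩ : ∃ κ : Module.Dual k (Fin (n + 1) → k), κ w ≠ 0 := by
      by_contra! h
      exact hw0 ((Module.forall_dual_apply_eq_zero_iff k w).1 h)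
    refine generically_of_polyFun (f := fun c : Config H u m a b v => η (c.meets i))
      ?_ (e₀ := (0, (fun j => if j = i.1.1 then z else w, κ), 0)) ?_ fun _ h => h
    · have : ∀ c : Config H u m a b v, η (c.meets i) = ∑ j, c.meets i j * η (Pi.single j 1) := by
        intro c
        conv_lhs => rw [pi_eq_sum_univ' (c.meets i)]
        simp
      simp only [this]
      exact sum_mem_polyFun _ fun j _ => mul_mem_polyFun (meets_mem_polyFun i j)
        (const_mem_polyFun _)
    · have : i.1.2 ≠ i.1.1 := i.2.ne'
      simp [Config.meets, meet, this, hw, hκ, hz]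
  · exact generically_of_polyFun (f := fun c : Config H u m a b v => η (c.tangents i).2)
      (isLinearMap_mem_polyFun ⟨fun _ _ => map_add η _ _, fun _ _ => map_smul η _ _⟩)
      (e₀ := (0, 0, 0, fun _ => (0, z), 0)) hz fun _ h => h

/-- There are no cubics through a generic configuration. -/
theorem generically_no_cubic [Infinite k] (hn : 1 ≤ n) (hH : Module.finrank k H = n)
    (hbv : b + v ≤ n) {p : Fin (u + v) → Fin (n + 1) → k} {x : Fin m → Fin (n + 1) → k}
    {κ : Module.Dual k (Fin (n + 1) → k)} {t : Fin b → (Fin (n + 1) → k) × (Fin (n + 1) → k)}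
    (h : Module.finrank k (formsThrough 3 p x κ t) ≤ a)
    (hquad : n + 1 ≤ u ∨ (u = n ∧ (1 ≤ v ∨ 1 ≤ b ∨ 2 ≤ m)) ∨
      (u + 1 = n ∧ 2 ≤ n ∧ 1 ≤ v ∧ 1 ≤ b ∧ (2 ≤ b ∨ 2 ≤ m))) :
    Generically k fun c : Config H u m a b v =>
      NoForm 3 c.doubles (c.points c.simple) c.tangents := by
  classical
  obtain ⟨y, hy⟩ := exists_generically_noForm_auxiliary (H := H) (u := u) hH hbv h
  obtain ⟨η, h0, hη⟩ := exists_eq_ker (H := H) (by rw [hH, Module.finrank_fin_fun])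
  obtain ⟨c, hc1, hc2, hc3, hc4, hc5⟩ := (hy.and
    ((generically_no_quadric (a := a) hn hH hquad).and (generically_avoid_hyperplane hn h0))).exists
  have hηe : ∀ z, η z = ∑ i, η (Pi.single i 1) * z i := by
    intro z
    conv_lhs => rw [pi_eq_sum_univ' z]
    simp [mul_comm]
  let Z := formsThrough 3 c.doubles c.2.1.1 c.2.1.2 c.tangents
  have hZ : ∀ f, f ∈ Z ↔ f.IsHomogeneous 3 ∧ (∀ i, DoubleAt (c.doubles i) f) ∧
      (∀ i, MvPolynomial.eval (c.meets i) f = 0) ∧ ∀ i, MvPolynomial.eval (c.tangents i).1 f = 0 ∧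
        dirDeriv (c.tangents i).1 (c.tangents i).2 f = 0 := by
    intro f
    rw [mem_formsThrough]
    simp [Config.meets]
  -- The auxiliary points, which need not lie in `H`, leave no cubic in `Z`; as there are `a` of
  -- them, this bounds the dimension of `Z`.
  have hrank : Module.finrank k Z ≤ a := by
    have := finrank_le_inf_ker_add_card Z fun i => (MvPolynomial.aeval (y i)).toLinearMap
    have hbot : Z ⊓ ⨅ i, LinearMap.ker (MvPolynomial.aeval (R := k) (y i)).toLinearMap = ⊥ := by
      rw [eq_bot_iff]
      rintro f ⟨hf, hf'⟩
      obtain ⟨h1, h2, h3, h4⟩ := (hZ f).1 hf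
      refine hc1 f h1 h2 ?_ h4
      rintro (i | i)
      · exact h3 i
      · simpa [Config.points, MvPolynomial.aeval_eq_eval] using (Submodule.mem_iInf _).1 hf' i
    rw [hbot, finrank_bot, Fintype.card_fin, zero_add] at this
    exact this
  obtain ⟨s, hs⟩ := exists_separating
    (fun z : H => (MvPolynomial.aeval (z : Fin (n + 1) → k)).toLinearMap) a Z hrank (by
      intro f hf hfH
      obtain ⟨h1, h2, h3, h4⟩ := (hZ f).1 hf
      -- After division by the equation of `H`, conditions at points off `H` pass unchanged to `q`.
      -- Those at degree two schemes and double points supported in `H` lose one order, leaving the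
      -- vanishing of `q` at their supports.
      obtain ⟨q, hq, rfl⟩ := exists_eq_mul_of_vanish h1 (c := fun i => η (Pi.single i 1)) (by
          rintro h
          refine h0 (LinearMap.ext fun z => ?_)
          rw [hηe]
          simp [congr_fun h]) fun z hz => by
        have hzH : z ∈ H := by
          rw [hη, LinearMap.mem_ker, hηe]
          exact hz
        simpa [MvPolynomial.aeval_eq_eval] using hfH ⟨z, hzH⟩
      have hF : ∀ z, MvPolynomial.eval z (∑ i, MvPolynomial.C (η (Pi.single i 1)) *
          MvPolynomial.X i) = η z := by
        intro z
        rw [hηe]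
        simp
      have hF' : ∀ z w, dirDeriv z w (∑ i, MvPolynomial.C (η (Pi.single i 1)) *
          MvPolynomial.X i) = η w := by
        intro z w
        rw [hηe]
        simp [dirDeriv_mul, dirDeriv_C, dirDeriv_X]
      have hz : ∀ z ∈ H, η z = 0 := fun z hz => by rwa [hη] at hz
      simp only [DoubleAt, dirDeriv_mul, map_mul, hF, hF'] at h2 h3 h4
      have : q = 0 := by
        refine hc2 q hq (fun i => ?_) ?_ (fun i => i.elim0)
        · obtain ⟨e1, e2⟩ := h2 (.inl i)
          have e3 := (mul_eq_zero.1 e1).resolve_left (hc3 i)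
          refine ⟨e3, fun w => ?_⟩
          have e4 := e2 w
          rw [e3, mul_zero, zero_add] at e4
          exact (mul_eq_zero.1 e4).resolve_left (hc3 i)
        · rintro (i | i | i)
          · exact (mul_eq_zero.1 (h3 i)).resolve_left (hc4 i)
          · have e1 := (h4 i).2
            rw [show η (c.tangents i).1 = 0 from hz _ (SetLike.coe_mem _), zero_mul, add_zero] at e1
            exact (mul_eq_zero.1 e1).resolve_left (hc5 i)
          · obtain ⟨w, hw⟩ : ∃ w, η w ≠ 0 := by
              by_contra! h
              exact h0 (LinearMap.ext h)
            have e1 := (h2 (.inr i)).2 w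
            rw [show η (c.doubles (.inr i)) = 0 from hz _ (SetLike.coe_mem _), zero_mul,
              add_zero] at e1
            exact (mul_eq_zero.1 e1).resolve_left hw
      rw [this, mul_zero])
  refine generically_noForm 3 doubles_mem_polyFun ?_ tangents_fst_mem_polyFun
    tangents_snd_mem_polyFun (e₀ := (c.1, c.2.1, s, c.2.2.2)) ?_
  · rintro (i | i) j
    · exact meets_mem_polyFun i j
    · exact simple_mem_polyFun i j
  · intro f h1 h2 h3 h4
    refine hs f ((hZ f).2 ⟨h1, h2, fun i => h3 (.inl i), h4⟩) fun j => ?_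
    simpa [Config.points, Config.simple, MvPolynomial.aeval_eq_eval] using h3 (.inr j)

end Configurations

end ProjSpace

namespace ProjSpace

/-! ### Jets of Laurent polynomials and sections of the twisted structure sheaf. -/

section Laurent

open MvPolynomial

variable {k : Type*} [Field k] {n : ℕ}

/-- The linear map with prescribed values on the Laurent monomials. -/
noncomputable def laurentLift {M : Type*} [AddCommGroup M] [Module k M]
    (F : (Fin (n + 1) → ℤ) → M) : Laurent k n →ₗ[k] M :=
  Finsupp.linearCombination k F ∘ₗ (AddMonoidAlgebra.coeffLinearEquiv k).toLinearMap

@[simp]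
theorem laurentLift_single {M : Type*} [AddCommGroup M] [Module k M]
    (F : (Fin (n + 1) → ℤ) → M) (α : Fin (n + 1) → ℤ) (c : k) :
    laurentLift F (AddMonoidAlgebra.single α c) = c • F α := by
  simp [laurentLift]

theorem laurent_hom_ext {M : Type*} [AddCommGroup M] [Module k M] {f g : Laurent k n →ₗ[k] M}
    (h : ∀ α c, f (AddMonoidAlgebra.single α c) = g (AddMonoidAlgebra.single α c)) : f = g := by
  ext α
  simpa using h α 1

/-- The value of a Laurent monomial at a point. -/
noncomputable def monomialValue (x : Fin (n + 1) → k) (α : Fin (n + 1) → ℤ) : k := ∏ i, x i ^ α i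

/-- The convention `0⁻¹ = 0` makes the value meaningless where a negative power of a vanishing
coordinate occurs, so multiplicativity needs a nonzero coordinate. -/
theorem monomialValue_add_single {x : Fin (n + 1) → k} {i : Fin (n + 1)} (hi : x i ≠ 0)
    (α : Fin (n + 1) → ℤ) : monomialValue x (α + Pi.single i 1) = x i * monomialValue x α := by
  unfold monomialValue
  rw [← Finset.mul_prod_erase _ _ (Finset.mem_univ i),
    ← Finset.mul_prod_erase (f := fun j => x j ^ α j) _ (Finset.mem_univ i), ← mul_assoc]
  congr 1
  · rw [Pi.add_apply, Pi.single_eq_same, zpow_add₀ hi, zpow_one, mul_comm]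
  · refine Finset.prod_congr rfl fun j hj => ?_
    rw [Pi.add_apply, Pi.single_eq_of_ne (Finset.ne_of_mem_erase hj), add_zero]

/-- The value of a Laurent polynomial at a point. -/
noncomputable def laurentEval (x : Fin (n + 1) → k) : Laurent k n →ₗ[k] k :=
  laurentLift (monomialValue x)

/-- The derivative of a Laurent polynomial at a point. -/
noncomputable def laurentDeriv (x w : Fin (n + 1) → k) : Laurent k n →ₗ[k] k :=
  laurentLift fun α => ∑ j, w j * α j * monomialValue x (α - Pi.single j 1)

theorem toLaurent_X (i : Fin (n + 1)) :
    toLaurent k n (X i) = AddMonoidAlgebra.single (Pi.single i 1) 1 := by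
  simp [toLaurent]

theorem toLaurent_monomial (e : Fin (n + 1) →₀ ℕ) (c : k) :
    toLaurent k n (monomial e c) = AddMonoidAlgebra.single (fun i => (e i : ℤ)) c := by
  induction e using Finsupp.induction_linear generalizing c with
  | zero =>
    rw [show monomial (0 : Fin (n + 1) →₀ ℕ) c = C c from rfl, ← algebraMap_eq, AlgHom.commutes]
    rfl
  | add f g hf hg =>
    have := congr_arg₂ (· * ·) (hf c) (hg 1)
    simp only [← map_mul, monomial_mul, mul_one, AddMonoidAlgebra.single_mul_single] at this
    rw [this]
    congr 1
  | single i m =>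
    rw [← C_mul_X_pow_eq_monomial, map_mul, map_pow, toLaurent_X, ← algebraMap_eq, AlgHom.commutes,
      AddMonoidAlgebra.single_pow, one_pow, ← Algebra.smul_def, AddMonoidAlgebra.smul_single,
      smul_eq_mul, mul_one]
    congr 1
    ext j
    by_cases hj : j = i
    · subst hj; simp
    · simp [hj]

theorem monomialValue_natCast (x : Fin (n + 1) → k) (e : Fin (n + 1) →₀ ℕ) :
    monomialValue x (fun i => (e i : ℤ)) = ∏ i, x i ^ e i := by
  simp [monomialValue]

theorem laurentEval_toLaurent (x : Fin (n + 1) → k) (f : MvPolynomial (Fin (n + 1)) k) :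
    laurentEval x (toLaurent k n f) = eval x f := by
  induction f using MvPolynomial.induction_on' with
  | monomial e c =>
    rw [toLaurent_monomial, laurentEval, laurentLift_single, monomialValue_natCast, eval_monomial,
      Finsupp.prod_fintype _ _ (by simp), smul_eq_mul]
  | add p q hp hq => simp [hp, hq]

theorem laurentDeriv_toLaurent (x w : Fin (n + 1) → k) (f : MvPolynomial (Fin (n + 1)) k) :
    laurentDeriv x w (toLaurent k n f) = dirDeriv x w f := by
  induction f using MvPolynomial.induction_on' with
  | monomial e c =>
    rw [toLaurent_monomial, laurentDeriv, laurentLift_single, dirDeriv_apply, Finset.smul_sum]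
    refine Finset.sum_congr rfl fun j _ => ?_
    rw [pderiv_monomial, eval_monomial, Finsupp.prod_fintype _ _ (by simp)]
    by_cases hj : e j = 0
    · simp [hj]
    · have : (fun i => (e i : ℤ)) - Pi.single j 1 =
          fun i => (((e - Finsupp.single j 1 : Fin (n + 1) →₀ ℕ) i : ℕ) : ℤ) := by
        ext i
        by_cases hi : i = j
        · subst hi
          simp
          omega
        · simp [hi]
      rw [this, monomialValue_natCast]
      simp only [Int.cast_natCast, smul_eq_mul]
      ring
  | add p q hp hq => simp [hp, hq]

/-- The Leibniz rule for multiplication by monomials in the coordinates which do not vanish at a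
point. -/
theorem laurent_leibniz {x : Fin (n + 1) → k} {T : Finset (Fin (n + 1))} (hT : ∀ i ∈ T, x i ≠ 0)
    (w : Fin (n + 1) → k) (N : ℕ) (g : Laurent k n) :
    laurentEval x (toLaurent k n (∏ i ∈ T, X i) ^ N * g) =
        eval x ((∏ i ∈ T, X i) ^ N) * laurentEval x g ∧
      laurentDeriv x w (toLaurent k n (∏ i ∈ T, X i) ^ N * g) =
        eval x ((∏ i ∈ T, X i) ^ N) * laurentDeriv x w g +
          dirDeriv x w ((∏ i ∈ T, X i) ^ N) * laurentEval x g := by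
  -- The multipliers that obey both rules form a submonoid, which reduces the claim to a single
  -- variable.
  let M : Submonoid (MvPolynomial (Fin (n + 1)) k) :=
    { carrier := {h | ∀ g, laurentEval x (toLaurent k n h * g) = eval x h * laurentEval x g ∧
        laurentDeriv x w (toLaurent k n h * g) =
          eval x h * laurentDeriv x w g + dirDeriv x w h * laurentEval x g}
      one_mem' := fun g => by
        have : dirDeriv x w (1 : MvPolynomial (Fin (n + 1)) k) = 0 := dirDeriv_C x w 1
        simp [this]
      mul_mem' := fun {f h} hf hh g => by
        rw [map_mul (toLaurent k n), mul_assoc, (hf _).1, (hf _).2, (hh _).1, (hh _).2, map_mul, dirDeriv_mul]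
        constructor <;> ring }
  have hX : ∀ i ∈ T, (X i : MvPolynomial (Fin (n + 1)) k) ∈ M := by
    intro i hi g
    rw [toLaurent_X, eval_X, dirDeriv_X]
    induction g using AddMonoidAlgebra.induction_linear with
    | zero => simp
    | add f g hf hg =>
      rw [mul_add, map_add, map_add, map_add, map_add, hf.1, hf.2, hg.1, hg.2]
      constructor <;> ring
    | single α c =>
      rw [AddMonoidAlgebra.single_mul_single, one_mul, add_comm (Pi.single i 1) α]
      simp only [laurentEval, laurentDeriv, laurentLift_single, smul_eq_mul]
      refine ⟨?_, ?_⟩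
      · rw [monomialValue_add_single (hT i hi)]
        ring
      · have : ∀ j, w j * ((α + Pi.single i 1 : Fin (n + 1) → ℤ) j : k) *
            monomialValue x (α + Pi.single i 1 - Pi.single j 1) =
            x i * (w j * α j * monomialValue x (α - Pi.single j 1)) +
              if j = i then w i * monomialValue x α else 0 := by
          intro j
          by_cases hj : j = i
          · subst hj
            have e1 : monomialValue x α = x j * monomialValue x (α - Pi.single j 1) := by
              rw [← monomialValue_add_single (hT j hi), sub_add_cancel]
            rw [add_sub_cancel_right, e1]
            simp
            ring
          · rw [if_neg hj, add_sub_right_comm, monomialValue_add_single (hT i hi)]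
            simp [hj]
            ring
        simp only [this, Finset.sum_add_distrib, Finset.sum_ite_eq', Finset.mem_univ, if_true,
          ← Finset.mul_sum]
        ring
  have := M.pow_mem (M.prod_mem hX) N g
  rwa [map_pow] at this

/-- The sections over the standard open sets of the sheaf `𝓞(d)`. -/
theorem mem_sections_top {d : ℕ} {T : Finset (Fin (n + 1))} {g : Laurent k n} :
    g ∈ sections ⊤ d T ↔ ∀ α, g.coeff α ≠ 0 → ∑ i, α i = d ∧ ∀ i ∉ T, 0 ≤ α i := by
  have hprod : ∀ N : ℕ, toLaurent k n (∏ i ∈ T, X i) ^ N =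
      AddMonoidAlgebra.single (fun i => if i ∈ T then (N : ℤ) else 0) 1 := by
    intro N
    have : (∏ i ∈ T, X i : MvPolynomial (Fin (n + 1)) k) = monomial (∑ i ∈ T, Finsupp.single i 1) 1 := by
      rw [monomial_sum_one]
      rfl
    rw [this, toLaurent_monomial, AddMonoidAlgebra.single_pow, one_pow]
    congr 1
    ext i
    simp [Finsupp.single_apply]
  constructor
  · rintro ⟨N, f, -, hf, he⟩ α hα
    have hcoeff : ∀ (e : Fin (n + 1) → ℤ), (toLaurent k n f).coeff e ≠ 0 →
        ∑ i, e i = (d + N * T.card : ℕ) ∧ ∀ i, 0 ≤ e i := by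
      intro e hne
      rw [f.as_sum, map_sum, AddMonoidAlgebra.coeff_sum, Finsupp.finsetSum_apply] at hne
      obtain ⟨m, hm, hne⟩ := Finset.exists_ne_zero_of_sum_ne_zero hne
      rw [toLaurent_monomial, AddMonoidAlgebra.coeff_single, Finsupp.single_apply] at hne
      split_ifs at hne with hem
      · subst hem
        have hdeg : d + N * T.card = m.degree := hf.degree_eq_sum_deg_support hm
        refine ⟨?_, fun i => by positivity⟩
        rw [hdeg, Finsupp.degree_eq_sum]
        simp
      · exact absurd rfl hne
    have h := hcoeff ((fun i => if i ∈ T then (N : ℤ) else 0) + α) (by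
      rw [he, hprod, AddMonoidAlgebra.coeff_single_mul_add]
      simpa using hα)
    refine ⟨?_, fun i hi => by simpa [hi] using h.2 i⟩
    have h1 := h.1
    simp only [Pi.add_apply, Finset.sum_add_distrib, Finset.sum_ite_mem, Finset.univ_inter,
      Finset.sum_const, nsmul_eq_mul] at h1
    push_cast at h1
    linarith
  · intro h
    rw [← g.sum_coeff_single, Finsupp.sum]
    refine Submodule.sum_mem _ fun α hα => ?_
    obtain ⟨h1, h2⟩ := h α (Finsupp.mem_support_iff.1 hα)
    let N : ℕ := ∑ i, (α i).natAbs
    have hN : ∀ i, 0 ≤ (if i ∈ T then (N : ℤ) else 0) + α i := by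
      intro i
      split_ifs with hi
      · have : (α i).natAbs ≤ N := Finset.single_le_sum (f := fun i => (α i).natAbs)
          (fun _ _ => Nat.zero_le _) (Finset.mem_univ i)
        omega
      · simpa using h2 i hi
    let e : Fin (n + 1) →₀ ℕ :=
      Finsupp.equivFunOnFinite.symm fun i => ((if i ∈ T then (N : ℤ) else 0) + α i).toNat
    have he : (fun i => (e i : ℤ)) = (fun i => if i ∈ T then (N : ℤ) else 0) + α := by
      ext i
      simp only [e, Finsupp.equivFunOnFinite_symm_apply_apply, Pi.add_apply]
      exact Int.toNat_of_nonneg (hN i)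
    refine ⟨N, monomial e (g.coeff α), trivial, isHomogeneous_monomial _ ?_, ?_⟩
    · have : (e.degree : ℤ) = (d + N * T.card : ℕ) := by
        rw [Finsupp.degree_eq_sum]
        push_cast
        rw [Finset.sum_congr rfl fun i _ => congr_fun he i]
        simp only [Pi.add_apply, Finset.sum_add_distrib, Finset.sum_ite_mem, Finset.univ_inter,
          Finset.sum_const, nsmul_eq_mul, h1]
        ring
      exact_mod_cast this
    · rw [toLaurent_monomial, hprod, AddMonoidAlgebra.single_mul_single, one_mul, he]

end Laurent

end ProjSpace

namespace ProjSpace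

/-! ### The contracting homotopy of a simplex. -/

section Cone

variable {k : Type*} [Field k] {n : ℕ} {M : Type*} [AddCommGroup M] [Module k M]

/-- The simplicial differential with coefficients in a vector space. -/
def cechDiff (k : Type*) [Field k] [Module k M] (b : Finset (Fin (n + 1)) → M)
    (T : Finset (Fin (n + 1))) : M :=
  ∑ l ∈ T, ((-1 : k) ^ (T.filter (· < l)).card) • b (T.erase l)

theorem differential_apply (b : Finset (Fin (n + 1)) → Laurent k n) (T : Finset (Fin (n + 1))) :
    differential k n b T = cechDiff k b T := by
  simp [differential, cechDiff]

theorem map_cechDiff {M' : Type*} [AddCommGroup M'] [Module k M'] (f : M →ₗ[k] M')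
    (b : Finset (Fin (n + 1)) → M) (T : Finset (Fin (n + 1))) :
    f (cechDiff k b T) = cechDiff k (fun S => f (b S)) T := by
  simp [cechDiff]

/-- The contraction of the simplicial complex to the vertex `i`. -/
def cone (k : Type*) [Field k] [Module k M] (i : Fin (n + 1)) (b : Finset (Fin (n + 1)) → M)
    (T : Finset (Fin (n + 1))) : M :=
  if i ∈ T then 0 else ((-1 : k) ^ (T.filter (· < i)).card) • b (insert i T)

/-- The empty set is among the faces, so this contracts the augmented complex. When `i ∉ T`, the
terms that remove some `l ∈ T` cancel, because inserting `i` and removing `l` in the two orders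
gives opposite signs. -/
theorem cechDiff_cone_add (i : Fin (n + 1)) (b : Finset (Fin (n + 1)) → M)
    (T : Finset (Fin (n + 1))) :
    cechDiff k (cone k i b) T + cone k i (cechDiff k b) T = b T := by
  have hsq : ∀ m : ℕ, ((-1 : k) ^ m * (-1) ^ m) = 1 := fun m => by
    rw [← mul_pow]; simp
  by_cases hi : i ∈ T
  · rw [cone, if_pos hi, add_zero, cechDiff, Finset.sum_eq_single i]
    · have : (T.erase i).filter (· < i) = T.filter (· < i) := by
        ext j
        simp only [Finset.mem_filter, Finset.mem_erase]
        exact ⟨fun h => ⟨h.1.2, h.2⟩, fun h => ⟨⟨h.2.ne, h.1⟩, h.2⟩⟩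
      rw [cone, if_neg (Finset.notMem_erase i T), this, smul_smul, hsq, one_smul,
        Finset.insert_erase hi]
    · intro l _ hl
      rw [cone, if_pos (Finset.mem_erase.2 ⟨hl.symm, hi⟩), smul_zero]
    · exact fun h => absurd hi h
  · rw [cone, if_neg hi, cechDiff, cechDiff, Finset.sum_insert hi, smul_add, smul_smul,
      Finset.erase_insert hi, Finset.filter_insert, if_neg (lt_irrefl i), hsq, one_smul,
      add_comm (b T), ← add_assoc, Finset.smul_sum, ← Finset.sum_add_distrib,
      Finset.sum_eq_zero, zero_add]
    intro l hl
    have hil : i ≠ l := fun h => hi (h ▸ hl)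
    have h1 : i ∉ T.erase l := fun h => hi (Finset.mem_of_mem_erase h)
    rw [cone, if_neg h1, smul_smul, smul_smul, ← Finset.erase_insert_of_ne hil, ← add_smul]
    convert zero_smul k _ using 2
    rw [Finset.filter_insert, Finset.filter_erase]
    rcases lt_or_gt_of_ne hil with h | h
    · rw [if_pos h, Finset.card_insert_of_notMem (by simp [hi]),
        Finset.erase_eq_of_notMem (by simp [h.le]), pow_succ]
      ring
    · have hmem : l ∈ T.filter (· < i) := by simp [hl, h]
      rw [if_neg h.not_gt, ← Finset.card_erase_add_one hmem, pow_succ]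
      ring

end Cone

/-! ### Linear forms and finite schemes given by jets. -/

section DualForm

open MvPolynomial

variable {k : Type*} [Field k] {n : ℕ}

/-- The linear form with given values. -/
noncomputable def dualForm (η : Module.Dual k (Fin (n + 1) → k)) : MvPolynomial (Fin (n + 1)) k :=
  ∑ i, C (η (Pi.single i 1)) * X i

theorem dual_apply_eq_sum (η : Module.Dual k (Fin (n + 1) → k)) (z : Fin (n + 1) → k) :
    η z = ∑ i, η (Pi.single i 1) * z i := by
  conv_lhs => rw [pi_eq_sum_univ' z]
  simp [mul_comm]

@[simp]
theorem eval_dualForm (η : Module.Dual k (Fin (n + 1) → k)) (z : Fin (n + 1) → k) :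
    eval z (dualForm η) = η z := by
  rw [dual_apply_eq_sum]
  simp [dualForm]

@[simp]
theorem dirDeriv_dualForm (η : Module.Dual k (Fin (n + 1) → k)) (z w : Fin (n + 1) → k) :
    dirDeriv z w (dualForm η) = η w := by
  rw [dual_apply_eq_sum]
  simp [dualForm, dirDeriv_mul, dirDeriv_C, dirDeriv_X]

theorem isHomogeneous_dualForm (η : Module.Dual k (Fin (n + 1) → k)) :
    (dualForm η).IsHomogeneous 1 :=
  IsHomogeneous.sum _ _ _ fun _ _ => isHomogeneous_C_mul_X _ _

theorem exists_dual_eq {V O : Type*} [AddCommGroup V] [Module k V] [Finite O] {b : O → V}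
    (hb : LinearIndependent k b) (c : O → k) : ∃ η : Module.Dual k V, ∀ o, η (b o) = c o := by
  classical
  have := Fintype.ofFinite O
  obtain ⟨B, hB⟩ := (Fintype.linearCombination k b).exists_leftInverse_of_injective
    (LinearMap.ker_eq_bot'.2 fun m hm => funext (Fintype.linearIndependent_iff.1 hb m hm))
  refine ⟨(Fintype.linearCombination k c) ∘ₗ B, fun o => ?_⟩
  have : B (b o) = Pi.single o 1 := by
    have h := LinearMap.congr_fun hB (Pi.single o 1)
    rwa [LinearMap.comp_apply, Fintype.linearCombination_apply_single, one_smul] at h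
  rw [LinearMap.comp_apply, this, Fintype.linearCombination_apply_single, one_smul]

theorem DoubleAt.mul_right {x : Fin (n + 1) → k} {f : MvPolynomial (Fin (n + 1)) k}
    (hf : DoubleAt x f) (g : MvPolynomial (Fin (n + 1)) k) : DoubleAt x (f * g) :=
  ⟨by rw [map_mul, hf.1, zero_mul], fun w => by rw [dirDeriv_mul, hf.1, hf.2]; ring⟩

theorem doubleAt_sq {x : Fin (n + 1) → k} {f : MvPolynomial (Fin (n + 1)) k} (hf : eval x f = 0) :
    DoubleAt x (f ^ 2) :=
  ⟨by rw [map_pow, hf]; ring, fun w => by rw [pow_two, dirDeriv_mul, hf]; ring⟩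

end DualForm

/-- Finitely many points of projective space, each with finitely many tangent directions, and the
ideal of the union of the corresponding schemes. -/
structure JetScheme (k : Type*) [Field k] (n : ℕ) (ι : Type*) (D : ι → Type*) where
  /-- The points. -/
  pt : ι → Fin (n + 1) → k
  /-- The tangent directions. -/
  dir : ∀ i, D i → Fin (n + 1) → k
  /-- The ideal. -/
  ideal : Ideal (MvPolynomial (Fin (n + 1)) k)
  pairwise : ∀ i j, i ≠ j → LinearIndependent k ![pt i, pt j]
  indep : ∀ i, LinearIndependent k fun o : Option (D i) => o.elim (pt i) (dir i)
  mem_ideal : ∀ (f : MvPolynomial (Fin (n + 1)) k) (d : ℕ), f.IsHomogeneous d →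
    (f ∈ ideal ↔ ∀ i, MvPolynomial.eval (pt i) f = 0 ∧ ∀ δ, dirDeriv (pt i) (dir i δ) f = 0)

/-! ### Interpolation of jets by forms and by local sections. -/

namespace JetScheme

open MvPolynomial

variable {k : Type*} [Field k] {n : ℕ} {ι : Type*} {D : ι → Type*} (Y : JetScheme k n ι D)

/-- The coordinates of the jets of a polynomial. -/
noncomputable def jet (j : Σ i, Option (D i)) : MvPolynomial (Fin (n + 1)) k →ₗ[k] k :=
  j.2.elim (aeval (Y.pt j.1)).toLinearMap fun δ => dirDeriv (Y.pt j.1) (Y.dir j.1 δ)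

/-- The coordinates of the jets of a Laurent polynomial. -/
noncomputable def laurentJet (j : Σ i, Option (D i)) : Laurent k n →ₗ[k] k :=
  j.2.elim (laurentEval (Y.pt j.1)) fun δ => laurentDeriv (Y.pt j.1) (Y.dir j.1 δ)

theorem jet_none (i : ι) (f : MvPolynomial (Fin (n + 1)) k) :
    Y.jet ⟨i, none⟩ f = eval (Y.pt i) f := by
  simp [jet, aeval_eq_eval]

theorem jet_some (i : ι) (δ : D i) (f : MvPolynomial (Fin (n + 1)) k) :
    Y.jet ⟨i, some δ⟩ f = dirDeriv (Y.pt i) (Y.dir i δ) f := rfl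

theorem laurentJet_none (i : ι) : Y.laurentJet ⟨i, none⟩ = laurentEval (Y.pt i) := rfl

theorem laurentJet_some (i : ι) (δ : D i) :
    Y.laurentJet ⟨i, some δ⟩ = laurentDeriv (Y.pt i) (Y.dir i δ) := rfl

theorem laurentJet_toLaurent (j : Σ i, Option (D i)) (f : MvPolynomial (Fin (n + 1)) k) :
    Y.laurentJet j (toLaurent k n f) = Y.jet j f := by
  rcases j with ⟨i, _ | δ⟩
  · rw [jet_none, laurentJet_none, laurentEval_toLaurent]
  · rw [jet_some, laurentJet_some, laurentDeriv_toLaurent]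

theorem mem_ideal_iff {f : MvPolynomial (Fin (n + 1)) k} {d : ℕ} (hf : f.IsHomogeneous d) :
    f ∈ Y.ideal ↔ ∀ j, Y.jet j f = 0 := by
  rw [Y.mem_ideal f d hf]
  constructor
  · rintro h ⟨i, _ | δ⟩
    · rw [jet_none]; exact (h i).1
    · exact (h i).2 δ
  · intro h i
    refine ⟨?_, fun δ => h ⟨i, some δ⟩⟩
    rw [← jet_none]
    exact h ⟨i, none⟩

/-- The vanishing of jets of a Laurent polynomial can be tested after clearing denominators. -/
theorem jet_eq_zero_iff {i : ι} {T : Finset (Fin (n + 1))} (hT : ∀ t ∈ T, Y.pt i t ≠ 0) {N : ℕ}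
    {f : MvPolynomial (Fin (n + 1)) k} {g : Laurent k n}
    (h : toLaurent k n f = toLaurent k n (∏ t ∈ T, X t) ^ N * g) :
    (∀ o, Y.jet ⟨i, o⟩ f = 0) ↔ ∀ o, Y.laurentJet ⟨i, o⟩ g = 0 := by
  have hs : eval (Y.pt i) ((∏ t ∈ T, X t) ^ N) ≠ 0 := by
    rw [map_pow, map_prod]
    exact pow_ne_zero _ (Finset.prod_ne_zero_iff.2 fun t ht => by simpa using hT t ht)
  have h0 : Y.jet ⟨i, none⟩ f = eval (Y.pt i) ((∏ t ∈ T, X t) ^ N) * Y.laurentJet ⟨i, none⟩ g := by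
    rw [← laurentJet_toLaurent, h]
    exact (laurent_leibniz hT 0 N g).1
  have h1 : ∀ δ, Y.jet ⟨i, some δ⟩ f =
      eval (Y.pt i) ((∏ t ∈ T, X t) ^ N) * Y.laurentJet ⟨i, some δ⟩ g +
        dirDeriv (Y.pt i) (Y.dir i δ) ((∏ t ∈ T, X t) ^ N) * Y.laurentJet ⟨i, none⟩ g := by
    intro δ
    rw [← laurentJet_toLaurent, h]
    exact (laurent_leibniz hT _ N g).2
  rw [Option.forall, Option.forall]
  simp only [h0, h1, mul_eq_zero, hs, false_or]
  refine and_congr_right fun h => ?_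
  simp only [h, mul_zero, add_zero, mul_eq_zero, hs, false_or]

theorem mem_sections_iff {d : ℕ} {T : Finset (Fin (n + 1))} {g : Laurent k n}
    (hg : g ∈ sections ⊤ d T) : g ∈ sections Y.ideal d T ↔
      ∀ j, (∀ t ∈ T, Y.pt j.1 t ≠ 0) → Y.laurentJet j g = 0 := by
  constructor
  · rintro ⟨N, f, hfI, hf, he⟩ ⟨i, o⟩ hT
    exact (Y.jet_eq_zero_iff hT he).1 (fun o => (Y.mem_ideal_iff hf).1 hfI ⟨i, o⟩) o
  · intro h
    obtain ⟨N, f, -, hf, he⟩ := hg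
    have hx : (∏ t ∈ T, (X t : MvPolynomial (Fin (n + 1)) k)).IsHomogeneous T.card := by
      simpa using IsHomogeneous.prod T
        (fun i => (X i : MvPolynomial (Fin (n + 1)) k)) (fun _ => 1)
        (fun i _ => isHomogeneous_X k i)
    -- The extra square in the denominator makes the numerator vanish to order two at every point
    -- outside the open set, where `g` imposes nothing.
    have hf' : ((∏ t ∈ T, X t) ^ 2 * f).IsHomogeneous (d + (2 + N) * T.card) := by
      have := (hx.pow 2).mul hf
      rwa [show T.card * 2 + (d + N * T.card) = d + (2 + N) * T.card by ring] at this
    have he' : toLaurent k n ((∏ t ∈ T, X t) ^ 2 * f) =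
        toLaurent k n (∏ t ∈ T, X t) ^ (2 + N) * g := by
      rw [map_mul, he, map_pow, pow_add, mul_assoc]
    refine ⟨2 + N, _, (Y.mem_ideal_iff hf').2 ?_, hf', he'⟩
    rintro ⟨i, o⟩
    by_cases hT : ∀ t ∈ T, Y.pt i t ≠ 0
    · exact (Y.jet_eq_zero_iff hT he').2 (fun o => h ⟨i, o⟩ hT) o
    · push Not at hT
      obtain ⟨t, ht, h0⟩ := hT
      have hd : DoubleAt (Y.pt i) ((∏ t ∈ T, X t) ^ 2 * f) := by
        refine (doubleAt_sq ?_).mul_right f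
        rw [map_prod]
        exact Finset.prod_eq_zero ht (by simpa using h0)
      rcases o with _ | δ
      · rw [jet_none]; exact hd.1
      · exact hd.2 _

/-- A product of squares of linear forms separating the point `i` from the others vanishes to order
two at those and is nonzero at `i`; one more linear factor then prescribes the jet at `i`. The bound
on `d` leaves room for all these factors. -/
theorem exists_form [Fintype ι] [∀ i, Finite (D i)] {d : ℕ} (hd : 2 * Fintype.card ι + 1 ≤ d)
    (c : (Σ i, Option (D i)) → k) :
    ∃ f : MvPolynomial (Fin (n + 1)) k, f.IsHomogeneous d ∧ ∀ j, Y.jet j f = c j := by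
  classical
  have hsep : ∀ i q, ∃ η : Module.Dual k (Fin (n + 1) → k),
      i ≠ q → η (Y.pt i) = 1 ∧ η (Y.pt q) = 0 := by
    intro i q
    by_cases hiq : i = q
    · exact ⟨0, fun h => absurd hiq h⟩
    · obtain ⟨η, hη⟩ := exists_dual_eq (Y.pairwise i q hiq) ![1, 0]
      exact ⟨η, fun _ => ⟨hη 0, hη 1⟩⟩
  choose η hη using hsep
  have hunit : ∀ i, ∃ η : Module.Dual k (Fin (n + 1) → k), η (Y.pt i) = 1 := by
    intro i
    obtain ⟨η, hη⟩ := exists_dual_eq (Y.indep i) fun _ => 1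
    exact ⟨η, hη none⟩
  choose η₀ hη₀ using hunit
  let P : ι → MvPolynomial (Fin (n + 1)) k := fun i =>
    (∏ q ∈ Finset.univ.erase i, dualForm (η i q) ^ 2) *
      dualForm (η₀ i) ^ (d - 1 - 2 * (Fintype.card ι - 1))
  have hPdeg : ∀ i, (P i).IsHomogeneous (d - 1) := by
    intro i
    have h1 := IsHomogeneous.prod (Finset.univ.erase i) (fun q => dualForm (η i q) ^ 2)
      (fun _ => 1 * 2) fun q _ => (isHomogeneous_dualForm _).pow 2
    have h2 := h1.mul ((isHomogeneous_dualForm (η₀ i)).pow (d - 1 - 2 * (Fintype.card ι - 1)))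
    rw [Finset.sum_const, Finset.card_erase_of_mem (Finset.mem_univ i), Finset.card_univ,
      smul_eq_mul, one_mul, one_mul] at h2
    convert h2 using 1
    omega
  have hP1 : ∀ i, eval (Y.pt i) (P i) = 1 := by
    intro i
    simp only [P, map_mul, map_prod, map_pow, eval_dualForm, hη₀, one_pow, mul_one]
    refine Finset.prod_eq_one fun q hq => ?_
    rw [(hη i q (Finset.ne_of_mem_erase hq).symm).1, one_pow]
  have hP0 : ∀ i q, i ≠ q → DoubleAt (Y.pt q) (P i) := by
    intro i q hiq
    have hq : q ∈ Finset.univ.erase i := Finset.mem_erase.2 ⟨hiq.symm, Finset.mem_univ q⟩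
    simp only [P]
    rw [← Finset.mul_prod_erase _ _ hq, mul_assoc]
    refine (doubleAt_sq ?_).mul_right _
    rw [eval_dualForm, (hη i q hiq).2]
  have hm : ∀ i, ∃ m : Module.Dual k (Fin (n + 1) → k), m (Y.pt i) = c ⟨i, none⟩ ∧
      ∀ δ, m (Y.dir i δ) = c ⟨i, some δ⟩ - dirDeriv (Y.pt i) (Y.dir i δ) (P i) * c ⟨i, none⟩ := by
    intro i
    obtain ⟨m, hm⟩ := exists_dual_eq (Y.indep i) fun o => o.elim (c ⟨i, none⟩)
      fun δ => c ⟨i, some δ⟩ - dirDeriv (Y.pt i) (Y.dir i δ) (P i) * c ⟨i, none⟩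
    exact ⟨m, hm none, fun δ => hm (some δ)⟩
  choose m hm0 hm1 using hm
  refine ⟨∑ i, P i * dualForm (m i), IsHomogeneous.sum _ _ _ fun i _ => ?_, ?_⟩
  · have := (hPdeg i).mul (isHomogeneous_dualForm (m i))
    rwa [Nat.sub_add_cancel (by omega)] at this
  · rintro ⟨i, o⟩
    rw [map_sum, Finset.sum_eq_single i]
    · rcases o with _ | δ
      · rw [jet_none, map_mul, hP1, eval_dualForm, hm0, one_mul]
      · rw [jet_some, dirDeriv_mul, hP1, eval_dualForm, dirDeriv_dualForm, hm0, hm1]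
        ring
    · intro q _ hqi
      have := (hP0 q i hqi).mul_right (dualForm (m q))
      rcases o with _ | δ
      · rw [jet_none]; exact this.1
      · exact this.2 _
    · simp

/-- A large denominator gives a numerator of degree high enough for interpolation. -/
theorem exists_section [Fintype ι] [∀ i, Finite (D i)] (d : ℕ) {T : Finset (Fin (n + 1))}
    (hT : T.Nonempty) (c : (Σ i, Option (D i)) → k) :
    ∃ g ∈ sections ⊤ d T, ∀ j, (∀ t ∈ T, Y.pt j.1 t ≠ 0) → Y.laurentJet j g = c j := by
  classical
  set N := 2 * Fintype.card ι + 1 with hN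
  set M : MvPolynomial (Fin (n + 1)) k := (∏ t ∈ T, X t) ^ N with hM
  -- By the Leibniz rule, these are the jets of the numerator when the quotient by `M` has jets `c`.
  let c' : (Σ i, Option (D i)) → k := fun j =>
    eval (Y.pt j.1) M * c j + j.2.elim 0 fun δ =>
      dirDeriv (Y.pt j.1) (Y.dir j.1 δ) M * c ⟨j.1, none⟩
  obtain ⟨f, hf, hjet⟩ := Y.exists_form (d := d + N * T.card) (by
    have := Nat.mul_le_mul_left N hT.card_pos
    omega) c'
  let β : Fin (n + 1) → ℤ := fun i => if i ∈ T then (-N : ℤ) else 0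
  have hprod : toLaurent k n (∏ i ∈ T, X i) ^ N =
      AddMonoidAlgebra.single (fun i => if i ∈ T then (N : ℤ) else 0) 1 := by
    have : (∏ i ∈ T, X i : MvPolynomial (Fin (n + 1)) k) =
        monomial (∑ i ∈ T, Finsupp.single i 1) 1 := by
      rw [monomial_sum_one]
      rfl
    rw [this, toLaurent_monomial, AddMonoidAlgebra.single_pow, one_pow]
    congr 1
    ext i
    simp [Finsupp.single_apply]
  have he : toLaurent k n f = toLaurent k n (∏ t ∈ T, X t) ^ N *
      (AddMonoidAlgebra.single β 1 * toLaurent k n f) := by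
    rw [hprod, ← mul_assoc, AddMonoidAlgebra.single_mul_single, one_mul]
    have : (fun i => if i ∈ T then (N : ℤ) else 0) + β = 0 := by
      ext i
      by_cases hi : i ∈ T <;> simp [β, hi]
    rw [this, ← AddMonoidAlgebra.one_def, one_mul]
  set g := AddMonoidAlgebra.single β (1 : k) * toLaurent k n f
  refine ⟨g, ⟨N, f, trivial, hf, he⟩, ?_⟩
  have h0 : ∀ i, (∀ t ∈ T, Y.pt i t ≠ 0) → Y.laurentJet ⟨i, none⟩ g = c ⟨i, none⟩ ∧
      eval (Y.pt i) M ≠ 0 := by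
    intro i hi
    have hs : eval (Y.pt i) M ≠ 0 := by
      rw [hM, map_pow, map_prod]
      exact pow_ne_zero _ (Finset.prod_ne_zero_iff.2 fun t ht => by simpa using hi t ht)
    have h1 := (laurent_leibniz hi 0 N g).1
    rw [← he, laurentEval_toLaurent, ← jet_none, hjet] at h1
    simp only [c', Option.elim_none, add_zero] at h1
    exact ⟨(mul_left_cancel₀ hs h1).symm, hs⟩
  rintro ⟨i, _ | δ⟩ hi
  · exact (h0 i hi).1
  · have h1 := (laurent_leibniz hi (Y.dir i δ) N g).2
    rw [← he, laurentDeriv_toLaurent, ← jet_some, hjet, ← laurentJet_none, (h0 i hi).1] at h1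
    simp only [c', Option.elim_some] at h1
    exact (mul_left_cancel₀ (h0 i hi).2 (add_right_cancel h1)).symm

end JetScheme

end ProjSpace

namespace ProjSpace

/-! ### Čech cohomology of the twisted structure sheaf. -/

section Cech

open MvPolynomial

variable {k : Type*} [Field k] {n : ℕ}

theorem cechDiff_eq_zero {M : Type*} [AddCommGroup M] [Module k M] {b : Finset (Fin (n + 1)) → M}
    {T : Finset (Fin (n + 1))} (h : ∀ l ∈ T, b (T.erase l) = 0) : cechDiff k b T = 0 :=
  Finset.sum_eq_zero fun l hl => by rw [h l hl, smul_zero]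

theorem cechDiff_congr {M : Type*} [AddCommGroup M] [Module k M] {b b' : Finset (Fin (n + 1)) → M}
    {T : Finset (Fin (n + 1))} (h : ∀ l ∈ T, b (T.erase l) = b' (T.erase l)) :
    cechDiff k b T = cechDiff k b' T :=
  Finset.sum_congr rfl fun l hl => by rw [h l hl]

theorem cechDiff_sub {M : Type*} [AddCommGroup M] [Module k M] (b b' : Finset (Fin (n + 1)) → M)
    (T : Finset (Fin (n + 1))) : cechDiff k (fun S => b S - b' S) T =
      cechDiff k b T - cechDiff k b' T := by
  simp [cechDiff, smul_sub]

/-- The cone homotopy replaces the bookkeeping of signs: on `insert i S` the claim reduces to the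
vanishing of the square on the smaller set `S`, applied to `cone k i b`. -/
theorem cechDiff_cechDiff {M : Type*} [AddCommGroup M] [Module k M] (T : Finset (Fin (n + 1))) :
    ∀ b : Finset (Fin (n + 1)) → M, cechDiff k (cechDiff k b) T = 0 := by
  induction T using Finset.induction_on with
  | empty => intro b; simp [cechDiff]
  | insert i S hi ih =>
    intro b
    have h1 := cechDiff_cone_add (k := k) i (cechDiff k b) S
    have h2 : cone k i (cechDiff k b) = fun T => b T - cechDiff k (cone k i b) T := by
      ext T
      rw [← cechDiff_cone_add (k := k) i b T, add_sub_cancel_left]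
    rw [h2, cechDiff_sub, ih, sub_zero, add_eq_left, cone, if_neg hi] at h1
    exact (smul_eq_zero.1 h1).resolve_left (pow_ne_zero _ (by simp))

theorem mem_cochains {I : Ideal (MvPolynomial (Fin (n + 1)) k)} {d p : ℕ}
    {c : Finset (Fin (n + 1)) → Laurent k n} :
    c ∈ cochains I d p ↔ ∀ T, (T.card = p + 1 → c T ∈ sections I d T) ∧
      (T.card ≠ p + 1 → c T = 0) := by
  simp only [cochains, Submodule.mem_pi, Set.mem_univ, true_implies]
  refine forall_congr' fun T => ?_
  split_ifs with h <;> simp [h]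

theorem mem_cocycles {I : Ideal (MvPolynomial (Fin (n + 1)) k)} {d p : ℕ}
    {c : Finset (Fin (n + 1)) → Laurent k n} :
    c ∈ cocycles I d p ↔ c ∈ cochains I d p ∧ differential k n c = 0 := Iff.rfl

theorem differential_differential (b : Finset (Fin (n + 1)) → Laurent k n) :
    differential k n (differential k n b) = 0 := by
  ext1 T
  rw [differential_apply, show differential k n b = cechDiff k b from
    funext fun T => differential_apply b T, cechDiff_cechDiff]
  rfl

theorem sections_top_mono {d : ℕ} {S T : Finset (Fin (n + 1))} (h : S ⊆ T) :
    (sections ⊤ d S : Submodule k (Laurent k n)) ≤ sections ⊤ d T := by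
  intro g hg
  rw [mem_sections_top] at hg ⊢
  exact fun α hα => ⟨(hg α hα).1, fun i hi => (hg α hα).2 i fun hS => hi (h hS)⟩

theorem cochains_le_top (I : Ideal (MvPolynomial (Fin (n + 1)) k)) (d p : ℕ) :
    cochains I d p ≤ cochains ⊤ d p := by
  intro c hc
  rw [mem_cochains] at hc ⊢
  refine fun T => ⟨fun h => ?_, (hc T).2⟩
  obtain ⟨N, f, -, h'⟩ := (hc T).1 h
  exact ⟨N, f, trivial, h'⟩

theorem differential_mem_cochains_top {d p : ℕ} {b : Finset (Fin (n + 1)) → Laurent k n}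
    (hb : b ∈ cochains ⊤ d p) : differential k n b ∈ cochains ⊤ d (p + 1) := by
  rw [mem_cochains] at hb ⊢
  refine fun T => ⟨fun h => ?_, fun h => ?_⟩
  · rw [differential_apply]
    refine Submodule.sum_mem _ fun l hl => Submodule.smul_mem _ _
      (sections_top_mono (Finset.erase_subset l T) ((hb _).1 ?_))
    rw [Finset.card_erase_of_mem hl, h, Nat.add_sub_cancel]
  · rw [differential_apply]
    refine cechDiff_eq_zero fun l hl => (hb _).2 ?_
    have := Finset.card_erase_add_one hl
    omega

theorem differential_single (g : Laurent k n) (T : Finset (Fin (n + 1))) :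
    differential k n (Pi.single ∅ g) T = if T.card = 1 then g else 0 := by
  rw [differential_apply]
  split_ifs with h
  · obtain ⟨i, rfl⟩ := Finset.card_eq_one.1 h
    simp [cechDiff, Finset.filter_singleton]
  · refine cechDiff_eq_zero fun l hl => ?_
    have : T.erase l ≠ ∅ := by
      intro he
      have := Finset.card_erase_add_one hl
      rw [he] at this
      exact h this.symm
    rw [Pi.single_eq_of_ne this]

open Classical in
/-- A coordinate in which the exponent is nonnegative, if there is one. -/
noncomputable def nonnegIndex (α : Fin (n + 1) → ℤ) : Fin (n + 1) :=
  if h : ∃ i, 0 ≤ α i then h.choose else 0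

theorem nonnegIndex_spec {α : Fin (n + 1) → ℤ} (h : 0 ≤ ∑ i, α i) : 0 ≤ α (nonnegIndex α) := by
  have : ∃ i, 0 ≤ α i := by
    by_contra! H
    exact absurd (Finset.sum_neg (fun i _ => H i) Finset.univ_nonempty) h.not_gt
  rw [nonnegIndex, dif_pos this]
  exact this.choose_spec

/-- The part of a Laurent polynomial formed by the monomials with a given index. -/
noncomputable def laurentPart (i : Fin (n + 1)) : Laurent k n →ₗ[k] Laurent k n :=
  laurentLift fun α => if nonnegIndex α = i then AddMonoidAlgebra.single α 1 else 0

theorem sum_laurentPart (g : Laurent k n) : ∑ i, laurentPart i g = g := by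
  have : ∑ i, laurentPart i = (LinearMap.id : Laurent k n →ₗ[k] Laurent k n) := by
    refine laurent_hom_ext fun α c => ?_
    simp [laurentPart, LinearMap.sum_apply]
  have := LinearMap.congr_fun this g
  rwa [LinearMap.sum_apply] at this

theorem coeff_laurentPart (i : Fin (n + 1)) (g : Laurent k n) (α : Fin (n + 1) → ℤ) :
    (laurentPart i g).coeff α = if nonnegIndex α = i then g.coeff α else 0 := by
  induction g using AddMonoidAlgebra.induction_linear with
  | zero => simp
  | add f g hf hg =>
    rw [map_add, AddMonoidAlgebra.coeff_add, Finsupp.add_apply, hf, hg, AddMonoidAlgebra.coeff_add,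
      Finsupp.add_apply]
    split_ifs <;> simp
  | single β c =>
    rw [laurentPart, laurentLift_single]
    by_cases hβ : β = α
    · subst hβ
      split_ifs <;> simp
    · split_ifs <;> simp [hβ]

/-- The Čech complex of `𝓞(d)`, augmented by the forms of degree `d`, is exact. -/
theorem exists_primitive {d p : ℕ} {c : Finset (Fin (n + 1)) → Laurent k n}
    (hc : c ∈ cocycles ⊤ d p) : ∃ b : Finset (Fin (n + 1)) → Laurent k n,
      (∀ T, (T.card = p → b T ∈ sections ⊤ d T) ∧ (T.card ≠ p → b T = 0)) ∧
        differential k n b = c := by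
  obtain ⟨hc, hδ⟩ := mem_cocycles.1 hc
  rw [mem_cochains] at hc
  -- Every monomial is coned to a vertex `i` in which its exponent is nonnegative, so that it
  -- remains a section after `i` is removed from the index set. Such a vertex exists because the
  -- exponents add up to `d ≥ 0`.
  refine ⟨fun T => ∑ i, cone k i (fun S => laurentPart i (c S)) T, fun T => ⟨fun hT => ?_, fun hT => ?_⟩, ?_⟩
  · refine Submodule.sum_mem _ fun i _ => ?_
    rw [cone]
    split_ifs with hi
    · exact Submodule.zero_mem _
    · refine Submodule.smul_mem _ _ ?_
      have h := (hc (insert i T)).1 (by rw [Finset.card_insert_of_notMem hi, hT])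
      rw [mem_sections_top] at h ⊢
      intro α hα
      rw [coeff_laurentPart] at hα
      split_ifs at hα with hαi
      · obtain ⟨h1, h2⟩ := h α hα
        refine ⟨h1, fun j hj => ?_⟩
        by_cases hji : j = i
        · rw [hji, ← hαi]
          exact nonnegIndex_spec (by rw [h1]; positivity)
        · exact h2 j (by simp [hji, hj])
      · exact absurd rfl hα
  · refine Finset.sum_eq_zero fun i _ => ?_
    rw [cone]
    split_ifs with hi
    · rfl
    · rw [(hc (insert i T)).2 (by rw [Finset.card_insert_of_notMem hi]; omega), map_zero, smul_zero]
  · ext1 T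
    rw [differential_apply]
    have h1 : cechDiff k (fun T => ∑ i, cone k i (fun S => laurentPart i (c S)) T) T =
        ∑ i, cechDiff k (cone k i fun S => laurentPart i (c S)) T := by
      simp only [cechDiff, Finset.smul_sum]
      exact Finset.sum_comm
    have h2 : ∀ i, cechDiff k (cone k i fun S => laurentPart i (c S)) T = laurentPart i (c T) := by
      intro i
      have := cechDiff_cone_add (k := k) i (fun S => laurentPart i (c S)) T
      rw [← this, left_eq_add, cone]
      split_ifs
      · rfl
      · rw [← map_cechDiff, ← differential_apply, hδ]
        simp
    rw [h1]
    simp only [h2, sum_laurentPart]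

theorem exists_primitive_succ {d p : ℕ} {c : Finset (Fin (n + 1)) → Laurent k n}
    (hc : c ∈ cocycles ⊤ d (p + 1)) : ∃ b ∈ cochains ⊤ d p, differential k n b = c := by
  obtain ⟨b, hb, h⟩ := exists_primitive hc
  exact ⟨b, mem_cochains.2 hb, h⟩

theorem exists_primitive_zero {d : ℕ} {c : Finset (Fin (n + 1)) → Laurent k n}
    (hc : c ∈ cocycles ⊤ d 0) : ∃ f : MvPolynomial (Fin (n + 1)) k, f.IsHomogeneous d ∧
      differential k n (Pi.single ∅ (toLaurent k n f)) = c := by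
  obtain ⟨b, hb, h⟩ := exists_primitive hc
  obtain ⟨N, f, -, hf, he⟩ := (hb ∅).1 rfl
  refine ⟨f, by simpa using hf, ?_⟩
  rw [← h]
  congr 1
  ext1 T
  by_cases hT : T = ∅
  · subst hT
    simpa using he
  · rw [Pi.single_eq_of_ne hT, (hb T).2 (by simpa using hT)]

theorem toLaurent_injective [Infinite k] : Function.Injective (toLaurent k n) := by
  rw [injective_iff_map_eq_zero]
  intro f hf
  refine MvPolynomial.funext fun x => ?_
  rw [← laurentEval_toLaurent, hf, map_zero, map_zero]

theorem toLaurent_mem_sections_top {f : MvPolynomial (Fin (n + 1)) k} {d : ℕ}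
    (hf : f.IsHomogeneous d) (T : Finset (Fin (n + 1))) : toLaurent k n f ∈ sections ⊤ d T :=
  ⟨0, f, trivial, by simpa using hf, by simp⟩

end Cech

end ProjSpace

namespace ProjSpace

/-! ### Cohomology of the ideal sheaf of a finite scheme. -/

namespace JetScheme

open MvPolynomial

variable {k : Type*} [Field k] {n : ℕ} {ι : Type*} {D : ι → Type*} (Y : JetScheme k n ι D)

theorem exists_pt_ne_zero (i : ι) : ∃ t, Y.pt i t ≠ 0 := by
  have := (Y.indep i).ne_zero none
  exact Function.ne_iff.1 this

/-- A coordinate which does not vanish at the point `i`. -/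
noncomputable def chart (i : ι) : Fin (n + 1) := (Y.exists_pt_ne_zero i).choose

theorem pt_chart_ne_zero (i : ι) : Y.pt i (Y.chart i) ≠ 0 := (Y.exists_pt_ne_zero i).choose_spec

theorem mem_cochains_iff {d p : ℕ} {c : Finset (Fin (n + 1)) → Laurent k n} :
    c ∈ cochains Y.ideal d p ↔ c ∈ cochains ⊤ d p ∧
      ∀ T, T.card = p + 1 → ∀ j, (∀ t ∈ T, Y.pt j.1 t ≠ 0) → Y.laurentJet j (c T) = 0 := by
  constructor
  · intro h
    refine ⟨cochains_le_top _ _ _ h, fun T hT => ?_⟩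
    exact (Y.mem_sections_iff ((mem_cochains.1 (cochains_le_top _ _ _ h) T).1 hT)).1
      ((mem_cochains.1 h T).1 hT)
  · rintro ⟨h, h'⟩
    rw [mem_cochains] at h ⊢
    exact fun T => ⟨fun hT => (Y.mem_sections_iff ((h T).1 hT)).2 (h' T hT), (h T).2⟩

/-- The index sets whose coordinates do not vanish at a given point are the faces of a simplex, so
the Čech complex of jets at that point is contracted to the vertex `chart`. -/
theorem laurentJet_eq_of_differential_mem {d p : ℕ} {b : Finset (Fin (n + 1)) → Laurent k n}
    (h : differential k n b ∈ cochains Y.ideal d p) (j : Σ i, Option (D i))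
    {T : Finset (Fin (n + 1))} (hT : ∀ t ∈ T, Y.pt j.1 t ≠ 0) :
    Y.laurentJet j (b T) =
      cechDiff k (cone k (Y.chart j.1) fun S => Y.laurentJet j (b S)) T := by
  have := cechDiff_cone_add (k := k) (Y.chart j.1) (fun S => Y.laurentJet j (b S)) T
  rw [← this, add_eq_left, cone]
  split_ifs with hi
  · rfl
  · rw [← map_cechDiff, ← differential_apply]
    by_cases hc : (insert (Y.chart j.1) T).card = p + 1
    · rw [((Y.mem_cochains_iff.1 h).2 _ hc j fun t ht => ?_), smul_zero]
      rcases Finset.mem_insert.1 ht with rfl | ht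
      · exact Y.pt_chart_ne_zero _
      · exact hT t ht
    · rw [(mem_cochains.1 h _).2 hc, map_zero, smul_zero]

/-- There are cochains with arbitrary jets. -/
theorem exists_cochain [Fintype ι] [∀ i, Finite (D i)] (d p : ℕ)
    (e : (Σ i, Option (D i)) → Finset (Fin (n + 1)) → k) :
    ∃ b ∈ cochains ⊤ d p, ∀ T, T.card = p + 1 → ∀ j, (∀ t ∈ T, Y.pt j.1 t ≠ 0) →
      Y.laurentJet j (b T) = e j T := by
  have : ∀ T : Finset (Fin (n + 1)), ∃ g, T.card = p + 1 → g ∈ sections ⊤ d T ∧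
      ∀ j, (∀ t ∈ T, Y.pt j.1 t ≠ 0) → Y.laurentJet j g = e j T := by
    intro T
    by_cases hT : T.card = p + 1
    · obtain ⟨g, hg, h⟩ := Y.exists_section d (T := T) (Finset.card_pos.1 (by omega)) fun j => e j T
      exact ⟨g, fun _ => ⟨hg, h⟩⟩
    · exact ⟨0, fun h => absurd h hT⟩
  choose g hg using this
  refine ⟨fun T => if T.card = p + 1 then g T else 0, mem_cochains.2 fun T => ⟨fun h => ?_, fun h => ?_⟩,
    fun T hT => ?_⟩
  · rw [if_pos h]; exact (hg T h).1
  · rw [if_neg h]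
  · simpa only [if_pos hT] using (hg T hT).2

/-- A cocycle is `δ b` for a cochain `b` of the structure sheaf. The jets of `b` are the coboundary
of their cone, which is realised by the jets of a cochain `b'`; then `b - δ b'` lies in the ideal
sheaf and has the same differential. -/
theorem cocycles_le_coboundaries [Fintype ι] [∀ i, Finite (D i)] (d p : ℕ) :
    cocycles Y.ideal d (p + 2) ≤ coboundaries Y.ideal d (p + 2) := by
  rintro c ⟨hc, hδ⟩
  obtain ⟨b, hb, rfl⟩ := exists_primitive_succ
    (mem_cocycles.2 ⟨cochains_le_top _ _ _ hc, hδ⟩ : c ∈ cocycles ⊤ d (p + 1 + 1))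
  obtain ⟨b', hb', hjet⟩ := Y.exists_cochain d p fun j =>
    cone k (Y.chart j.1) fun S => Y.laurentJet j (b S)
  refine ⟨b - differential k n b', Y.mem_cochains_iff.2 ⟨Submodule.sub_mem _ hb
    (differential_mem_cochains_top hb'), fun T hT j hj => ?_⟩, ?_⟩
  · rw [Pi.sub_apply, map_sub, differential_apply, map_cechDiff,
      Y.laurentJet_eq_of_differential_mem hc j hj, sub_eq_zero]
    refine cechDiff_congr fun l hl => (hjet _ ?_ j fun t ht => hj t (Finset.mem_of_mem_erase ht)).symm
    rw [Finset.card_erase_of_mem hl, hT, Nat.add_sub_cancel]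
  · rw [map_sub, differential_differential, sub_zero]

instance subsingleton_cohomology [Fintype ι] [∀ i, Finite (D i)] (d p : ℕ) :
    Subsingleton (Cohomology Y.ideal d (p + 2)) := by
  rw [Submodule.Quotient.subsingleton_iff, Submodule.submoduleOf_eq_top]
  exact Y.cocycles_le_coboundaries d p

/-- The map from forms to jets. -/
noncomputable def jetMap (d : ℕ) :
    homogeneousSubmodule (Fin (n + 1)) k d →ₗ[k] ((Σ i, Option (D i)) → k) :=
  LinearMap.pi fun j => Y.jet j ∘ₗ Submodule.subtype _

theorem jetMap_apply {d : ℕ} (f : homogeneousSubmodule (Fin (n + 1)) k d) (j : Σ i, Option (D i)) :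
    Y.jetMap d f j = Y.jet j f.1 := rfl

/-- The constant cochain defined by a form. -/
noncomputable def constCochain : MvPolynomial (Fin (n + 1)) k →ₗ[k]
    (Finset (Fin (n + 1)) → Laurent k n) :=
  differential k n ∘ₗ LinearMap.single k (fun _ => Laurent k n) ∅ ∘ₗ (toLaurent k n).toLinearMap

theorem constCochain_apply (f : MvPolynomial (Fin (n + 1)) k) (T : Finset (Fin (n + 1))) :
    constCochain f T = if T.card = 1 then toLaurent k n f else 0 :=
  differential_single _ _

theorem differential_constCochain (f : MvPolynomial (Fin (n + 1)) k) :
    differential k n (constCochain f) = 0 :=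
  differential_differential _

theorem constCochain_mem {f : MvPolynomial (Fin (n + 1)) k} {d : ℕ} (hf : f.IsHomogeneous d) :
    constCochain f ∈ cochains ⊤ d 0 := by
  rw [mem_cochains]
  refine fun T => ⟨fun h => ?_, fun h => ?_⟩
  · rw [constCochain_apply, if_pos (by simpa using h)]
    exact toLaurent_mem_sections_top hf T
  · rw [constCochain_apply, if_neg (by simpa using h)]

theorem exists_constCochain_eq {d : ℕ} {c : Finset (Fin (n + 1)) → Laurent k n}
    (hc : c ∈ cocycles ⊤ d 0) : ∃ f : homogeneousSubmodule (Fin (n + 1)) k d,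
      constCochain f.1 = c := by
  obtain ⟨f, hf, h⟩ := exists_primitive_zero hc
  exact ⟨⟨f, hf⟩, h⟩

theorem constCochain_mem_ideal {d : ℕ} (f : homogeneousSubmodule (Fin (n + 1)) k d) :
    constCochain f.1 ∈ cochains Y.ideal d 0 ↔ f ∈ LinearMap.ker (Y.jetMap d) := by
  rw [Y.mem_cochains_iff, LinearMap.mem_ker]
  constructor
  · rintro ⟨-, h⟩
    ext j
    have := h {Y.chart j.1} (Finset.card_singleton _) j (by simpa using Y.pt_chart_ne_zero j.1)
    rwa [constCochain_apply, if_pos (Finset.card_singleton _), laurentJet_toLaurent] at this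
  · intro h
    refine ⟨constCochain_mem f.2, fun T hT j _ => ?_⟩
    rw [constCochain_apply, if_pos (by simpa using hT), laurentJet_toLaurent]
    exact congr_fun h j

/-- The global sections of the ideal sheaf are the forms with vanishing jets. -/
noncomputable def cohomologyZeroEquiv [Infinite k] (d : ℕ) :
    LinearMap.ker (Y.jetMap d) ≃ₗ[k] Cohomology Y.ideal d 0 :=
  (LinearEquiv.ofBijective
    ((constCochain ∘ₗ Submodule.subtype _ ∘ₗ Submodule.subtype _).codRestrict (cocycles Y.ideal d 0)
      fun f => ⟨(Y.constCochain_mem_ideal f.1).2 f.2, differential_constCochain _⟩) (by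
    constructor
    · refine (injective_iff_map_eq_zero _).2 fun f hf => ?_
      have h1 := congr_fun (congr_arg Subtype.val hf) {0}
      change constCochain f.1.1 {0} = 0 at h1
      rw [constCochain_apply, if_pos (Finset.card_singleton _)] at h1
      exact Subtype.ext (Subtype.ext (toLaurent_injective (h1.trans (map_zero _).symm)))
    · rintro ⟨c, hc, hδ⟩
      obtain ⟨f, hf⟩ := exists_constCochain_eq (mem_cocycles.2 ⟨cochains_le_top _ _ _ hc, hδ⟩)
      exact ⟨⟨f, (Y.constCochain_mem_ideal f).1 (hf ▸ hc)⟩, Subtype.ext hf⟩)) ≪≫ₗ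
  (Submodule.quotEquivOfEqBot _ (by
    rw [coboundaries, Submodule.submoduleOf, Submodule.comap_bot, Submodule.ker_subtype])).symm

/-- The cochains of the structure sheaf whose differential is a cochain of the ideal sheaf, that
is, which come from a cocycle of the structure sheaf of the subscheme. -/
noncomputable def relativeCochains (d : ℕ) : Submodule k (Finset (Fin (n + 1)) → Laurent k n) :=
  cochains ⊤ d 0 ⊓ (cochains Y.ideal d 1).comap (differential k n)

/-- The jets of a section of the structure sheaf of the subscheme. -/
noncomputable def relativeJet (d : ℕ) :
    Y.relativeCochains d →ₗ[k] ((Σ i, Option (D i)) → k) :=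
  LinearMap.pi fun j => Y.laurentJet j ∘ₗ LinearMap.proj {Y.chart j.1} ∘ₗ Submodule.subtype _

theorem relativeJet_apply {d : ℕ} (b : Y.relativeCochains d) (j : Σ i, Option (D i)) :
    Y.relativeJet d b j = Y.laurentJet j (b.1 {Y.chart j.1}) := rfl

theorem laurentJet_eq_relativeJet {d : ℕ} (b : Y.relativeCochains d) (j : Σ i, Option (D i))
    {T : Finset (Fin (n + 1))} (hT : T.card = 1) (hj : ∀ t ∈ T, Y.pt j.1 t ≠ 0) :
    Y.laurentJet j (b.1 T) = Y.relativeJet d b j := by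
  obtain ⟨t, rfl⟩ := Finset.card_eq_one.1 hT
  rw [Y.laurentJet_eq_of_differential_mem b.2.2 j hj]
  simp [cechDiff, cone, relativeJet_apply, Finset.filter_singleton]

theorem relativeJet_surjective [Fintype ι] [∀ i, Finite (D i)] (d : ℕ) :
    Function.Surjective (Y.relativeJet d) := by
  intro c
  obtain ⟨b, hb, hjet⟩ := Y.exists_cochain d 0 fun j _ => c j
  refine ⟨⟨b, hb, Y.mem_cochains_iff.2 ⟨differential_mem_cochains_top hb, fun T hT j hj => ?_⟩⟩, ?_⟩
  · rw [differential_apply, map_cechDiff]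
    -- A constant cochain is the differential of its value placed on the empty set, so its
    -- differential vanishes.
    have : cechDiff k (fun S => Y.laurentJet j (b S)) T =
        cechDiff k (cechDiff k fun S => if S = ∅ then c j else 0) T := by
      refine cechDiff_congr fun l hl => ?_
      have hcard : (T.erase l).card = 1 := by
        rw [Finset.card_erase_of_mem hl, hT]
      rw [hjet _ hcard j fun t ht => hj t (Finset.mem_of_mem_erase ht)]
      obtain ⟨t, ht⟩ := Finset.card_eq_one.1 hcard
      rw [ht]
      simp [cechDiff, Finset.filter_singleton]
    rw [this, cechDiff_cechDiff]
  · ext j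
    rw [relativeJet_apply]
    exact hjet _ (Finset.card_singleton _) j (by simpa using Y.pt_chart_ne_zero j.1)

/-- The connecting map to the first cohomology of the ideal sheaf. -/
noncomputable def connecting (d : ℕ) : Y.relativeCochains d →ₗ[k] Cohomology Y.ideal d 1 :=
  Submodule.mkQ _ ∘ₗ (differential k n ∘ₗ Submodule.subtype _).codRestrict (cocycles Y.ideal d 1)
    fun b => ⟨b.2.2, differential_differential _⟩

theorem connecting_surjective (d : ℕ) : Function.Surjective (Y.connecting d) := by
  refine (Submodule.mkQ_surjective _).comp ?_
  rintro ⟨c, hc, hδ⟩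
  obtain ⟨b, hb, rfl⟩ := exists_primitive_succ
    (mem_cocycles.2 ⟨cochains_le_top _ _ _ hc, hδ⟩ : c ∈ cocycles ⊤ d (0 + 1))
  exact ⟨⟨b, hb, hc⟩, rfl⟩

/-- A relative cochain becomes a coboundary exactly when it differs from a cochain of the ideal
sheaf by a global form, that is, when its jets are those of a form. -/
theorem ker_connecting (d : ℕ) : LinearMap.ker (Y.connecting d) =
    LinearMap.ker ((LinearMap.range (Y.jetMap d)).mkQ ∘ₗ Y.relativeJet d) := by
  ext b
  have h1 : b ∈ LinearMap.ker (Y.connecting d) ↔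
      ∃ b' ∈ cochains Y.ideal d 0, differential k n b' = differential k n b.1 := by
    rw [LinearMap.mem_ker, connecting, LinearMap.comp_apply, Submodule.mkQ_apply,
      Submodule.Quotient.mk_eq_zero]
    rfl
  have h2 : b ∈ LinearMap.ker ((LinearMap.range (Y.jetMap d)).mkQ ∘ₗ Y.relativeJet d) ↔
      ∃ f, Y.jetMap d f = Y.relativeJet d b := by
    rw [LinearMap.mem_ker, LinearMap.comp_apply, Submodule.mkQ_apply,
      Submodule.Quotient.mk_eq_zero]
    rfl
  rw [h1, h2]
  constructor
  · rintro ⟨b', hb', he⟩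
    obtain ⟨f, hf⟩ := exists_constCochain_eq (d := d) (c := b.1 - b') (mem_cocycles.2
      ⟨Submodule.sub_mem _ b.2.1 (cochains_le_top _ _ _ hb'), by rw [map_sub, he, sub_self]⟩)
    refine ⟨f, ?_⟩
    ext j
    have h3 := (Y.mem_cochains_iff.1 hb').2 {Y.chart j.1} (Finset.card_singleton _) j
      (by simpa using Y.pt_chart_ne_zero j.1)
    have h4 := congr_arg (Y.laurentJet j) (congr_fun hf {Y.chart j.1})
    rw [constCochain_apply, if_pos (Finset.card_singleton _), laurentJet_toLaurent, Pi.sub_apply,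
      map_sub, h3, sub_zero] at h4
    exact h4
  · rintro ⟨f, hf⟩
    refine ⟨b.1 - constCochain f.1, Y.mem_cochains_iff.2 ⟨Submodule.sub_mem _ b.2.1
      (constCochain_mem f.2), fun T hT j hj => ?_⟩, by
        rw [map_sub, differential_constCochain, sub_zero]⟩
    rw [Pi.sub_apply, map_sub, constCochain_apply, if_pos (by simpa using hT), laurentJet_toLaurent,
      Y.laurentJet_eq_relativeJet b j (by simpa using hT) hj, ← hf, jetMap_apply, sub_self]

/-- The first cohomology of the ideal sheaf is the cokernel of the map from forms to jets. -/
noncomputable def cohomologyOneEquiv [Fintype ι] [∀ i, Finite (D i)] (d : ℕ) :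
    Cohomology Y.ideal d 1 ≃ₗ[k] ((Σ i, Option (D i)) → k) ⧸ LinearMap.range (Y.jetMap d) :=
  ((Y.connecting d).quotKerEquivOfSurjective (Y.connecting_surjective d)).symm ≪≫ₗ
    Submodule.quotEquivOfEq _ _ (Y.ker_connecting d) ≪≫ₗ
    ((LinearMap.range (Y.jetMap d)).mkQ ∘ₗ Y.relativeJet d).quotKerEquivOfSurjective
      ((Submodule.mkQ_surjective _).comp (Y.relativeJet_surjective d))

/-- Only degrees zero and one contribute, and kernel minus cokernel of the jet map is source minus
target. For `n ≥ 1` both degrees occur in the sum. -/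
theorem eulerChar_eq [Infinite k] [Fintype ι] [∀ i, Fintype (D i)] (hn : 1 ≤ n) (d : ℕ) :
    eulerChar Y.ideal d = (n + d).choose d - (∑ i, (Fintype.card (D i) + 1) : ℕ) := by
  obtain ⟨n, rfl⟩ := Nat.exists_eq_add_of_le' hn
  rw [eulerChar, Finset.sum_range_succ', Finset.sum_range_succ',
    Finset.sum_eq_zero fun p _ => by
      have := Y.subsingleton_cohomology d p
      rw [show p + 1 + 1 = p + 2 from rfl, Module.finrank_zero_of_subsingleton]
      simp]
  rw [← (Y.cohomologyZeroEquiv d).finrank_eq, zero_add 1, (Y.cohomologyOneEquiv d).finrank_eq]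
  have h1 := (Y.jetMap d).finrank_range_add_finrank_ker
  have h2 := Submodule.finrank_quotient_add_finrank (LinearMap.range (Y.jetMap d))
  rw [finrank_homogeneousSubmodule, Fintype.card_fin, show n + 1 + 1 + d - 1 = n + 1 + d by omega] at h1
  rw [Module.finrank_fintype_fun_eq_card, Fintype.card_sigma] at h2
  simp only [Fintype.card_option] at h2
  rw [← h1, ← h2]
  push_cast
  ring

/-- Between spaces of equal dimension the jet map is bijective once it is injective, which kills
both remaining cohomology groups. -/
theorem adjusted [Infinite k] [Fintype ι] [∀ i, Fintype (D i)] {d : ℕ}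
    (hcard : ∑ i, (Fintype.card (D i) + 1) = (n + d).choose d)
    (h : ∀ f : MvPolynomial (Fin (n + 1)) k, f.IsHomogeneous d → f ∈ Y.ideal → f = 0) :
    Adjusted Y.ideal d := by
  have hker : LinearMap.ker (Y.jetMap d) = ⊥ := by
    rw [LinearMap.ker_eq_bot']
    exact fun f hf => Subtype.ext (h f.1 f.2 ((Y.mem_ideal_iff f.2).2 (congr_fun hf)))
  have hrange : LinearMap.range (Y.jetMap d) = ⊤ := by
    have h1 := (Y.jetMap d).finrank_range_add_finrank_ker
    rw [hker, finrank_bot, add_zero, finrank_homogeneousSubmodule, Fintype.card_fin,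
      show n + 1 + d - 1 = n + d by omega, ← hcard] at h1
    refine Submodule.eq_top_of_finrank_eq (h1.trans ?_)
    rw [Module.finrank_fintype_fun_eq_card, Fintype.card_sigma]
    simp only [Fintype.card_option]
  rintro (_ | _ | p)
  · have : Subsingleton (LinearMap.ker (Y.jetMap d)) := by rw [hker]; infer_instance
    exact (Y.cohomologyZeroEquiv d).symm.toEquiv.subsingleton
  · have : Subsingleton (((Σ i, Option (D i)) → k) ⧸ LinearMap.range (Y.jetMap d)) := by
      rw [hrange]; infer_instance
    exact (Y.cohomologyOneEquiv d).toEquiv.subsingleton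
  · exact Y.subsingleton_cohomology d p

end JetScheme

end ProjSpace

namespace ProjSpace

/-! ### The ideals of the components in terms of jets. -/

section Ideals

open MvPolynomial

variable {k : Type*} [Field k] {n : ℕ}

theorem aeval_mul_of_isHomogeneous {σ A : Type*} [Fintype σ] [CommRing A] [Algebra k A]
    {f : MvPolynomial σ k} {d : ℕ} (hf : f.IsHomogeneous d) (x : σ → k) (t : A) :
    aeval (fun i => x i • t) f = eval x f • t ^ d := by
  rw [aeval_def, eval₂_eq', eval_eq', Finset.sum_smul]
  refine Finset.sum_congr rfl fun e he => ?_
  have hdeg : d = ∑ i, e i := by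
    rw [← Finsupp.degree_eq_sum]
    exact hf.degree_eq_sum_deg_support he
  simp only [smul_pow]
  rw [Finset.prod_smul, Finset.prod_pow_eq_pow_sum, ← hdeg, ← Algebra.smul_def, smul_smul]

/-- Taylor's formula up to order two. -/
theorem aeval_add_of_mul_eq_zero {σ A : Type*} [Fintype σ] [CommRing A] [Algebra k A]
    (x y : σ → A) (hy : ∀ i j, y i * y j = 0) (f : MvPolynomial σ k) :
    aeval (fun i => x i + y i) f = aeval x f + ∑ i, aeval x (pderiv i f) * y i := by
  classical
  induction f using MvPolynomial.induction_on with
  | C a => simp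
  | add p q hp hq =>
    simp only [map_add, hp, hq, add_mul, Finset.sum_add_distrib]
    ring
  | mul_X p j hp =>
    have h1 : ∀ i, aeval x (pderiv i (p * X j)) * y i =
        x j * (aeval x (pderiv i p) * y i) + if i = j then aeval x p * y j else 0 := by
      intro i
      by_cases hij : i = j
      · subst hij
        simp [Derivation.leibniz]
        ring
      · rw [if_neg hij, add_zero, Derivation.leibniz, pderiv_X_of_ne (Ne.symm hij)]
        simp
        ring
    have h2 : (∑ i, aeval x (pderiv i p) * y i) * y j = 0 := by
      rw [Finset.sum_mul]
      exact Finset.sum_eq_zero fun i _ => by rw [mul_assoc, hy, mul_zero]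
    rw [map_mul, hp, aeval_X, map_mul, aeval_X]
    simp only [h1, Finset.sum_add_distrib, ← Finset.mul_sum, Finset.sum_ite_eq', Finset.mem_univ,
      if_true]
    linear_combination h2

/-- Taylor's formula for a form, modulo an ideal. -/
theorem mem_of_taylor {I : Ideal (MvPolynomial (Fin (n + 1)) k)} {f : MvPolynomial (Fin (n + 1)) k}
    {d : ℕ} (hf : f.IsHomogeneous d) {x : Fin (n + 1) → k} (h0 : eval x f = 0)
    {t : MvPolynomial (Fin (n + 1)) k} {y : Fin (n + 1) → MvPolynomial (Fin (n + 1)) k}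
    (hX : ∀ i, X i - (x i • t + y i) ∈ I) (hy : ∀ i j, y i * y j ∈ I)
    (h1 : ∑ i, eval x (pderiv i f) • y i ∈ I) : f ∈ I := by
  rw [← Ideal.Quotient.eq_zero_iff_mem]
  have e1 : Ideal.Quotient.mk I f = aeval (fun i => x i • Ideal.Quotient.mk I t +
      Ideal.Quotient.mk I (y i)) f := by
    have : (fun i => x i • Ideal.Quotient.mk I t + Ideal.Quotient.mk I (y i)) =
        fun i => Ideal.Quotient.mkₐ k I (X i) := by
      ext i
      rw [Ideal.Quotient.mkₐ_eq_mk, Ideal.Quotient.eq.2 (hX i), map_add]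
      rfl
    rw [this, ← comp_aeval_apply, aeval_X_left]
    rfl
  rw [e1, aeval_add_of_mul_eq_zero _ _ fun i j => by
    rw [← map_mul, Ideal.Quotient.eq_zero_iff_mem]; exact hy i j]
  rw [aeval_mul_of_isHomogeneous hf, h0, zero_smul, zero_add]
  have e2 : ∀ i, aeval (fun i => x i • Ideal.Quotient.mk I t) (pderiv i f) * Ideal.Quotient.mk I (y i) =
      Ideal.Quotient.mk I t ^ (d - 1) * Ideal.Quotient.mk I (eval x (pderiv i f) • y i) := by
    intro i
    rw [aeval_mul_of_isHomogeneous hf.pderiv, smul_mul_assoc, ← mul_smul_comm]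
    rfl
  simp only [e2, ← Finset.mul_sum, ← map_sum]
  rw [Ideal.Quotient.eq_zero_iff_mem.2 h1, mul_zero]

theorem dualForm_mem_linearIdeal {W : Submodule k (Fin (n + 1) → k)}
    {η : Module.Dual k (Fin (n + 1) → k)} (h : ∀ w ∈ W, η w = 0) : dualForm η ∈ linearIdeal W :=
  Ideal.subset_span ⟨fun i => η (Pi.single i 1), fun w hw => by
    rw [← dual_apply_eq_sum]; exact h w hw, rfl⟩

theorem linearIdeal_le {W : Submodule k (Fin (n + 1) → k)}
    {I : Ideal (MvPolynomial (Fin (n + 1)) k)}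
    (h : ∀ η : Module.Dual k (Fin (n + 1) → k), (∀ w ∈ W, η w = 0) → dualForm η ∈ I) :
    linearIdeal W ≤ I := by
  refine Ideal.span_le.2 ?_
  rintro _ ⟨c, hc, rfl⟩
  let η : Module.Dual k (Fin (n + 1) → k) := ∑ i, c i • LinearMap.proj i
  have hη : ∀ w, η w = ∑ i, c i * w i := fun w => by simp [η, LinearMap.sum_apply]
  have := h η fun w hw => by rw [hη, hc w hw]
  have he : ∑ i, C (c i) * X i = dualForm η :=
    Finset.sum_congr rfl fun i _ => by rw [hη]; simp [Pi.single_apply]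
  rw [he]
  exact this

theorem X_eq_dualForm (i : Fin (n + 1)) :
    (X i : MvPolynomial (Fin (n + 1)) k) = dualForm (LinearMap.proj i) := by
  simp [dualForm, Pi.single_apply]

theorem smul_dualForm (c : k) (η : Module.Dual k (Fin (n + 1) → k)) :
    c • dualForm η = dualForm (c • η) := by
  simp [dualForm, Finset.smul_sum, smul_eq_C_mul, mul_assoc]

theorem dualForm_sub (η η' : Module.Dual k (Fin (n + 1) → k)) :
    dualForm η - dualForm η' = dualForm (η - η') := by
  simp [dualForm, sub_mul, Finset.sum_sub_distrib]

theorem exists_dual_eq_one {x : Fin (n + 1) → k} (hx : x ≠ 0) :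
    ∃ η : Module.Dual k (Fin (n + 1) → k), η x = 1 := by
  obtain ⟨η, hη⟩ : ∃ η : Module.Dual k (Fin (n + 1) → k), η x ≠ 0 := by
    by_contra! h
    exact hx ((Module.forall_dual_apply_eq_zero_iff k x).1 h)
  exact ⟨(η x)⁻¹ • η, by simp [hη]⟩

theorem eval_eq_zero_of_mem_pointIdeal {x : Fin (n + 1) → k} {f : MvPolynomial (Fin (n + 1)) k}
    (h : f ∈ pointIdeal x) : eval x f = 0 := by
  have : pointIdeal x ≤ RingHom.ker (eval x) := linearIdeal_le fun η hη => by
    rw [RingHom.mem_ker, eval_dualForm]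
    exact hη x (Submodule.mem_span_singleton_self x)
  exact this h

theorem X_sub_mem_pointIdeal {x : Fin (n + 1) → k} {η : Module.Dual k (Fin (n + 1) → k)}
    (hη : η x = 1) (i : Fin (n + 1)) : X i - x i • dualForm η ∈ pointIdeal x := by
  rw [X_eq_dualForm, smul_dualForm, dualForm_sub]
  refine dualForm_mem_linearIdeal fun w hw => ?_
  obtain ⟨c, rfl⟩ := Submodule.mem_span_singleton.1 hw
  simp [hη]

theorem mem_pointIdeal_iff {x : Fin (n + 1) → k} (hx : x ≠ 0) {f : MvPolynomial (Fin (n + 1)) k}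
    {d : ℕ} (hf : f.IsHomogeneous d) : f ∈ pointIdeal x ↔ eval x f = 0 := by
  refine ⟨eval_eq_zero_of_mem_pointIdeal, fun h => ?_⟩
  obtain ⟨η, hη⟩ := exists_dual_eq_one hx
  refine mem_of_taylor hf h (t := dualForm η) (y := 0) (fun i => ?_) (by simp) (by simp)
  simpa using X_sub_mem_pointIdeal hη i

theorem doubleAt_of_mem {x : Fin (n + 1) → k} {f : MvPolynomial (Fin (n + 1)) k}
    (h : f ∈ doublePointIdeal x) : DoubleAt x f := by
  rw [doublePointIdeal, pow_two] at h
  induction h using Submodule.mul_induction_on' with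
  | mem_mul_mem a ha b hb =>
    have ha' := eval_eq_zero_of_mem_pointIdeal ha
    have hb' := eval_eq_zero_of_mem_pointIdeal hb
    exact ⟨by rw [map_mul, ha', zero_mul], fun w => by rw [dirDeriv_mul, ha', hb']; ring⟩
  | add a _ b _ ha hb => exact (doubleSubmodule x).add_mem ha hb

theorem mem_doublePointIdeal_iff {x : Fin (n + 1) → k} (hx : x ≠ 0)
    {f : MvPolynomial (Fin (n + 1)) k} {d : ℕ} (hf : f.IsHomogeneous d) :
    f ∈ doublePointIdeal x ↔ DoubleAt x f := by
  refine ⟨doubleAt_of_mem, fun h => ?_⟩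
  obtain ⟨η, hη⟩ := exists_dual_eq_one hx
  refine mem_of_taylor hf h.1 (t := dualForm η) (y := fun i => X i - x i • dualForm η)
    (fun i => by simp) (fun i j => ?_) ?_
  · rw [doublePointIdeal, pow_two]
    exact Ideal.mul_mem_mul (X_sub_mem_pointIdeal hη i) (X_sub_mem_pointIdeal hη j)
  · convert Ideal.zero_mem _ using 1
    refine Finset.sum_eq_zero fun i _ => ?_
    rw [(doubleAt_iff.1 h).2 i, zero_smul]

theorem mem_tangentIdeal_iff {x y : Fin (n + 1) → k} (hxy : LinearIndependent k ![x, y])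
    {f : MvPolynomial (Fin (n + 1)) k} {d : ℕ} (hf : f.IsHomogeneous d) :
    f ∈ tangentIdeal x y ↔ eval x f = 0 ∧ dirDeriv x y f = 0 := by
  constructor
  · let I : Ideal (MvPolynomial (Fin (n + 1)) k) :=
      { carrier := {f | eval x f = 0 ∧ dirDeriv x y f = 0}
        zero_mem' := by simp
        add_mem' := fun {a b} ha hb => ⟨by rw [map_add, ha.1, hb.1, add_zero],
          by rw [map_add, ha.2, hb.2, add_zero]⟩
        smul_mem' := fun c a ha => ⟨by rw [smul_eq_mul, map_mul, ha.1, mul_zero],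
          by rw [smul_eq_mul, dirDeriv_mul, ha.1, ha.2]; ring⟩ }
    have : tangentIdeal x y ≤ I := by
      refine sup_le (linearIdeal_le fun η hη => ⟨?_, ?_⟩) fun f hf => ?_
      · rw [eval_dualForm]
        exact hη x (Submodule.subset_span (by simp))
      · rw [dirDeriv_dualForm]
        exact hη y (Submodule.subset_span (by simp))
      · have := doubleAt_of_mem hf
        exact ⟨this.1, this.2 y⟩
    exact fun h => this h
  · rintro ⟨h0, h1⟩
    obtain ⟨η, hη⟩ := exists_dual_eq hxy ![1, 0]
    obtain ⟨η', hη'⟩ := exists_dual_eq hxy ![0, 1]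
    have e1 : η x = 1 := hη 0
    have e2 : η y = 0 := hη 1
    have e3 : η' x = 0 := hη' 0
    have e4 : η' y = 1 := hη' 1
    -- With `η`, `η'` dual to `x`, `y`, each variable is `x i • η + y i • η'` on the line, and the
    -- square of `η'` lies in the ideal of the double point.
    refine mem_of_taylor hf h0 (t := dualForm η) (y := fun i => y i • dualForm η') (fun i => ?_)
      (fun i j => ?_) ?_
    · refine Ideal.mem_sup_left ?_
      rw [X_eq_dualForm, smul_dualForm, smul_dualForm, ← sub_sub, dualForm_sub, dualForm_sub]
      refine dualForm_mem_linearIdeal fun w hw => ?_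
      obtain ⟨c, c', rfl⟩ := Submodule.mem_span_pair.1 hw
      simp [e1, e2, e3, e4]
      ring
    · refine Ideal.mem_sup_right ?_
      have hmem : dualForm η' ∈ pointIdeal x := dualForm_mem_linearIdeal fun w hw => by
        obtain ⟨c, rfl⟩ := Submodule.mem_span_singleton.1 hw
        simp [e3]
      rw [doublePointIdeal, pow_two]
      exact Ideal.mul_mem_mul (Submodule.smul_of_tower_mem _ _ hmem)
        (Submodule.smul_of_tower_mem _ _ hmem)
    · simp only [smul_smul, ← Finset.sum_smul]
      have : ∑ i, eval x (pderiv i f) * y i = dirDeriv x y f := by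
        rw [dirDeriv_apply]
        exact Finset.sum_congr rfl fun i _ => mul_comm _ _
      rw [this, h1, zero_smul]
      exact Ideal.zero_mem _

/-- The hypothesis contains both nondegeneracies: `x`, `y` are independent and `κ` is not zero on
their span. -/
theorem span_pair_inf_ker {x y : Fin (n + 1) → k} {κ : Module.Dual k (Fin (n + 1) → k)}
    (h : meet κ x y ≠ 0) :
    Submodule.span k {x, y} ⊓ LinearMap.ker κ = Submodule.span k {meet κ x y} := by
  have hm : meet κ x y = κ y • x - κ x • y := rfl
  refine le_antisymm ?_ ?_
  · rintro z ⟨hz, hκ⟩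
    obtain ⟨s, t, rfl⟩ := Submodule.mem_span_pair.1 hz
    rw [SetLike.mem_coe, LinearMap.mem_ker, map_add, map_smul, map_smul, smul_eq_mul,
      smul_eq_mul] at hκ
    rw [Submodule.mem_span_singleton, hm]
    by_cases hy : κ y = 0
    · have hx : κ x ≠ 0 := by
        intro hx
        rw [hm, hx, hy] at h
        simp at h
      have hs : s = 0 := by simpa [hy, hx] using hκ
      refine ⟨-(t / κ x), ?_⟩
      rw [hy, hs]
      simp [smul_smul, hx]
    · refine ⟨s / κ y, ?_⟩
      have ht : t = -(s / κ y * κ x) := by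
        field_simp
        linear_combination hκ
      rw [ht, smul_sub, smul_smul, smul_smul, div_mul_cancel₀ _ hy, neg_smul, sub_eq_add_neg]
  · rw [Submodule.span_singleton_le_iff_mem, hm]
    refine ⟨Submodule.mem_span_pair.2 ⟨κ y, -κ x, by rw [neg_smul, sub_eq_add_neg]⟩, ?_⟩
    rw [SetLike.mem_coe, LinearMap.mem_ker]
    simp [mul_comm]

theorem mem_complexIdeal_iff {m : ℕ} {x : Fin m → Fin (n + 1) → k}
    {κ : Module.Dual k (Fin (n + 1) → k)} (h : ∀ i j, i < j → meet κ (x i) (x j) ≠ 0)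
    {f : MvPolynomial (Fin (n + 1)) k} {d : ℕ} (hf : f.IsHomogeneous d) :
    f ∈ complexIdeal x κ ↔ ∀ i j, i < j → eval (meet κ (x i) (x j)) f = 0 := by
  simp only [complexIdeal, Submodule.mem_iInf]
  refine forall_congr' fun i => forall_congr' fun j => forall_congr' fun hij => ?_
  rw [span_pair_inf_ker (h i j hij)]
  exact mem_pointIdeal_iff (h i j hij) hf

end Ideals

end ProjSpace

namespace ProjSpace

/-! ### A configuration with distinct supports is a scheme given by jets. -/

section Geometry

open MvPolynomial

variable {k : Type*} [Field k] {n : ℕ}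

theorem exists_complement_basis {x : Fin (n + 1) → k} (hx : x ≠ 0) :
    ∃ w : Fin n → Fin (n + 1) → k,
      LinearIndependent k fun o : Option (Fin n) => o.elim x w := by
  obtain ⟨C, hC⟩ := Submodule.exists_isCompl (Submodule.span k {x})
  have h1 := Submodule.finrank_add_eq_of_isCompl hC
  rw [finrank_span_singleton hx, Module.finrank_fin_fun] at h1
  let β := Module.finBasisOfFinrankEq k C (n := n) (by omega)
  refine ⟨fun i => β i, ?_⟩
  have hli : LinearIndependent k fun i => (β i : Fin (n + 1) → k) :=
    β.linearIndependent.map' C.subtype C.ker_subtype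
  rw [linearIndependent_option]
  refine ⟨hli, fun hmem => hx ?_⟩
  have hxC : x ∈ C := by
    refine Submodule.span_le.2 ?_ hmem
    rintro _ ⟨i, rfl⟩
    exact (β i).2
  exact (Submodule.disjoint_def.1 hC.disjoint) x (Submodule.mem_span_singleton_self x) hxC

/-- By Euler's relation the derivative along `x` vanishes together with the value, so the `n`
complementary directions suffice. -/
theorem doubleAt_iff_of_linearIndependent {x : Fin (n + 1) → k} {w : Fin n → Fin (n + 1) → k}
    (h : LinearIndependent k fun o : Option (Fin n) => o.elim x w)
    {f : MvPolynomial (Fin (n + 1)) k} {d : ℕ} (hf : f.IsHomogeneous d) :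
    DoubleAt x f ↔ eval x f = 0 ∧ ∀ δ, dirDeriv x (w δ) f = 0 := by
  refine ⟨fun h => ⟨h.1, fun δ => h.2 _⟩, fun ⟨h0, h1⟩ => ⟨h0, fun y => ?_⟩⟩
  have hspan : y ∈ Submodule.span k (Set.range fun o : Option (Fin n) => o.elim x w) := by
    rw [h.span_eq_top_of_card_eq_finrank' (by simp)]
    trivial
  induction hspan using Submodule.span_induction with
  | mem y hy =>
    obtain ⟨_ | δ, rfl⟩ := hy
    · exact (dirDeriv_self hf x).trans (by rw [h0, mul_zero])
    · exact h1 δ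
  | zero => simp [dirDeriv_apply]
  | add a b _ _ ha hb => rw [dirDeriv_add_right, ha, hb, add_zero]
  | smul c a _ ha => rw [dirDeriv_smul_right, ha, mul_zero]

variable {H : Submodule k (Fin (n + 1) → k)} {u m a b v : ℕ}

/-- The points of a configuration, with the simple points restricted to a subset. -/
def Config.pt (A : Finset (Fin a)) (c : Config H u m a b v) :
    {e : Fin m × Fin m // e.1 < e.2} ⊕ Fin u ⊕ A ⊕ Fin b ⊕ Fin v → Fin (n + 1) → k :=
  Sum.elim c.meets (Sum.elim c.1 (Sum.elim (fun i => c.simple i) (Sum.elim (fun i => (c.tangents i).1)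
    fun i => c.2.2.2.2 i)))

/-- The number of tangent directions at the points of a configuration. -/
def tangentCount (n u m b v : ℕ) {a : ℕ} (A : Finset (Fin a)) :
    {e : Fin m × Fin m // e.1 < e.2} ⊕ Fin u ⊕ A ⊕ Fin b ⊕ Fin v → ℕ :=
  Sum.elim (fun _ => 0) (Sum.elim (fun _ => n) (Sum.elim (fun _ => 0) (Sum.elim (fun _ => 1)
    fun _ => n)))

/-- The supports of the components of a configuration are distinct, apart from simple points outside
`A` which lie on a double point. -/
structure Config.Separated (c : Config H u m a b v) (A : Finset (Fin a)) : Prop where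
  ne_zero : ∀ i, c.pt A i ≠ 0
  pairwise : ∀ i j, i ≠ j → LinearIndependent k ![c.pt A i, c.pt A j]
  tangent : ∀ i, LinearIndependent k ![(c.tangents i).1, (c.tangents i).2]
  redundant : ∀ i ∉ A, ∃ (j : Fin v) (s : k), s ≠ 0 ∧
    c.simple i = s • (c.2.2.2.2 j : Fin (n + 1) → k)

theorem Config.Separated.mem_ideal_iff {c : Config H u m a b v} {A : Finset (Fin a)}
    (hc : c.Separated A) {f : MvPolynomial (Fin (n + 1)) k} {d : ℕ} (hf : f.IsHomogeneous d) :
    f ∈ c.ideal ↔ (∀ i, eval (c.meets i) f = 0) ∧ (∀ i, DoubleAt (c.1 i) f) ∧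
      (∀ i : A, eval (c.simple i) f = 0) ∧
      (∀ i, eval (c.tangents i).1 f = 0 ∧ dirDeriv (c.tangents i).1 (c.tangents i).2 f = 0) ∧
      ∀ i, DoubleAt (c.2.2.2.2 i : Fin (n + 1) → k) f := by
  have hm : ∀ i j, i < j → meet c.2.1.2 (c.2.1.1 i) (c.2.1.1 j) ≠ 0 := fun i j hij =>
    hc.ne_zero (.inl ⟨(i, j), hij⟩)
  have hu : ∀ i, c.1 i ≠ 0 := fun i => hc.ne_zero (.inr (.inl i))
  have hv : ∀ i, (c.2.2.2.2 i : Fin (n + 1) → k) ≠ 0 := fun i =>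
    hc.ne_zero (.inr (.inr (.inr (.inr i))))
  have ha : ∀ i, c.simple i ≠ 0 := fun i => by
    by_cases hi : i ∈ A
    · exact hc.ne_zero (.inr (.inr (.inl ⟨i, hi⟩)))
    · obtain ⟨j, s, hs, h⟩ := hc.redundant i hi
      rw [h]
      exact smul_ne_zero hs (hv j)
  have ht : ∀ i, f ∈ tangentIdeal ((c.2.2.2.1 i).1 : Fin (n + 1) → k) (c.2.2.2.1 i).2 ↔ _ :=
    fun i => mem_tangentIdeal_iff (hc.tangent i) hf
  have ha' : ∀ i, f ∈ pointIdeal (c.2.2.1 i : Fin (n + 1) → k) ↔ _ :=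
    fun i => mem_pointIdeal_iff (ha i) hf
  simp only [Config.ideal, Submodule.mem_inf, Submodule.mem_iInf, mem_complexIdeal_iff hm hf,
    mem_doublePointIdeal_iff (hu _) hf, mem_doublePointIdeal_iff (hv _) hf, ht, ha']
  have h1 : (∀ i j, i < j → eval (meet c.2.1.2 (c.2.1.1 i) (c.2.1.1 j)) f = 0) ↔
      ∀ i, eval (c.meets i) f = 0 :=
    ⟨fun h i => h _ _ i.2, fun h i j hij => h ⟨(i, j), hij⟩⟩
  rw [h1]
  constructor
  · rintro ⟨⟨⟨⟨h1, h2⟩, h3⟩, h4⟩, h5⟩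
    exact ⟨h2, h1, fun i => h3 i, h4, h5⟩
  · rintro ⟨h2, h1, h3, h4, h5⟩
    refine ⟨⟨⟨⟨h1, h2⟩, fun i => ?_⟩, h4⟩, h5⟩
    by_cases hi : i ∈ A
    · exact h3 ⟨i, hi⟩
    · obtain ⟨j, s, hs, h⟩ := hc.redundant i hi
      rw [h, eval_smul_of_isHomogeneous hf, (h5 j).1,
        mul_zero]

theorem Config.Separated.exists_jetScheme {c : Config H u m a b v} {A : Finset (Fin a)}
    (hc : c.Separated A) : ∃ Y : JetScheme k n _ fun i => Fin (tangentCount n u m b v A i),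
      Y.ideal = c.ideal := by
  have hsingle : ∀ x : Fin (n + 1) → k, x ≠ 0 → ∀ w : Fin 0 → Fin (n + 1) → k,
      LinearIndependent k fun o : Option (Fin 0) => o.elim x w := fun x hx w => by
    refine linearIndependent_option.2 ⟨linearIndependent_empty_type, fun h => hx ?_⟩
    simpa using h
  have hdouble : ∀ x : Fin (n + 1) → k, x ≠ 0 → ∃ w : Fin n → Fin (n + 1) → k,
      (LinearIndependent k fun o : Option (Fin n) => o.elim x w) ∧
        ∀ (f : MvPolynomial (Fin (n + 1)) k) (d : ℕ), f.IsHomogeneous d →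
          (DoubleAt x f ↔ eval x f = 0 ∧ ∀ δ, dirDeriv x (w δ) f = 0) := fun x hx => by
    obtain ⟨w, hw⟩ := exists_complement_basis hx
    exact ⟨w, hw, fun f d hf => doubleAt_iff_of_linearIndependent hw hf⟩
  have htangent : ∀ x y : Fin (n + 1) → k, LinearIndependent k ![x, y] →
      LinearIndependent k fun o : Option (Fin 1) => o.elim x fun _ => y := fun x y hxy => by
    have hinj : Function.Injective (fun o : Option (Fin 1) => o.elim (0 : Fin 2) fun _ => 1) := by
      decide
    convert hxy.comp _ hinj using 1
    ext (_ | _) <;> rfl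
  choose w₁ hw₁ hw₁' using hdouble
  let dir : ∀ i, Fin (tangentCount n u m b v A i) → Fin (n + 1) → k := fun i =>
    match i with
    | .inl _ => Fin.elim0
    | .inr (.inl i) => w₁ (c.1 i) (hc.ne_zero (.inr (.inl i)))
    | .inr (.inr (.inl _)) => Fin.elim0
    | .inr (.inr (.inr (.inl i))) => fun _ => (c.tangents i).2
    | .inr (.inr (.inr (.inr i))) =>
      w₁ (c.2.2.2.2 i : Fin (n + 1) → k) (hc.ne_zero (.inr (.inr (.inr (.inr i)))))
  have hlin : ∀ i, LinearIndependent k fun o : Option (Fin (tangentCount n u m b v A i)) =>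
      o.elim (c.pt A i) (dir i) := by
    rintro (i | i | i | i | i)
    · exact hsingle _ (hc.ne_zero (.inl i)) _
    · exact hw₁ _ (hc.ne_zero (.inr (.inl i)))
    · exact hsingle _ (hc.ne_zero (.inr (.inr (.inl i)))) _
    · exact htangent _ _ (hc.tangent i)
    · exact hw₁ _ (hc.ne_zero (.inr (.inr (.inr (.inr i)))))
  refine ⟨⟨c.pt A, dir, c.ideal, hc.pairwise, hlin, fun f d hf => ?_⟩, rfl⟩
  rw [hc.mem_ideal_iff hf]
  simp only [Sum.forall]
  refine and_congr ?_ (and_congr ?_ (and_congr ?_ (and_congr ?_ ?_)))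
  · exact forall_congr' fun i => ⟨fun h => ⟨h, fun δ => δ.elim0⟩, fun h => h.1⟩
  · exact forall_congr' fun i => hw₁' _ _ f d hf
  · exact forall_congr' fun i => ⟨fun h => ⟨h, fun δ => δ.elim0⟩, fun h => h.1⟩
  · exact forall_congr' fun i => and_congr_right fun _ => ⟨fun h _ => h, fun h => h (0 : Fin 1)⟩
  · exact forall_congr' fun i => hw₁' _ _ f d hf

theorem sum_tangentCount (A : Finset (Fin a)) :
    ∑ i, (Fintype.card (Fin (tangentCount n u m b v A i)) + 1) =
      (n + 1) * (u + v) + m.choose 2 + A.card + 2 * b := by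
  simp only [Fintype.card_fin]
  simp only [Fintype.card_fin, Fintype.sum_sum_type, tangentCount, Sum.elim_inl, Sum.elim_inr,
    Finset.sum_const, Finset.card_univ, card_lt_pairs, Fintype.card_coe, smul_eq_mul]
  ring

theorem generically_linearIndependent [Infinite k] {E : Type*} [AddCommGroup E] [Module k E]
    {x y : E → Fin (n + 1) → k} (hx : ∀ i, (fun e => x e i) ∈ polyFun k E)
    (hy : ∀ i, (fun e => y e i) ∈ polyFun k E) {e₀ : E}
    (h : LinearIndependent k ![x e₀, y e₀]) :
    Generically k fun e => LinearIndependent k ![x e, y e] := by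
  have key : ∀ e, LinearIndependent k ![x e, y e] ↔
      ∀ s : k × k, (∀ i, s.1 * x e i + s.2 * y e i = 0) → s = 0 := by
    intro e
    rw [LinearIndependent.pair_iff]
    constructor
    · intro h s hs
      exact Prod.ext_iff.2 (h s.1 s.2 (funext hs))
    · intro h s t hst
      exact Prod.ext_iff.1 (h (s, t) (congr_fun hst))
  simp only [key] at h ⊢
  refine generically_injective (fun e (s : k × k) i => s.1 * x e i + s.2 * y e i)
    (fun e i => ⟨fun s t => ?_, fun c s => ?_⟩) (fun s i => ?_) h
  · simp only [Prod.fst_add, Prod.snd_add]; ring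
  · simp only [Prod.smul_fst, Prod.smul_snd, smul_eq_mul]; ring
  · exact add_mem_polyFun (mul_mem_polyFun (const_mem_polyFun _) (hx i))
      (mul_mem_polyFun (const_mem_polyFun _) (hy i))

theorem pt_mem_polyFun (A : Finset (Fin a)) (i j) :
    (fun c : Config H u m a b v => c.pt A i j) ∈ polyFun k (Config H u m a b v) := by
  rcases i with i | i | i | i | i
  · exact meets_mem_polyFun i j
  · exact doubles_mem_polyFun (.inl i) j
  · exact simple_mem_polyFun _ j
  · exact tangents_fst_mem_polyFun i j
  · exact doubles_mem_polyFun (.inr i) j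

/-- Shows that the points of the complex on coordinate vertices cut out by the sum of the
coordinates are distinct. -/
theorem linearIndependent_single_sub {i j i' j' : Fin (n + 1)} (hij : i < j) (hij' : i' < j')
    (hne : (i, j) ≠ (i', j')) : LinearIndependent k
      ![(Pi.single i 1 - Pi.single j 1 : Fin (n + 1) → k), Pi.single i' 1 - Pi.single j' 1] := by
  rw [LinearIndependent.pair_iff]
  intro s t hst
  have h : ∀ x, s * ((if x = i then 1 else 0) - (if x = j then 1 else 0)) +
      t * ((if x = i' then 1 else 0) - (if x = j' then 1 else 0)) = 0 := by
    intro x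
    simpa [Pi.single_apply] using congr_fun hst x
  have h1 := h i
  have h2 := h j
  have h3 := h i'
  have h4 := h j'
  have hne' : i ≠ i' ∨ j ≠ j' := by
    by_contra! H
    exact hne (by rw [H.1, H.2])
  have e1 := hij.ne
  have e2 := hij'.ne
  by_cases a1 : i = i'
  · subst a1
    have a2 : j ≠ j' := hne'.resolve_left (by simp)
    simp [e1.symm, a2, e2.symm, a2.symm] at h2 h4
    exact ⟨h2, h4⟩
  · by_cases a2 : i = j'
    · have a3 : j ≠ i' := fun h => by
        rw [a2] at hij
        exact absurd (hij.trans (h ▸ hij')) (lt_irrefl _)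
      have a4 : j ≠ j' := fun h => e1 (a2.trans h.symm)
      have hs : s = 0 := by simpa [e1.symm, a3, a4] using h2
      subst hs
      simpa [e2] using h3
    · have hs : s = 0 := by simpa [e1, a1, a2] using h1
      subst hs
      simpa [e2] using h3

end Geometry

end ProjSpace

namespace ProjSpace

/-! ### Distinctness of the supports of a generic configuration. -/

section Separation

variable {k : Type*} [Field k] {n : ℕ} {H : Submodule k (Fin (n + 1) → k)} {u m a b v : ℕ}

theorem generically_ne_zero [Infinite k] {E : Type*} [AddCommGroup E] [Module k E]
    {x : E → Fin (n + 1) → k} (hx : ∀ i, (fun e => x e i) ∈ polyFun k E) {e₀ : E}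
    (h : x e₀ ≠ 0) : Generically k fun e => x e ≠ 0 := by
  obtain ⟨i, hi⟩ := Function.ne_iff.1 h
  exact generically_of_polyFun (hx i) hi fun e he h0 => he (congr_fun h0 i)

/-- The points of a configuration which are restricted to the hyperplane. -/
def InHyperplane (A : Finset (Fin a)) : Fin u ⊕ A ⊕ Fin b ⊕ Fin v → Prop :=
  Sum.elim (fun _ => False) fun _ => True

theorem exists_config (A : Finset (Fin a)) (x : Fin m → Fin (n + 1) → k)
    (κ : Module.Dual k (Fin (n + 1) → k)) (y : Fin (n + 1) → k) (z : H)
    {g : Fin u ⊕ A ⊕ Fin b ⊕ Fin v → Fin (n + 1) → k} (hg : ∀ i, InHyperplane A i → g i ∈ H) :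
    ∃ c : Config H u m a b v, c.2.1.1 = x ∧ c.2.1.2 = κ ∧ (∀ i, c.pt A (.inr i) = g i) ∧
      (∀ i, (c.tangents i).2 = y) ∧ ∀ i ∉ A, c.simple i = z := by
  refine ⟨(fun i => g (.inl i), (x, κ),
    fun i => if h : i ∈ A then ⟨g (.inr (.inl ⟨i, h⟩)), hg _ trivial⟩ else z,
    fun i => (⟨g (.inr (.inr (.inl i))), hg _ trivial⟩, y),
    fun i => ⟨g (.inr (.inr (.inr i))), hg _ trivial⟩), rfl, rfl, ?_, fun _ => rfl, ?_⟩
  · rintro (i | i | i | i) <;> simp [Config.pt, Config.simple, Config.tangents]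
  · intro i hi
    simp [Config.simple, hi]

theorem exists_linearIndependent_pair (hn : 1 ≤ n) (hH : Module.finrank k H = n) :
    ∃ x y : Fin (n + 1) → k, LinearIndependent k ![x, y] ∧ x ∈ H ∧ (2 ≤ n → y ∈ H) := by
  have hli : ∀ x : Fin (n + 1) → k, x ≠ 0 → ∀ y, y ∉ Submodule.span k {x} →
      LinearIndependent k ![x, y] := fun x hx y hy =>
    (LinearIndependent.pair_iff' hx).2 fun s hs => hy (Submodule.mem_span_singleton.2 ⟨s, hs⟩)
  obtain ⟨x, hx, h0⟩ := H.exists_mem_ne_zero_of_ne_bot (by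
    rintro rfl
    rw [finrank_bot] at hH
    omega)
  have hs := finrank_span_singleton (K := k) h0
  by_cases h2 : 2 ≤ n
  · obtain ⟨y, hy, hy'⟩ := Set.not_subset.1 (show ¬ H ≤ Submodule.span k {x} from fun h => by
      have := Submodule.finrank_mono h
      omega)
    exact ⟨x, y, hli x h0 y hy', hx, fun _ => hy⟩
  · obtain ⟨y, hy⟩ : ∃ y, y ∉ Submodule.span k {x} := by
      by_contra! h
      rw [(Submodule.eq_top_iff'.2 h), finrank_top, Module.finrank_fin_fun] at hs
      omega
    exact ⟨x, y, hli x h0 y hy, hx, fun h => absurd h h2⟩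

theorem exists_meets (hm : m ≤ n + 1) : ∃ (x : Fin m → Fin (n + 1) → k)
    (κ : Module.Dual k (Fin (n + 1) → k)), ∀ i j, meet κ (x i) (x j) =
      Pi.single (Fin.castLE hm i) 1 - Pi.single (Fin.castLE hm j) 1 := by
  refine ⟨fun i => Pi.single (Fin.castLE hm i) 1, ∑ i, LinearMap.proj i, fun i j => ?_⟩
  simp [meet]

/-- Every condition is open, so each is tested on a configuration of its own. On the projective line
`H` is a single point and carries at most one component; simple points absorbed by a double point
there are the ones left out of `A`. -/
theorem generically_separated [Infinite k] (hn : 1 ≤ n) (hH : Module.finrank k H = n)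
    {A : Finset (Fin a)} (hA : A = Finset.univ ∨ n = 1 ∧ 0 < v) (hm : m ≤ n + 1)
    (hcard : 2 ≤ n ∨ m ≤ 1 ∧ A.card + b + v ≤ 1) :
    Generically k fun c : Config H u m a b v => c.Separated A := by
  obtain ⟨h₀, h₁, hli, hh₀, hh₁⟩ := exists_linearIndependent_pair hn hH
  have hne₀ : h₀ ≠ 0 := by simpa using hli.ne_zero 0
  obtain ⟨x, κ, hx⟩ := exists_meets (k := k) hm
  have hmeet : ∀ e : {e : Fin m × Fin m // e.1 < e.2}, meet κ (x e.1.1) (x e.1.2) ≠ 0 := by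
    intro e he
    have h1 := congr_fun ((hx _ _).symm.trans he) (Fin.castLE hm e.1.1)
    have h2 : Fin.castLE hm e.1.1 ≠ Fin.castLE hm e.1.2 := fun h =>
      e.2.ne ((Fin.castLE_injective hm) h)
    simp [h2] at h1
  obtain ⟨c₀, hx₀, hκ₀, hc₀, hy₀, hz₀⟩ := exists_config (u := u) (b := b) (v := v) A x κ h₁
    ⟨h₀, hh₀⟩ (g := fun _ => h₀) fun _ _ => hh₀
  have hm₀ : ∀ e, c₀.meets e = meet κ (x e.1.1) (x e.1.2) := fun e => by
    rw [Config.meets, hx₀, hκ₀]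
  have hzero : Generically k fun c : Config H u m a b v => ∀ i, c.pt A i ≠ 0 := by
    refine generically_forall fun i => generically_ne_zero (pt_mem_polyFun A i) (e₀ := c₀) ?_
    rcases i with e | i
    · exact (hm₀ e).trans_ne (hmeet e)
    · rw [hc₀]
      exact hne₀
  have hsimple : Generically k fun c : Config H u m a b v => ∀ i, i ∉ A → c.simple i ≠ 0 := by
    refine generically_forall fun i => ?_
    by_cases hi : i ∈ A
    · exact generically_of_forall fun c h => absurd hi h
    · refine (generically_ne_zero (simple_mem_polyFun i) (e₀ := c₀) ?_).mono fun c h _ => h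
      rw [hz₀ i hi]
      exact hne₀
  have htangent : Generically k fun c : Config H u m a b v =>
      ∀ i, LinearIndependent k ![(c.tangents i).1, (c.tangents i).2] := by
    refine generically_forall fun i => generically_linearIndependent (tangents_fst_mem_polyFun i)
      (tangents_snd_mem_polyFun i) (e₀ := c₀) ?_
    rw [hy₀, show (c₀.tangents i).1 = h₀ from hc₀ (.inr (.inr (.inl i)))]
    exact hli
  have hmixed : ∀ e i, ∃ c : Config H u m a b v,
      LinearIndependent k ![c.pt A (.inl e), c.pt A (.inr i)] := by
    intro e i
    have h2 : 2 ≤ n := hcard.resolve_right fun h => by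
      have := e.1.1.2
      have := e.1.2.2
      have : (e.1.1 : ℕ) < e.1.2 := e.2
      omega
    have : ∃ h ∈ H, LinearIndependent k ![meet κ (x e.1.1) (x e.1.2), h] := by
      by_contra! hc
      have hspan : H ≤ Submodule.span k {meet κ (x e.1.1) (x e.1.2)} := fun h hh => by
        by_contra hs
        exact hc h hh ((LinearIndependent.pair_iff' (hmeet e)).2
          fun s hs' => hs (Submodule.mem_span_singleton.2 ⟨s, hs'⟩))
      have := Submodule.finrank_mono hspan
      rw [finrank_span_singleton (hmeet e)] at this
      omega
    obtain ⟨h, hh, hl⟩ := this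
    obtain ⟨c, h1, h2, h3, -⟩ := exists_config (u := u) (b := b) (v := v) A x κ 0 (0 : H)
      (g := fun _ => h) fun _ _ => hh
    refine ⟨c, ?_⟩
    rw [h3, show c.pt A (.inl e) = meet κ (x e.1.1) (x e.1.2) by
      rw [← h1, ← h2]; rfl]
    exact hl
  have hpair : Generically k fun c : Config H u m a b v =>
      ∀ i j, i ≠ j → LinearIndependent k ![c.pt A i, c.pt A j] := by
    refine generically_forall fun i => generically_forall fun j => ?_
    by_cases hij : i = j
    · exact generically_of_forall fun c h => absurd hij h
    suffices ∃ c : Config H u m a b v, LinearIndependent k ![c.pt A i, c.pt A j] by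
      obtain ⟨c, hc⟩ := this
      exact (generically_linearIndependent (pt_mem_polyFun A i) (pt_mem_polyFun A j) hc).mono
        fun c h _ => h
    rcases i with e | i <;> rcases j with e' | j
    · refine ⟨c₀, ?_⟩
      rw [show c₀.pt A (.inl e) = _ from hm₀ e, show c₀.pt A (.inl e') = _ from hm₀ e', hx, hx]
      refine linearIndependent_single_sub e.2 e'.2 fun h => hij ?_
      rw [Prod.ext_iff] at h
      exact congr_arg _ (Subtype.ext (Prod.ext (Fin.castLE_injective hm h.1)
        (Fin.castLE_injective hm h.2)))
    · exact hmixed e j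
    · obtain ⟨c, hc⟩ := hmixed e' i
      exact ⟨c, LinearIndependent.pair_symm_iff.1 hc⟩
    · classical
      have hij' : i ≠ j := fun h => hij (congr_arg _ h)
      have key : ∃ p q : Fin (n + 1) → k, LinearIndependent k ![p, q] ∧
          (InHyperplane A i → p ∈ H) ∧ (InHyperplane A j → q ∈ H) := by
        by_cases h2 : 2 ≤ n
        · exact ⟨h₀, h₁, hli, fun _ => hh₀, fun _ => hh₁ h2⟩
        · have hc := (hcard.resolve_left h2).2
          rcases i with i | i
          · exact ⟨h₁, h₀, LinearIndependent.pair_symm_iff.1 hli, False.elim, fun _ => hh₀⟩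
          · rcases j with j | j
            · exact ⟨h₀, h₁, hli, fun _ => hh₀, False.elim⟩
            · have hs : Fintype.card (A ⊕ Fin b ⊕ Fin v) ≤ 1 := by
                simp only [Fintype.card_sum, Fintype.card_coe, Fintype.card_fin]
                omega
              exact absurd (congr_arg _ (Fintype.card_le_one_iff.1 hs i j)) hij'
      obtain ⟨p, q, hpq, hp, hq⟩ := key
      obtain ⟨c, -, -, h3, -⟩ := exists_config (u := u) (m := m) (b := b) (v := v) A 0 0 0 (0 : H)
        (g := fun z => if z = i then p else if z = j then q else 0) (by
          intro z hz
          split_ifs with h1 h2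
          · exact hp (h1 ▸ hz)
          · exact hq (h2 ▸ hz)
          · exact H.zero_mem)
      refine ⟨c, ?_⟩
      rw [h3, h3, if_pos rfl, if_neg hij'.symm, if_pos rfl]
      exact hpq
  refine (hzero.and (hsimple.and (htangent.and hpair))).mono fun c ⟨h1, h2, h3, h4⟩ =>
    ⟨h1, h4, h3, fun i hi => ?_⟩
  obtain ⟨rfl, hv⟩ := hA.resolve_left fun h => hi (h ▸ Finset.mem_univ i)
  have hw : c.2.2.2.2 ⟨0, hv⟩ ≠ 0 := fun h => h1 (.inr (.inr (.inr (.inr ⟨0, hv⟩))))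
    (congr_arg Subtype.val h)
  obtain ⟨s, hs⟩ := (finrank_eq_one_iff_of_nonzero' _ hw).1 hH (c.2.2.1 i)
  refine ⟨⟨0, hv⟩, s, ?_, (congr_arg Subtype.val hs).symm⟩
  rintro rfl
  exact h2 i hi (by rw [Config.simple, ← hs, zero_smul]; rfl)

end Separation

end ProjSpace

namespace ProjSpace

/-! ### Arithmetic of the numbers of points. -/

section Numerics

theorem six_mul_choose_three (n : ℕ) : 6 * (n + 3).choose 3 = (n + 3) * (n + 2) * (n + 1) := by
  have := Nat.descFactorial_eq_factorial_mul_choose (n + 3) 3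
  simp [Nat.descFactorial, Nat.factorial] at this
  linarith

theorem twentyFour_mul_choose_four (n : ℕ) :
    24 * (n + 3).choose 4 = (n + 3) * (n + 2) * (n + 1) * n := by
  have := Nat.descFactorial_eq_factorial_mul_choose (n + 3) 4
  simp [Nat.descFactorial, Nat.factorial] at this
  linarith

theorem two_mul_choose_two_add (n : ℕ) : 2 * n.choose 2 + n = n * n := by
  induction n with
  | zero => rfl
  | succ n ih =>
    rw [Nat.choose_succ_succ' n 1, Nat.choose_one_right]
    linarith

/-- The lower bound on `a + b` keeps the double points within the number available in special
position. -/
theorem card_double_le {n r s : ℕ} (hc : (n + 1) * r + s = (n + 3).choose 3)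
    (hs : n * n ≤ 2 * s + n) :
    r ≤ n + 1 + (3 * (n / 3).choose 2 + n / 3 * (n % 3)) := by
  by_contra! h
  have h6 := six_mul_choose_three n
  have h2 := two_mul_choose_two_add (n / 3)
  have hlt : n % 3 < 3 := Nat.mod_lt _ (by norm_num)
  have hdiv : n = 3 * (n / 3) + n % 3 := (Nat.div_add_mod n 3).symm
  generalize (n / 3).choose 2 = C at *
  generalize n / 3 = q at *
  generalize n % 3 = e at *
  have h3 : 2 * n + 4 + 3 * (q * q) + 2 * (q * e) ≤ 2 * r + 3 * q := by nlinarith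
  have h4 := Nat.mul_le_mul_left (n + 1) h3
  rw [← hc] at h6
  subst hdiv
  interval_cases e <;> nlinarith

/-- The upper bound on `a + b` forces many double points; as `v ≤ 1`, at least `n + 1` of them are
free and the quadrics vanish at once. -/
theorem lt_card_double {n r m s a b : ℕ} (hn : 6 ≤ n) (hm : 2 * m ≤ n + 2) (hb : b < n)
    (hs : s = a + b) (hc : (n + 1) * r + m.choose 2 + s + b = (n + 3).choose 3)
    (h : 2 * n * s + n ≤ 2 * (n + 3).choose 4 + n * n) : n + 2 ≤ r := by
  by_contra! h'
  have h6 := six_mul_choose_three n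
  have h24 := twentyFour_mul_choose_four n
  have h2 := two_mul_choose_two_add m
  have h1 : 24 * s ≤ (n + 3) * (n + 2) * (n + 1) + 12 * n - 12 := by
    have : n * (24 * s + 12) ≤ n * ((n + 3) * (n + 2) * (n + 1) + 12 * n) := by nlinarith
    have := Nat.le_of_mul_le_mul_left this (by omega)
    omega
  have h3 : 8 * m.choose 2 ≤ (n + 2) * n := by
    obtain ⟨d, hd⟩ := Nat.exists_eq_add_of_le hm
    nlinarith [Nat.zero_le (d * m), Nat.zero_le (d * d)]
  have h4 : (n + 1) * r ≤ (n + 1) * (n + 1) := Nat.mul_le_mul_left _ (by omega)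
  obtain ⟨t, rfl⟩ := Nat.exists_eq_add_of_le hn
  have h5 : 24 * s + 12 ≤ (6 + t + 3) * (6 + t + 2) * (6 + t + 1) + 12 * (6 + t) := by omega
  nlinarith [Nat.zero_le (t * t), Nat.zero_le (t * t * t)]

/-- For `n ≤ 5` the cases are enumerated. The three exceptional triples violate the lower bound on
`a + b`, but their numbers of double points, 6, 8 and 10, are exactly the largest available in
special position. -/
theorem special_position_numerics {n u a b v m : ℕ} (hn : 2 ≤ n) (hv : v ≤ 1) (hv2 : n = 2 → v = 0)
    (ha : n ≤ a + 1) (hm : 2 * m ≤ n + 2) (hb : b < n)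
    (hab : (2 * n * (a + b) + n ≤ 2 * (n + 3).choose 4 + n * n ∧ n * n ≤ 2 * (a + b) + n) ∨
      (n = 4 ∧ a = 5 ∧ b = 0 ∧ v = 0 ∧ m = 0) ∨ (n = 5 ∧ a = 8 ∧ b = 0 ∧ v = 1 ∧ m = 0) ∨
      (n = 6 ∧ a = 14 ∧ b = 0 ∧ v = 0 ∧ m = 0))
    (hc : (n + 1) * (u + v) + m.choose 2 + a + 2 * b = (n + 3).choose 3) :
    ((n + 1 ≤ u + v ∧ u + v ≤ n + 1 + (3 * (n / 3).choose 2 + n / 3 * (n % 3))) ∨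
      (u + v = n ∧ 1 ≤ b ∧ n ≤ a + 1 ∧ 1 ≤ n) ∨ (u + v = n ∧ b = 0 ∧ n + 1 ≤ a)) ∧
    (n + 1 ≤ u ∨ (u = n ∧ (1 ≤ v ∨ 1 ≤ b ∨ 2 ≤ m)) ∨
      (u + 1 = n ∧ 2 ≤ n ∧ 1 ≤ v ∧ 1 ≤ b ∧ (2 ≤ b ∨ 2 ≤ m))) := by
  rcases hab with ⟨h1, h2⟩ | ⟨rfl, rfl, rfl, rfl, rfl⟩ | ⟨rfl, rfl, rfl, rfl, rfl⟩ |
    ⟨rfl, rfl, rfl, rfl, rfl⟩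
  · have hle := card_double_le (n := n) (r := u + v) (s := m.choose 2 + a + 2 * b)
      (by omega) (by omega)
    by_cases h6 : 6 ≤ n
    · have := lt_card_double (n := n) (r := u + v) h6 hm hb rfl (by omega) h1
      omega
    · have e5 : Nat.choose 5 3 = 10 := rfl
      have e6 : Nat.choose 6 3 = 20 := rfl
      have e7 : Nat.choose 7 3 = 35 := rfl
      have e8 : Nat.choose 8 3 = 56 := rfl
      have f5 : Nat.choose 5 4 = 5 := rfl
      have f6 : Nat.choose 6 4 = 15 := rfl
      have f7 : Nat.choose 7 4 = 35 := rfl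
      have f8 : Nat.choose 8 4 = 70 := rfl
      have g0 : Nat.choose 0 2 = 0 := rfl
      have g1 : Nat.choose 1 2 = 0 := rfl
      have g2 : Nat.choose 2 2 = 1 := rfl
      have g3 : Nat.choose 3 2 = 3 := rfl
      have hm3 : m ≤ 3 := by omega
      have hn5 : n ≤ 5 := by omega
      clear h6
      interval_cases n <;> interval_cases m <;>
        simp only [Nat.reduceAdd, Nat.reduceMul, e5, e6, e7, e8, f5, f6, f7, f8, g0, g1, g2, g3]
          at hc h1 h2 hle <;> omega
  · simp [Nat.choose] at hc ⊢
    omega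
  · simp [Nat.choose] at hc ⊢
    omega
  · simp [Nat.choose] at hc ⊢
    omega

end Numerics

end ProjSpace

namespace ProjSpace

/-! ### From the absence of cubics to adjustedness. -/

section Adjusted

open MvPolynomial

variable {k : Type*} [Field k] {n : ℕ} {H : Submodule k (Fin (n + 1) → k)} {u m a b v : ℕ}

theorem Config.Separated.adjusted [Infinite k] {c : Config H u m a b v}
    {A : Finset (Fin a)} (hc : c.Separated A)
    (hcount : (n + 1) * (u + v) + m.choose 2 + A.card + 2 * b = (n + 3).choose 3)
    (h : NoForm 3 c.doubles (c.points c.simple) c.tangents) : Adjusted c.ideal 3 := by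
  obtain ⟨Y, hY⟩ := hc.exists_jetScheme
  rw [← hY]
  refine Y.adjusted ((sum_tangentCount A).trans hcount) fun f hf hfY => ?_
  rw [hY, hc.mem_ideal_iff hf] at hfY
  obtain ⟨h1, h2, h3, h4, h5⟩ := hfY
  refine h f hf (Sum.forall.2 ⟨h2, h5⟩) (Sum.forall.2 ⟨h1, fun i => ?_⟩) h4
  by_cases hi : i ∈ A
  · exact h3 ⟨i, hi⟩
  · obtain ⟨j, s, -, e⟩ := hc.redundant i hi
    simp only [Config.points, Sum.elim_inr]
    rw [e, eval_smul_of_isHomogeneous hf, (h5 j).1, mul_zero]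

theorem Config.Separated.count_eq [Infinite k] (hn : 1 ≤ n) {c : Config H u m a b v}
    {A : Finset (Fin a)} (hc : c.Separated A) (h : NumericallyAdjusted c.ideal 3) :
    (n + 1) * (u + v) + m.choose 2 + A.card + 2 * b = (n + 3).choose 3 := by
  obtain ⟨Y, hY⟩ := hc.exists_jetScheme
  have h1 := Y.eulerChar_eq hn 3
  rw [hY, show eulerChar c.ideal 3 = 0 from h, sum_tangentCount] at h1
  omega

theorem generically_adjusted [Infinite k] (hn : 1 ≤ n) (hH : Module.finrank k H = n)
    {A : Finset (Fin a)} (hA : A = Finset.univ ∨ n = 1 ∧ 0 < v) (hm : m ≤ 2 * (n / 3) + n % 3)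
    (hcard : 2 ≤ n ∨ m ≤ 1 ∧ A.card + b + v ≤ 1) (hbv : b + v ≤ n)
    (hr : (n + 1 ≤ u + v ∧ u + v ≤ n + 1 + (3 * (n / 3).choose 2 + n / 3 * (n % 3))) ∨
      (u + v = n ∧ 1 ≤ b ∧ n ≤ A.card + 1 ∧ 1 ≤ n) ∨ (u + v = n ∧ b = 0 ∧ n + 1 ≤ A.card))
    (hquad : n + 1 ≤ u ∨ (u = n ∧ (1 ≤ v ∨ 1 ≤ b ∨ 2 ≤ m)) ∨
      (u + 1 = n ∧ 2 ≤ n ∧ 1 ≤ v ∧ 1 ≤ b ∧ (2 ≤ b ∨ 2 ≤ m)))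
    (hcount : (n + 1) * (u + v) + m.choose 2 + A.card + 2 * b = (n + 3).choose 3) :
    Generically k fun c : Config H u m a b v => Adjusted c.ideal 3 := by
  obtain ⟨p, x, κ, t, h⟩ := exists_special_position (k := k) hm hr hcount
  have hA' : A.card ≤ a := by simpa using A.card_le_univ
  exact ((generically_separated hn hH hA (by omega) hcard).and
    (generically_no_cubic (a := a) hn hH hbv (h.trans hA') hquad)).mono
      fun c hc => hc.1.adjusted hcount hc.2

end Adjusted

end ProjSpace

theorem proposition6p3 {k : Type*} [Field k] [IsAlgClosed k] (n : ℕ) (hn : 1 ≤ n)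
    (H : Submodule k (Fin (n + 1) → k)) (hH : Module.finrank k H = n)
    (u a b v : ℕ) (l : ℤ)
    (hv : v ≤ 1) (hv2 : n = 2 → v = 0)
    (ha : (n : ℚ) - 1 ≤ a)
    (hab : ((a : ℚ) + b ≤ (1 / (n : ℚ)) * ((n + 3).choose 4 : ℚ) + ((n : ℚ) - 1) / 2 ∧
        (n : ℚ) * ((n : ℚ) - 1) / 2 ≤ (a : ℚ) + b) ∨
      (n = 4 ∧ a = 5 ∧ b = 0 ∧ v = 0 ∧ l = -1) ∨
      (n = 5 ∧ a = 8 ∧ b = 0 ∧ v = 1 ∧ l = -1) ∨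
      (n = 6 ∧ a = 14 ∧ b = 0 ∧ v = 0 ∧ l = -1))
    (hb : b < n)
    (hl : -1 ≤ l) (hl2 : (l : ℚ) ≤ ((n : ℚ) + 2) / 2)
    (hnum : ProjSpace.Generically k fun Y : ProjSpace.Config H u l.toNat a b v =>
      ProjSpace.NumericallyAdjusted Y.ideal 3) :
    ProjSpace.Generically k fun Y : ProjSpace.Config H u l.toNat a b v =>
      ProjSpace.Adjusted Y.ideal 3 := by
  have : Infinite k := IsAlgClosed.instInfinite
  have hbv : b + v ≤ n := by omega
  have hn0 : (0 : ℚ) < n := by exact_mod_cast hn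
  have ha' : n ≤ a + 1 := by
    have : (n : ℚ) ≤ a + 1 := by linarith
    exact_mod_cast this
  have hm : 2 * l.toNat ≤ n + 2 := by
    have h1 : (2 * l : ℚ) ≤ n + 2 := by linarith
    have h2 : 2 * l ≤ n + 2 := by exact_mod_cast h1
    omega
  obtain rfl | hn2 : n = 1 ∨ 2 ≤ n := by omega
  · have hb0 : b = 0 := by omega
    subst hb0
    have ha1 : a ≤ 1 := by
      obtain ⟨h, -⟩ := hab.resolve_right (by omega)
      norm_num [Nat.choose] at h
      exact h
    -- On the projective line `H` is one point. If it carries a double point, the simple point is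
    -- contained in it and does not count.
    obtain ⟨A, hA, hAv, hAa⟩ : ∃ A : Finset (Fin a), (A = Finset.univ ∨ 1 = 1 ∧ 0 < v) ∧
        A.card + v ≤ 1 ∧ (v = 0 → A.card = a) := by
      obtain rfl | h1 : v = 0 ∨ v = 1 := by omega
      · exact ⟨Finset.univ, .inl rfl, by simpa using ha1, by simp⟩
      · exact ⟨∅, .inr ⟨rfl, by omega⟩, by simp [h1], by omega⟩
    obtain ⟨c, hc, hcn⟩ := ((ProjSpace.generically_separated le_rfl hH hA (by omega)
      (.inr ⟨by omega, by omega⟩)).and hnum).exists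
    have hcount := hc.count_eq le_rfl hcn
    have hm1 : l.toNat.choose 2 = 0 := Nat.choose_eq_zero_of_lt (by omega)
    have h4 : Nat.choose (1 + 3) 3 = 4 := rfl
    refine ProjSpace.generically_adjusted le_rfl hH hA (by omega) (.inr ⟨by omega, by omega⟩) hbv
      (.inl ⟨by omega, by simp; omega⟩) (by omega) hcount
  -- A single configuration that is both separated and numerically adjusted turns the hypothesis
  -- into an equality of integers, which no longer depends on the configuration.
  · obtain ⟨c, hc, hcn⟩ := ((ProjSpace.generically_separated hn hH (.inl rfl) (by omega)
      (.inl hn2)).and hnum).exists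
    have hcount := hc.count_eq hn hcn
    have hcount' := hcount
    rw [Finset.card_univ, Fintype.card_fin] at hcount'
    obtain ⟨hr, hquad⟩ := ProjSpace.special_position_numerics hn2 hv hv2 ha' hm hb (by
      refine hab.imp (fun ⟨h1, h2⟩ => ⟨?_, ?_⟩) (by omega)
      · have e : (n : ℚ) * (1 / n * ((n + 3).choose 4 : ℚ)) = (n + 3).choose 4 := by field_simp
        have : 2 * (n : ℚ) * (a + b) + n ≤ 2 * ((n + 3).choose 4 : ℚ) + n * n := by nlinarith
        exact_mod_cast this
      · have : (n : ℚ) * n ≤ 2 * (a + b) + n := by linarith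
        exact_mod_cast this) hcount'
    exact ProjSpace.generically_adjusted hn hH (.inl rfl) (by omega) (.inl hn2) hbv
      (by simpa using hr) hquad hcount
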